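/- **Setting.** Let $M$ be a smooth ($C^\infty$, Hausdorff, $\sigma$-compact) manifold of dimension $N\ge 3$. A *Finsler space* $\mathcal F^N=(M,F)$ consists of an open set $\mathcal D\subset TM\setminus 0$ of admissible tangent vectors, which meets every $T_xM$ and satisfies $(x,ky)\in\mathcal D$ for $(x,y)\in\mathcal D$, $k>0$ (the choice $\mathcal D=TM\setminus0$ is allowed), and a smooth function $F:\mathcal D\to(0,\infty)$ with $F(x,ky)=kF(x,y)$ for $k>0$, such that the metric tensor $g_{mn}(x,y)=\tfrac12\,\partial^2F^2/\partial y^m\partial y^n$ is positive definite on $\mathcal D$. The indicatrix at $x$ is $\{y\in T_xM:(x,y)\in\mathcal D,\ F(x,y)=1\}$, with the Riemannian metric induced by $g(x,\cdot)$. We say that *the indicatrix is a space of constant curvature* $K=K(x)$ if for every $x\in M$ the indicatrix at $x$ has constant curvature $K(x)$, where $K(x)$ may depend on $x$. Let $S$ be a smooth Riemannian metric on $M$, with $S_x$ the inner product on $T_xM$, and let $H:M\to(0,\infty)$ be a function. A *conformal automorphism* of degree $H$ with multiplier $q$ on an open conic set $W\subset\mathcal D$ is an injective map $(x,y)\mapsto(x,\bar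 y(x,y))$, $W\to TM$, smooth in $(x,y)$, together with a function $q:W\to(0,\infty)$, such that - $\bar y(x,ky)=k^{H(x)}\,\bar y(x,y)$ for $k>0$; - $F(x,y)=1$ implies $S_x(\bar y,\bar y)=1$ (unit vectors are sent to unit vectors); - $g(x,y)(\xi,\eta)=q(x,y)\,S_x(\bar y'\xi,\bar y'\eta)$ for all $\xi,\eta\in T_xM$, where $\bar y'$ is the differential of $\bar y(x,\cdot)$ at $y$. $\mathcal F^N$ is *conformally automorphic to the Riemannian space $(M,S)$ with degree $H$* if every point of $\mathcal D$ lies in such an open conic set $W$ on which there is a conformal automorphism of degree $H$ (the notion is local in the base manifold and in the tangent spaces). **Proposition 2.1.** A Finsler space $\mathcal F^N$, $N\ge3$, is conformally automorphic to some Riemannian space $(M,S)$, with some degree $H>0$, if and only if its indicatrix is a space of constant positive curvature $K=K(x)>0$. If $\mathcal F^N$ is conformally automorphic to $(M,S)$ with degree $H$, then the indicatrix is a space of constant curvature, its curvature is $H(x)^2$ (and no other value) for every $x\in M$, and every conformal automorphism of degree $H$ to $(M,S)$ has the multiplier $q=p^2$ with $$p=\frac1H\,F^{1-H}.$$ -/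

import Mathlib

open scoped Manifold ContDiff

noncomputable section

namespace FinslerConformal

/-! ### Curvature of a Riemannian metric given in coordinates

A metric on (an open part of) `ℝⁿ` is a matrix-valued function `γ`, with `γ u i j = γ_{ij}(u)`. -/

/-- The partial derivative `∂f/∂uⁱ` at the point `u`. -/
def partialDeriv {n : ℕ} (i : Fin n) (f : EuclideanSpace ℝ (Fin n) → ℝ)
    (u : EuclideanSpace ℝ (Fin n)) : ℝ :=
  fderiv ℝ f u (EuclideanSpace.single i 1)

/-- The Christoffel symbol of the second kind
`Γᵏ_{ij} = ½ ∑ₗ γᵏˡ (∂ᵢ γ_{jl} + ∂ⱼ γ_{il} - ∂ₗ γ_{ij})`. -/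
def christoffel {n : ℕ} (γ : EuclideanSpace ℝ (Fin n) → Matrix (Fin n) (Fin n) ℝ)
    (k i j : Fin n) (u : EuclideanSpace ℝ (Fin n)) : ℝ :=
  (1 / 2 : ℝ) * ∑ l, (γ u)⁻¹ k l *
    (partialDeriv i (fun w => γ w j l) u + partialDeriv j (fun w => γ w i l) u
      - partialDeriv l (fun w => γ w i j) u)

/-- The component `Rˡ_{kij}` of the Riemann curvature tensor, that is, the `l`-th component
of `R(∂ᵢ, ∂ⱼ) ∂ₖ = ∇ᵢ ∇ⱼ ∂ₖ - ∇ⱼ ∇ᵢ ∂ₖ`. -/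
def riemannTensor {n : ℕ} (γ : EuclideanSpace ℝ (Fin n) → Matrix (Fin n) (Fin n) ℝ)
    (l k i j : Fin n) (u : EuclideanSpace ℝ (Fin n)) : ℝ :=
  partialDeriv i (christoffel γ l j k) u - partialDeriv j (christoffel γ l i k) u
    + ∑ m, (christoffel γ l i m u * christoffel γ m j k u
      - christoffel γ l j m u * christoffel γ m i k u)

/-- The metric `γ` has constant curvature `K` on the set `V`:
`R(X, Y) Z = K (⟨Y, Z⟩ X - ⟨X, Z⟩ Y)` at all points of `V`. -/
def HasConstantCurvatureOn {n : ℕ}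
    (γ : EuclideanSpace ℝ (Fin n) → Matrix (Fin n) (Fin n) ℝ)
    (V : Set (EuclideanSpace ℝ (Fin n))) (K : ℝ) : Prop :=
  ∀ u ∈ V, ∀ l k i j : Fin n,
    riemannTensor γ l k i j u =
      K * (γ u j k * (if l = i then 1 else 0) - γ u i k * (if l = j then 1 else 0))

/-! ### Finsler spaces -/

/-- The second-order derivative tensor `½ ∂²f² / ∂yᵐ∂yⁿ` of a function `f` on `ℝᴺ`, evaluated at
the point `y` on the vectors `ξ, η`. -/
def halfHessianSq {N : ℕ} (f : EuclideanSpace ℝ (Fin N) → ℝ)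
    (y ξ η : EuclideanSpace ℝ (Fin N)) : ℝ :=
  (1 / 2 : ℝ) * fderiv ℝ (fun z => fderiv ℝ (fun w => f w ^ 2) z ξ) y η

/-- A Finsler space over the `N`-dimensional smooth manifold `M`. The Finsler metric function
`F` lives on an open conic part `domain` of the slit tangent bundle which meets every tangent space;
it is smooth, positive, positively homogeneous of degree one, and its fundamental tensor
`g = ½ ∂²F² / ∂y∂y` is positive definite. The choice `domain = {v | v.2 ≠ 0}` is allowed.

Recall that `TangentSpace (𝓡 N) x` is by definition a copy of `EuclideanSpace ℝ (Fin N)`; calculus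
in the fixed tangent space at `x` is done in that copy. -/
structure FinslerSpace (N : ℕ) (M : Type*) [TopologicalSpace M]
    [ChartedSpace (EuclideanSpace ℝ (Fin N)) M] [IsManifold (𝓡 N) ∞ M] where
  /-- The set of admissible tangent vectors. -/
  domain : Set (TangentBundle (𝓡 N) M)
  /-- The Finsler metric function. -/
  F : TangentBundle (𝓡 N) M → ℝ
  isOpen_domain : IsOpen domain
  ne_zero : ∀ v ∈ domain, v.2 ≠ 0
  conic : ∀ v ∈ domain, ∀ k : ℝ, 0 < k → (⟨v.1, k • v.2⟩ : TangentBundle (𝓡 N) M) ∈ domain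
  fiber_nonempty : ∀ x : M, ∃ y : TangentSpace (𝓡 N) x,
    (⟨x, y⟩ : TangentBundle (𝓡 N) M) ∈ domain
  smooth : ContMDiffOn (𝓡 N).tangent 𝓘(ℝ, ℝ) ∞ F domain
  pos : ∀ v ∈ domain, 0 < F v
  homogeneous : ∀ v ∈ domain, ∀ k : ℝ, 0 < k → F ⟨v.1, k • v.2⟩ = k * F v
  posDef : ∀ v ∈ domain, ∀ ξ : EuclideanSpace ℝ (Fin N), ξ ≠ 0 →
    0 < halfHessianSq (fun w => F ⟨v.1, w⟩) v.2 ξ ξ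

variable {N : ℕ} {M : Type*} [TopologicalSpace M]
  [ChartedSpace (EuclideanSpace ℝ (Fin N)) M] [IsManifold (𝓡 N) ∞ M]

/-- The Finslerian metric tensor `g_{mn}(x, y) = ½ ∂²F² / ∂yᵐ∂yⁿ`, where `v = (x, y)`. -/
def FinslerSpace.metricTensor (Φ : FinslerSpace N M) (v : TangentBundle (𝓡 N) M)
    (ξ η : EuclideanSpace ℝ (Fin N)) : ℝ :=
  halfHessianSq (fun w => Φ.F ⟨v.1, w⟩) v.2 ξ η

/-- The indicatrix `{y ∈ T_x M | F(x, y) = 1}`. -/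
def FinslerSpace.indicatrix (Φ : FinslerSpace N M) (x : M) : Set (EuclideanSpace ℝ (Fin N)) :=
  {y | (⟨x, y⟩ : TangentBundle (𝓡 N) M) ∈ Φ.domain ∧ Φ.F ⟨x, y⟩ = 1}

/-- A local parametrization of the indicatrix at `x`: a smooth immersion `φ` of an open set `V` of
`ℝᴺ⁻¹` into `T_x M` with values in the indicatrix. -/
structure FinslerSpace.IsIndicatrixParam (Φ : FinslerSpace N M) (x : M)
    (V : Set (EuclideanSpace ℝ (Fin (N - 1))))
    (φ : EuclideanSpace ℝ (Fin (N - 1)) → EuclideanSpace ℝ (Fin N)) : Prop where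
  isOpen : IsOpen V
  smooth : ContDiffOn ℝ ∞ φ V
  mapsTo : Set.MapsTo φ V (Φ.indicatrix x)
  immersion : ∀ u ∈ V, Function.Injective (fderiv ℝ φ u)

/-- The metric induced on the indicatrix at `x` by the Finslerian metric tensor, in the local
parameters given by `φ`: `γ_{ij}(u) = g(x, φ(u)) (∂ᵢφ, ∂ⱼφ)`. -/
def FinslerSpace.inducedMetric (Φ : FinslerSpace N M) (x : M)
    (φ : EuclideanSpace ℝ (Fin (N - 1)) → EuclideanSpace ℝ (Fin N))
    (u : EuclideanSpace ℝ (Fin (N - 1))) : Matrix (Fin (N - 1)) (Fin (N - 1)) ℝ :=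
  Matrix.of fun i j => Φ.metricTensor ⟨x, φ u⟩
    (fderiv ℝ φ u (EuclideanSpace.single i 1)) (fderiv ℝ φ u (EuclideanSpace.single j 1))

/-- For every `x`, the indicatrix at `x`, with the Riemannian metric induced by the Finslerian
metric tensor, is a space of constant curvature `K x`. -/
def FinslerSpace.IndicatrixHasConstantCurvature (Φ : FinslerSpace N M) (K : M → ℝ) : Prop :=
  ∀ (x : M) (V : Set (EuclideanSpace ℝ (Fin (N - 1))))
    (φ : EuclideanSpace ℝ (Fin (N - 1)) → EuclideanSpace ℝ (Fin N)),
    Φ.IsIndicatrixParam x V φ → HasConstantCurvatureOn (Φ.inducedMetric x φ) V (K x)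

/-! ### Conformal automorphisms -/


/-- Smooth Riemannian metrics on the manifold `M`. -/
abbrev RiemMetric (N : ℕ) (M : Type*) [TopologicalSpace M]
    [ChartedSpace (EuclideanSpace ℝ (Fin N)) M] [IsManifold (𝓡 N) ∞ M] :=
  Bundle.ContMDiffRiemannianMetric (𝓡 N) ∞ (EuclideanSpace ℝ (Fin N))
    (fun x : M => TangentSpace (𝓡 N) x)

/-- The map `(x, y) ↦ (x, C(x, y))` of the tangent bundle over the identity of `M` determined by a
family `C` of (in general non-linear) maps of the tangent spaces. -/
def totalMap (C : (x : M) → TangentSpace (𝓡 N) x → TangentSpace (𝓡 N) x)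
    (v : TangentBundle (𝓡 N) M) : TangentBundle (𝓡 N) M :=
  ⟨v.1, C v.1 v.2⟩

/-- The differential at `y` of the map `C x` of the tangent space at `x`. -/
def tangentDeriv (C : (x : M) → TangentSpace (𝓡 N) x → TangentSpace (𝓡 N) x)
    (v : TangentBundle (𝓡 N) M) :
    EuclideanSpace ℝ (Fin N) →L[ℝ] EuclideanSpace ℝ (Fin N) :=
  fderiv ℝ (fun w : EuclideanSpace ℝ (Fin N) => (C v.1 w : EuclideanSpace ℝ (Fin N))) v.2

/-- `ȳ = C(x, y)`, defined on the open conic set `W` of tangent vectors, is a conformal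
automorphism between the Finsler space and the Riemannian space `(M, S)`, of degree `H x` and with
conformal multiplier `q`: it is smooth and invertible, it keeps the base points, it is positively
homogeneous of degree `H x` in `y`, it carries Finslerian unit vectors to Riemannian unit vectors,
and `g(x, y) (ξ, η) = q(x, y) S_x(C'ξ, C'η)`, where `C'` is the differential of `C(x, ·)` at `y`. -/
structure IsConformalAutomorphismOn (Φ : FinslerSpace N M) (S : RiemMetric N M)
    (H : M → ℝ) (W : Set (TangentBundle (𝓡 N) M))
    (C : (x : M) → TangentSpace (𝓡 N) x → TangentSpace (𝓡 N) x)
    (q : TangentBundle (𝓡 N) M → ℝ) : Prop where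
  isOpen : IsOpen W
  subset : W ⊆ Φ.domain
  conic : ∀ v ∈ W, ∀ k : ℝ, 0 < k → (⟨v.1, k • v.2⟩ : TangentBundle (𝓡 N) M) ∈ W
  smooth : ContMDiffOn (𝓡 N).tangent (𝓡 N).tangent ∞ (totalMap C) W
  injective : Set.InjOn (totalMap C) W
  homogeneous : ∀ v ∈ W, ∀ k : ℝ, 0 < k → C v.1 (k • v.2) = (k ^ H v.1) • C v.1 v.2
  unit : ∀ v ∈ W, Φ.F v = 1 → S.inner v.1 (C v.1 v.2) (C v.1 v.2) = 1
  multiplier_pos : ∀ v ∈ W, 0 < q v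
  conformal : ∀ v ∈ W, ∀ ξ η : EuclideanSpace ℝ (Fin N),
    Φ.metricTensor v ξ η = q v * S.inner v.1 (tangentDeriv C v ξ) (tangentDeriv C v η)

/-- The Finsler space is conformally automorphic to the Riemannian space `(M, S)`, with degree
`H > 0`. The notion is local in the base manifold and in the tangent spaces. -/
def IsConformallyAutomorphic (Φ : FinslerSpace N M) (S : RiemMetric N M) (H : M → ℝ) : Prop :=
  (∀ x, 0 < H x) ∧ ∀ v ∈ Φ.domain, ∃ W C q, v ∈ W ∧ IsConformalAutomorphismOn Φ S H W C q

end FinslerConformal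

end

/-!
Let `φ` parametrize the indicatrix at `x`, with induced metric `γ`. Each of the two properties says
that the indicatrix, scaled to curvature one, is locally a round sphere.

If `c` is a conformal automorphism of degree `H`, then `c ∘ φ` takes its values in the unit sphere
of `S_x` and induces the metric `H² γ`: the multiplier is computed from the homogeneity of `F` and
`c` in the radial direction, and it is constant on the indicatrix. The frame `(∂ᵢ(c ∘ φ), c ∘ φ)`
satisfies Gauss' equations, whose integrability conditions say that `γ` has curvature `H²`.

Conversely, if `γ` has curvature `K`, then Gauss' equations for `K γ` form a flat connection. A
parallel frame, chosen smoothly in `x`, yields an isometry of a piece of the indicatrix with the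
metric `K γ` into the unit sphere of an arbitrary Riemannian metric `S`. Its homogeneous extension
of degree `√K` is the conformal automorphism.
-/

open scoped Manifold ContDiff

noncomputable section

namespace FinslerConformal

open Set Filter Topology

local notation:max "𝔼" n:max => EuclideanSpace ℝ (Fin n)
local notation:max "𝔾" n:max => EuclideanSpace ℝ (Option (Fin n))

/-! ### Flat connections depending on parameters -/

section Curry

/-- The curve `t ↦ f (q, t)` on the unit interval, as a point of the Banach space `C(I, F)`. -/
def curryUnit {Q F : Type*} [TopologicalSpace Q] [TopologicalSpace F] (f : Q × ℝ → F)
    (hf : Continuous f) (q : Q) : C(unitInterval, F) :=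
  ⟨fun t => f (q, t), by fun_prop⟩

theorem continuous_curryUnit {Q F : Type*} [TopologicalSpace Q] [TopologicalSpace F]
    (f : Q × ℝ → F) (hf : Continuous f) : Continuous (curryUnit f hf) :=
  (ContinuousMap.curry ⟨fun x : Q × unitInterval => f (x.1, x.2), by fun_prop⟩).continuous

variable {Q F : Type*} [NormedAddCommGroup Q] [NormedSpace ℝ Q] [FiniteDimensional ℝ Q]
  [NormedAddCommGroup F] [NormedSpace ℝ F]

/-- The derivative of `q ↦ f (q, ·)`, with values in the curves on the unit interval. -/
def curryUnitDeriv (f : Q × ℝ → F) (hf : ContDiff ℝ ∞ f) (q : Q) :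
    Q →L[ℝ] C(unitInterval, F) :=
  LinearMap.toContinuousLinearMap
    { toFun := fun y => ⟨fun t => fderiv ℝ f (q, t) (ContinuousLinearMap.inl ℝ Q ℝ y), by
        have := hf.continuous_fderiv (by simp)
        fun_prop⟩
      map_add' := fun y z => by
        ext t
        simp only [map_add, ContinuousMap.coe_mk, ContinuousMap.add_apply]
      map_smul' := fun c y => by
        ext t
        simp only [map_smul, ContinuousMap.coe_mk, ContinuousMap.smul_apply, RingHom.id_apply] }

theorem curryUnitDeriv_apply (f : Q × ℝ → F) (hf : ContDiff ℝ ∞ f) (q y : Q)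
    (t : unitInterval) : curryUnitDeriv f hf q y t = fderiv ℝ f (q, t) (y, 0) := rfl

theorem hasFDerivAt_curryUnit (f : Q × ℝ → F) (hf : ContDiff ℝ ∞ f) (q : Q) :
    HasFDerivAt (curryUnit f hf.continuous) (curryUnitDeriv f hf q) q := by
  let D : Q × ℝ → (Q →L[ℝ] F) := fun x => (fderiv ℝ f x).comp (ContinuousLinearMap.inl ℝ Q ℝ)
  have hD : Continuous D := by
    have := hf.continuous_fderiv (by simp)
    fun_prop
  have hfD (t : ℝ) (x : Q) : HasFDerivAt (fun x => f (x, t)) (D (x, t)) x :=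
    (hf.differentiable (by simp) _).hasFDerivAt.comp x (hasFDerivAt_prodMk_left x t)
  rw [hasFDerivAt_iff_isLittleO_nhds_zero, Asymptotics.isLittleO_iff]
  intro ε hε
  -- The partial derivative is close to its value at `q`, uniformly along the unit interval.
  have hcont : ContinuousAt (curryUnit D hD) q := (continuous_curryUnit D hD).continuousAt
  obtain ⟨δ, hδ, hball⟩ := (Metric.continuousAt_iff (β := C(unitInterval, Q →L[ℝ] F))).1 hcont ε hε
  filter_upwards [Metric.ball_mem_nhds (0 : Q) hδ] with y hy
  rw [ContinuousMap.norm_le _ (by positivity)]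
  intro t
  have hclose : ∀ x ∈ Metric.ball q δ, ‖D (x, t) - D (q, t)‖ ≤ ε := fun x hx => by
    have := ContinuousMap.dist_apply_le_dist (f := curryUnit D hD x) (g := curryUnit D hD q) t
    rw [dist_eq_norm] at this
    exact this.trans (hball hx).le
  have hmean := (convex_ball q δ).norm_image_sub_le_of_norm_hasFDerivWithin_le'
    (fun x _ => (hfD t x).hasFDerivWithinAt) hclose (Metric.mem_ball_self hδ)
    (y := q + y) (by simpa using hy)
  simpa [curryUnit, curryUnitDeriv_apply, D] using hmean

theorem contDiff_curryUnit (f : Q × ℝ → F) (hf : ContDiff ℝ ∞ f) :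
    ContDiff ℝ ∞ (curryUnit f hf.continuous) := by
  rw [contDiff_infty]
  intro n
  induction n generalizing f with
  | zero => exact contDiff_zero.2 (continuous_curryUnit f hf.continuous)
  | succ n ih =>
    have hderiv := hasFDerivAt_curryUnit f hf
    rw [Nat.cast_succ, contDiff_succ_iff_fderiv_apply]
    refine ⟨fun q => (hderiv q).differentiableAt, by simp, fun y => ?_⟩
    have hpartial : ContDiff ℝ ∞ fun x : Q × ℝ => fderiv ℝ f x (y, 0) :=
      (hf.fderiv_right (by simp)).clm_apply contDiff_const
    convert ih _ hpartial using 2 with q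
    rw [(hderiv q).fderiv]
    rfl

end Curry

section Primitive

variable {F : Type*} [NormedAddCommGroup F] [NormedSpace ℝ F]

/-- The primitive vanishing at `0` of a curve on the unit interval. -/
def primitiveUnit : C(unitInterval, F) →L[ℝ] C(unitInterval, F) :=
  LinearMap.mkContinuous
    { toFun := fun g => ⟨fun t => ∫ s in (0 : ℝ)..t, IccExtend zero_le_one g s,
        (intervalIntegral.continuous_primitive (fun _ _ =>
          g.continuous.Icc_extend'.intervalIntegrable _ _) 0).comp continuous_subtype_val⟩
      map_add' := fun g k => by
        ext t
        exact intervalIntegral.integral_add (g.continuous.Icc_extend'.intervalIntegrable 0 t)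
          (k.continuous.Icc_extend'.intervalIntegrable 0 t)
      map_smul' := fun c g => by
        ext t
        exact intervalIntegral.integral_smul c _ }
    1 (by
      intro g
      rw [ContinuousMap.norm_le _ (by positivity)]
      intro t
      have h := intervalIntegral.norm_integral_le_of_norm_le_const (a := 0) (b := t) (C := ‖g‖)
        (f := IccExtend (zero_le_one (α := ℝ)) g) (fun x _ => g.norm_coe_le_norm _)
      refine h.trans ?_
      rw [sub_zero, abs_of_nonneg t.2.1, one_mul]
      exact mul_le_of_le_one_right (norm_nonneg _) t.2.2)

theorem primitiveUnit_apply (g : C(unitInterval, F)) (t : unitInterval) :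
    primitiveUnit g t = ∫ s in (0 : ℝ)..t, IccExtend zero_le_one g s := rfl

variable [CompleteSpace F]

theorem hasDerivAt_integral_IccExtend (g : C(unitInterval, F)) (t : unitInterval) :
    HasDerivAt (fun t => ∫ s in (0 : ℝ)..t, IccExtend zero_le_one g s) (g t) t := by
  have hg : Continuous (IccExtend (zero_le_one (α := ℝ)) g) := g.continuous.Icc_extend'
  rw [← IccExtend_val zero_le_one g t]
  exact intervalIntegral.integral_hasDerivAt_right (hg.intervalIntegrable _ _)
    hg.aestronglyMeasurable.stronglyMeasurableAtFilter hg.continuousAt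

theorem primitiveUnit_eq_of_hasDerivAt {g : C(unitInterval, F)} {f : ℝ → F} (h0 : f 0 = 0)
    (hf : ∀ t : unitInterval, HasDerivAt f (g t) t) (t : unitInterval) :
    primitiveUnit g t = f t := by
  have hderiv : ∀ s ∈ uIcc (0 : ℝ) t, HasDerivAt f (IccExtend zero_le_one g s) s := by
    intro s hs
    rw [uIcc_of_le t.2.1] at hs
    have hsI : s ∈ Icc (0 : ℝ) 1 := ⟨hs.1, hs.2.trans t.2.2⟩
    rw [IccExtend_of_mem _ _ hsI]
    exact hf ⟨s, hsI⟩
  rw [primitiveUnit_apply, intervalIntegral.integral_eq_sub_of_hasDerivAt hderiv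
    (g.continuous.Icc_extend'.intervalIntegrable _ _), h0, sub_zero]

end Primitive

theorem exists_contDiff_eventuallyEq {E F : Type*} [NormedAddCommGroup E] [NormedSpace ℝ E]
    [HasContDiffBump E] [NormedAddCommGroup F] [NormedSpace ℝ F] {n : ℕ∞} {f : E → F} {O : Set E}
    (hO : IsOpen O) (hf : ContDiffOn ℝ n f O) {x : E} (hx : x ∈ O) :
    ∃ g : E → F, ContDiff ℝ n g ∧ g =ᶠ[𝓝 x] f := by
  obtain ⟨r, hr, hrO⟩ := Metric.nhds_basis_closedBall.mem_iff.1 (hO.mem_nhds hx)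
  let χ : ContDiffBump x := ⟨r / 2, r, by positivity, by linarith⟩
  refine ⟨fun y => χ y • f y, contDiff_iff_contDiffAt.2 fun y => ?_, ?_⟩
  · by_cases hy : y ∈ O
    · exact χ.contDiff.contDiffAt.smul (hf.contDiffAt (hO.mem_nhds hy))
    · have hsupp : y ∈ (tsupport χ)ᶜ := fun h => hy (hrO (χ.tsupport_eq ▸ h))
      refine (contDiffAt_const (c := (0 : F))).congr_of_eventuallyEq ?_
      filter_upwards [(isClosed_tsupport χ).isOpen_compl.mem_nhds hsupp] with z hz
      rw [image_eq_zero_of_notMem_tsupport hz, zero_smul]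
  · filter_upwards [χ.eventuallyEq_one] with y hy
    rw [hy, Pi.one_apply, one_smul]

theorem exists_contDiffOn_fixedPoint {P C : Type*} [NormedAddCommGroup P] [NormedSpace ℝ P]
    [NormedRing C] [NormedAlgebra ℝ C] [CompleteSpace C] (J : C →L[ℝ] C) {β : P → C}
    (hβ : ContDiff ℝ ∞ β) :
    ∃ (ζ : P → C) (Ω : Set P), IsOpen Ω ∧ (∀ q, β q = 0 → q ∈ Ω) ∧ ContDiffOn ℝ ∞ ζ Ω ∧
      ∀ q ∈ Ω, ζ q = 1 + J (ζ q * β q) ∧ ∀ η, η = J (η * β q) → η = 0 := by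
  let V : P → C →L[ℝ] C := fun q => J.comp ((ContinuousLinearMap.mul ℝ C).flip (β q))
  have hV : ContDiff ℝ ∞ V := by fun_prop
  refine ⟨fun q => Ring.inverse (1 - V q) 1, {q | IsUnit (1 - V q)},
    Units.isOpen.preimage (continuous_const.sub hV.continuous), fun q hq => by simp [V, hq],
    fun q hq => ?_, fun q hq => ⟨?_, fun η hη => ?_⟩⟩
  · obtain ⟨x, hx⟩ := hq
    have hinv : ContDiffAt ℝ ∞ Ring.inverse (1 - V q) := hx ▸ contDiffAt_ringInverse ℝ x
    exact ((hinv.comp q (contDiff_const.sub hV).contDiffAt).clm_apply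
      contDiffAt_const).contDiffWithinAt
  · have h : Ring.inverse (1 - V q) 1 - V q (Ring.inverse (1 - V q) 1) = 1 :=
      congrArg (fun L : C →L[ℝ] C => L 1) (Ring.mul_inverse_cancel _ hq)
    exact eq_add_of_sub_eq h
  · have hker : (1 - V q) η = 0 := sub_eq_zero.2 hη
    have h : Ring.inverse (1 - V q) ((1 - V q) η) = η :=
      congrArg (fun L : C →L[ℝ] C => L η) (Ring.inverse_mul_cancel _ hq)
    rw [← h, hker, map_zero]

theorem fderiv_apply_of_fixedPoint {P C : Type*} [NormedAddCommGroup P] [NormedSpace ℝ P]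
    [NormedRing C] [NormedAlgebra ℝ C] {J : C →L[ℝ] C} {ζ β : P → C} {β' : P →L[ℝ] C} {q : P}
    (hζ : DifferentiableAt ℝ ζ q) (hβ : HasFDerivAt β β' q)
    (hfix : ∀ᶠ x in 𝓝 q, ζ x = 1 + J (ζ x * β x)) (y : P) :
    fderiv ℝ ζ q y = J (ζ q * β' y + fderiv ℝ ζ q y * β q) := by
  have h : HasFDerivAt ζ _ q := HasFDerivAt.congr_of_eventuallyEq
    ((J.hasFDerivAt.comp q (hζ.hasFDerivAt.mul' hβ)).const_add 1) hfix
  conv_lhs => rw [h.fderiv]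
  simp

section Connection

variable {P U 𝔸 : Type*} [NormedAddCommGroup P] [NormedSpace ℝ P]
  [NormedAddCommGroup U] [NormedSpace ℝ U] [NormedRing 𝔸] [NormedAlgebra ℝ 𝔸]

/-- The curvature `da + a ∧ a` of the connection form `a`, at `u` on the vectors `v, w`. -/
def connectionCurvature (a : U → U →L[ℝ] 𝔸) (u v w : U) : 𝔸 :=
  fderiv ℝ a u v w - fderiv ℝ a u w v + a u v * a u w - a u w * a u v

theorem connectionCurvature_congr {a b : U → U →L[ℝ] 𝔸} {u : U}
    (h : a =ᶠ[𝓝 u] b) : connectionCurvature a u = connectionCurvature b u := by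
  funext v w
  simp only [connectionCurvature, h.fderiv_eq, h.self_of_nhds]

/-- The frame `Z` is parallel at `u` for the connection form `a`: `dZ = Z a` there. -/
def IsParallelAt (a : U → U →L[ℝ] 𝔸) (Z : U → 𝔸) (u : U) : Prop :=
  HasFDerivAt Z ((ContinuousLinearMap.mul ℝ 𝔸 (Z u)).comp (a u)) u

theorem IsParallelAt.ringInverse [CompleteSpace 𝔸] {a : U → U →L[ℝ] 𝔸} {Z : U → 𝔸} {u : U}
    (hZ : IsParallelAt a Z u) (hu : IsUnit (Z u)) :
    HasFDerivAt (fun u => Ring.inverse (Z u))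
      (-(((ContinuousLinearMap.mul ℝ 𝔸).flip (Ring.inverse (Z u))).comp (a u))) u := by
  obtain ⟨x, hx⟩ := hu
  have hinv : HasFDerivAt Ring.inverse _ (Z u) := hx ▸ hasFDerivAt_ringInverse (𝕜 := ℝ) x
  refine (hinv.comp u hZ).congr_fderiv ?_
  ext w
  simp [← hx]

theorem hasDerivAt_comp_smul {F : Type*} [NormedAddCommGroup F] [NormedSpace ℝ F] {a : U → F}
    {u : U} {t : ℝ} (ha : DifferentiableAt ℝ a (t • u)) :
    HasDerivAt (fun t : ℝ => a (t • u)) (fderiv ℝ a (t • u) u) t := by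
  have hline : HasDerivAt (fun t : ℝ => t • u) u t := by
    simpa using (hasDerivAt_id t).smul_const u
  exact ha.hasFDerivAt.comp_hasDerivAt t hline

/-- The component `a_{tu}(u)` of a connection form, depending on parameters, along the ray through
`u`. -/
def radialComponent (A : P × U → U →L[ℝ] 𝔸) (x : (P × U) × ℝ) : 𝔸 :=
  A (x.1.1, x.2 • x.1.2) x.1.2

theorem contDiff_radialComponent {A : P × U → U →L[ℝ] 𝔸} (hA : ContDiff ℝ ∞ A) :
    ContDiff ℝ ∞ (radialComponent A) := by
  unfold radialComponent
  fun_prop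

theorem fderiv_radialComponent {A : P × U → U →L[ℝ] 𝔸} (hA : ContDiff ℝ ∞ A) (p : P) (u w : U)
    (t : ℝ) : fderiv ℝ (radialComponent A) ((p, u), t) ((0, w), 0) =
      t • fderiv ℝ (fun u => A (p, u)) (t • u) w u + A (p, t • u) w := by
  have ha : ContDiff ℝ ∞ fun u => A (p, u) := by fun_prop
  have hinclusion : HasFDerivAt (fun u : U => ((p, u), t))
      ((ContinuousLinearMap.inl ℝ (P × U) ℝ).comp (ContinuousLinearMap.inr ℝ P U)) u :=
    HasFDerivAt.comp (g := fun x => (x, t)) u (hasFDerivAt_prodMk_left (p, u) t)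
      (hasFDerivAt_prodMk_right p u)
  have hpartial := ((contDiff_radialComponent hA).differentiable (by simp)
    ((p, u), t)).hasFDerivAt.comp u hinclusion
  have hscale : HasFDerivAt (fun u : U => t • u) (t • ContinuousLinearMap.id ℝ U) u :=
    (hasFDerivAt_id u).const_smul _
  have hproduct := (((ha.differentiable (by simp) (t • u)).hasFDerivAt).comp u hscale).clm_apply
    (hasFDerivAt_id u)
  simpa [add_comm] using congrArg (fun L : U →L[ℝ] 𝔸 => L w) (hpartial.unique hproduct)

variable [CompleteSpace 𝔸]

/-- Both sides vanish at `0`, and by flatness along the ray the derivative of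
`t ↦ t • ζ t * a_{tu}(w)` is the integrand on the right. -/
theorem smul_mul_eq_primitiveUnit_of_flat {a : U → U →L[ℝ] 𝔸} (ha : ContDiff ℝ 1 a) {u w : U}
    {ζ β β' σ : C(unitInterval, 𝔸)} (hζ : ζ = 1 + primitiveUnit (ζ * β))
    (hβ : ∀ t : unitInterval, β t = a ((t : ℝ) • u) u)
    (hβ' : ∀ t : unitInterval,
      β' t = (t : ℝ) • fderiv ℝ a ((t : ℝ) • u) w u + a ((t : ℝ) • u) w)
    (hσ : ∀ t : unitInterval, σ t = (t : ℝ) • (ζ t * a ((t : ℝ) • u) w))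
    (hflat : ∀ t : unitInterval, connectionCurvature a ((t : ℝ) • u) w u = 0) :
    σ = primitiveUnit (ζ * β' + σ * β) := by
  let z : ℝ → 𝔸 := fun t => 1 + ∫ s in (0 : ℝ)..t, IccExtend zero_le_one (ζ * β) s
  have hz (t : unitInterval) : z t = ζ t := (congrArg (fun g : C(unitInterval, 𝔸) => g t) hζ).symm
  have hz' (t : unitInterval) : HasDerivAt z (z t * β t) t :=
    ((hasDerivAt_integral_IccExtend (ζ * β) t).const_add 1).congr_deriv
      (congrArg (· * β t) (hz t).symm)
  have haw (t : ℝ) : HasDerivAt (fun t : ℝ => a (t • u) w) (fderiv ℝ a (t • u) u w) t :=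
    (ContinuousLinearMap.apply ℝ 𝔸 w).hasFDerivAt.comp_hasDerivAt t
      (hasDerivAt_comp_smul (ha.differentiable (by simp) _))
  ext t
  refine (primitiveUnit_eq_of_hasDerivAt (f := fun t => t • (z t * a (t • u) w))
    (zero_smul ℝ _) (fun t => ?_) t).symm ▸ (by rw [hσ, hz])
  refine ((hasDerivAt_id' (t : ℝ)).fun_smul ((hz' t).fun_mul (haw t))).congr_deriv ?_
  have hcurv : fderiv ℝ a ((t : ℝ) • u) u w = fderiv ℝ a ((t : ℝ) • u) w u
      + a ((t : ℝ) • u) w * a ((t : ℝ) • u) u - a ((t : ℝ) • u) u * a ((t : ℝ) • u) w := by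
    have h := hflat t
    unfold connectionCurvature at h
    rw [← sub_eq_zero, ← neg_eq_zero, ← h]
    abel
  simp only [ContinuousMap.add_apply, ContinuousMap.mul_apply, hσ, hβ, hβ', hz, hcurv, mul_add,
    mul_sub, smul_mul_assoc, mul_smul_comm, one_smul, mul_assoc]
  module

variable [FiniteDimensional ℝ P] [FiniteDimensional ℝ U]

/-- The frame is transported along the rays from `(p, 0)` by a Volterra equation. The equation for
its variation in a direction `w` has a unique solution, which flatness exhibits. -/
theorem exists_isParallelAt_of_contDiff {A : P × U → U →L[ℝ] 𝔸} (hA : ContDiff ℝ ∞ A)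
    {p₀ : P} {r : ℝ} (hr : 0 < r)
    (hflat : ∀ p ∈ Metric.ball p₀ r, ∀ u ∈ Metric.ball (0 : U) r,
      connectionCurvature (fun u => A (p, u)) u = 0) :
    ∃ (Z : P × U → 𝔸) (O : Set (P × U)), IsOpen O ∧ (p₀, 0) ∈ O ∧ ContDiffOn ℝ ∞ Z O ∧
      (∀ p, (p, 0) ∈ O → Z (p, 0) = 1) ∧
      ∀ p u, (p, u) ∈ O → IsParallelAt (fun u => A (p, u)) (fun u => Z (p, u)) u := by
  have hB := contDiff_radialComponent hA
  let β : P × U → C(unitInterval, 𝔸) := curryUnit _ hB.continuous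
  have hβ0 (p : P) : β (p, 0) = 0 := by
    ext t
    simp [β, curryUnit, radialComponent]
  obtain ⟨ζ, Ω, hΩ, hβΩ, hζ, hfix⟩ :=
    exists_contDiffOn_fixedPoint (primitiveUnit (F := 𝔸)) (β := β) (contDiff_curryUnit _ hB)
  let ev : C(unitInterval, 𝔸) →L[ℝ] 𝔸 := ContinuousMap.evalCLM ℝ 1
  refine ⟨fun q => ev (ζ q), Ω ∩ Metric.ball p₀ r ×ˢ Metric.ball 0 r,
    hΩ.inter (Metric.isOpen_ball.prod Metric.isOpen_ball), ⟨hβΩ _ (hβ0 _), by simp [hr]⟩,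
    ev.contDiff.comp_contDiffOn (hζ.mono inter_subset_left), fun p hp => ?_, ?_⟩
  · change ev (ζ (p, 0)) = 1
    rw [(hfix _ hp.1).1, hβ0]
    simp [ev]
  rintro p u ⟨hq, hp, hu⟩
  have hζd : HasFDerivAt ζ (fderiv ℝ ζ (p, u)) (p, u) :=
    ((hζ.contDiffAt (hΩ.mem_nhds hq)).differentiableAt (by simp)).hasFDerivAt
  refine ((ev.hasFDerivAt.comp (p, u) hζd).comp u (hasFDerivAt_prodMk_right p u)).congr_fderiv ?_
  ext w
  have hvar : fderiv ℝ ζ (p, u) (0, w) = primitiveUnit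
      (ζ (p, u) * curryUnitDeriv _ hB (p, u) (0, w) + fderiv ℝ ζ (p, u) (0, w) * β (p, u)) :=
    fderiv_apply_of_fixedPoint hζd.differentiableAt (hasFDerivAt_curryUnit _ hB _)
      (by filter_upwards [hΩ.mem_nhds hq] with q hq using (hfix q hq).1) _
  let σ : C(unitInterval, 𝔸) := ⟨fun t => (t : ℝ) • (ζ (p, u) t * A (p, (t : ℝ) • u) w), by
    have := hA.continuous
    fun_prop⟩
  have hσ : σ = primitiveUnit
      (ζ (p, u) * curryUnitDeriv _ hB (p, u) (0, w) + σ * β (p, u)) := by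
    refine smul_mul_eq_primitiveUnit_of_flat (a := fun u => A (p, u))
      (u := u) (w := w) ((hA.comp (contDiff_prodMk_right p)).of_le (by simp)) (hfix _ hq).1
      (fun t => rfl) (fun t => fderiv_radialComponent hA p u w t) (fun t => rfl) (fun t => ?_)
    refine congrFun₂ (hflat p hp _ ?_) w u
    exact (convex_ball 0 r).smul_mem_of_zero_mem (Metric.mem_ball_self hr) hu t.2
  have hdiff : fderiv ℝ ζ (p, u) (0, w) = σ := sub_eq_zero.1 <| (hfix _ hq).2 _ <| by
    rw [sub_mul]
    nth_rw 1 [hvar, hσ]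
    rw [← map_sub, add_sub_add_left_eq_sub]
  exact (congrArg ev hdiff).trans (by simp [ev, σ])

theorem exists_isParallelAt {A : P × U → U →L[ℝ] 𝔸} {O : Set (P × U)} (hO : IsOpen O)
    (hA : ContDiffOn ℝ ∞ A O) {p₀ : P} (hp₀ : (p₀, 0) ∈ O)
    (hflat : ∀ q ∈ O, connectionCurvature (fun u => A (q.1, u)) q.2 = 0) :
    ∃ (Z : P × U → 𝔸) (r : ℝ), 0 < r ∧ Metric.ball p₀ r ×ˢ Metric.ball 0 r ⊆ O ∧
      ContDiffOn ℝ ∞ Z (Metric.ball p₀ r ×ˢ Metric.ball 0 r) ∧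
      (∀ p ∈ Metric.ball p₀ r, Z (p, 0) = 1) ∧
      ∀ p ∈ Metric.ball p₀ r, ∀ u ∈ Metric.ball (0 : U) r,
        IsUnit (Z (p, u)) ∧ IsParallelAt (fun u => A (p, u)) (fun u => Z (p, u)) u := by
  obtain ⟨A', hA', heq⟩ := exists_contDiff_eventuallyEq hO hA hp₀
  obtain ⟨r, hr, hball⟩ := Metric.mem_nhds_iff.1 (inter_mem (hO.mem_nhds hp₀) heq)
  rw [← ball_prod_same] at hball
  have hgerm (p : P) (hp : p ∈ Metric.ball p₀ r) (u : U) (hu : u ∈ Metric.ball 0 r) :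
      (fun u => A' (p, u)) =ᶠ[𝓝 u] fun u => A (p, u) := by
    filter_upwards [Metric.isOpen_ball.mem_nhds hu] with u' hu' using (hball ⟨hp, hu'⟩).2
  obtain ⟨Z, O', hO', hmem, hZ, hZ0, hZd⟩ := exists_isParallelAt_of_contDiff hA' hr
    fun p hp u hu => (connectionCurvature_congr (hgerm p hp u hu)).trans
      (hflat (p, u) (hball ⟨hp, hu⟩).1)
  have hunit : {q | IsUnit (Z q)} ∈ 𝓝 (p₀, (0 : U)) :=
    (hZ.contDiffAt (hO'.mem_nhds hmem)).continuousAt.preimage_mem_nhds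
      (Units.isOpen.mem_nhds (by simp [hZ0 _ hmem]))
  obtain ⟨s, hs, hballs⟩ := Metric.mem_nhds_iff.1 (inter_mem (inter_mem (hO'.mem_nhds hmem) hunit)
    (Metric.ball_mem_nhds (p₀, (0 : U)) hr))
  rw [← ball_prod_same, ← ball_prod_same] at hballs
  refine ⟨Z, s, hs, fun q hq => (hball (hballs hq).2).1, hZ.mono fun q hq => (hballs hq).1.1,
    fun p hp => hZ0 p (hballs ⟨hp, Metric.mem_ball_self hs⟩).1.1, fun p hp u hu => ?_⟩
  obtain ⟨⟨hO'pu, hunit⟩, hp', hu'⟩ := hballs (mk_mem_prod hp hu)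
  refine ⟨hunit, (hZd p u hO'pu).congr_fderiv ?_⟩
  rw [(hgerm p hp' u hu').self_of_nhds]

end Connection

/-! ### Gauss' equations as a flat connection -/

section PartialDeriv

variable {P : Type*} [NormedAddCommGroup P] [NormedSpace ℝ P] {n : ℕ}

theorem contDiffOn_snd_of_contDiffOn {E G : Type*} [NormedAddCommGroup E] [NormedSpace ℝ E]
    [NormedAddCommGroup G] [NormedSpace ℝ G] {f : P × E → G} {O : Set (P × E)}
    (hf : ContDiffOn ℝ ∞ f O) (p : P) : ContDiffOn ℝ ∞ (fun y => f (p, y)) {y | (p, y) ∈ O} :=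
  hf.comp (contDiff_prodMk_right p).contDiffOn fun _ hy => hy

theorem contDiffOn_partialDeriv {f : P × 𝔼 n → ℝ} {O : Set (P × 𝔼 n)} (hO : IsOpen O)
    (hf : ContDiffOn ℝ ∞ f O) (i : Fin n) :
    ContDiffOn ℝ ∞ (fun q : P × 𝔼 n => partialDeriv i (fun u => f (q.1, u)) q.2) O := by
  have hdf : ContDiffOn ℝ ∞ (fun q => fderiv ℝ f q (0, EuclideanSpace.single i 1)) O :=
    (hf.fderiv_of_isOpen hO (by simp)).clm_apply contDiffOn_const
  refine hdf.congr fun q hq => ?_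
  have hfq : HasFDerivAt f (fderiv ℝ f q) (q.1, q.2) :=
    ((hf.contDiffAt (hO.mem_nhds hq)).differentiableAt (by simp)).hasFDerivAt
  change fderiv ℝ (f ∘ Prod.mk q.1) q.2 _ = _
  rw [(hfq.comp q.2 (hasFDerivAt_prodMk_right q.1 q.2)).fderiv]
  simp

theorem contDiffOn_matrix_det {m : Type*} [Fintype m] [DecidableEq m] {g : P → Matrix m m ℝ}
    {O : Set P} (hg : ∀ i j, ContDiffOn ℝ ∞ (fun q => g q i j) O) :
    ContDiffOn ℝ ∞ (fun q => (g q).det) O := by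
  simp only [Matrix.det_apply, Units.smul_def, zsmul_eq_mul]
  exact ContDiffOn.sum fun σ _ => contDiffOn_const.mul (contDiffOn_prod fun i _ => hg _ _)

theorem contDiffOn_matrix_inv {m : Type*} [Fintype m] [DecidableEq m] {g : P → Matrix m m ℝ}
    {O : Set P} (hg : ∀ i j, ContDiffOn ℝ ∞ (fun q => g q i j) O)
    (hdet : ∀ q ∈ O, (g q).det ≠ 0) (i j : m) :
    ContDiffOn ℝ ∞ (fun q => (g q)⁻¹ i j) O := by
  simp only [Matrix.inv_def, Ring.inverse_eq_inv', Matrix.smul_apply, smul_eq_mul,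
    Matrix.adjugate_apply]
  refine ((contDiffOn_matrix_det hg).inv hdet).mul (contDiffOn_matrix_det fun a b => ?_)
  obtain rfl | h := eq_or_ne a j
  · simpa using contDiffOn_const
  · simpa [Matrix.updateRow_ne h] using hg a b

variable {γ : P → 𝔼 n → Matrix (Fin n) (Fin n) ℝ} {O : Set (P × 𝔼 n)}

theorem contDiffOn_christoffel (hO : IsOpen O)
    (hγ : ∀ i j, ContDiffOn ℝ ∞ (fun q : P × 𝔼 n => γ q.1 q.2 i j) O)
    (hdet : ∀ q ∈ O, (γ q.1 q.2).det ≠ 0) (k i j : Fin n) :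
    ContDiffOn ℝ ∞ (fun q : P × 𝔼 n => christoffel (γ q.1) k i j q.2) O := by
  unfold christoffel
  refine contDiffOn_const.mul (ContDiffOn.sum fun l _ => ?_)
  exact (contDiffOn_matrix_inv hγ hdet k l).mul
    (((contDiffOn_partialDeriv hO (hγ j l) i).add (contDiffOn_partialDeriv hO (hγ i l) j)).sub
      (contDiffOn_partialDeriv hO (hγ i j) l))

theorem contDiffOn_riemannTensor (hO : IsOpen O)
    (hγ : ∀ i j, ContDiffOn ℝ ∞ (fun q : P × 𝔼 n => γ q.1 q.2 i j) O)
    (hdet : ∀ q ∈ O, (γ q.1 q.2).det ≠ 0) (l k i j : Fin n) :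
    ContDiffOn ℝ ∞ (fun q : P × 𝔼 n => riemannTensor (γ q.1) l k i j q.2) O := by
  have hΓ := contDiffOn_christoffel hO hγ hdet
  unfold riemannTensor
  refine ((contDiffOn_partialDeriv hO (hΓ l j k) i).sub
    (contDiffOn_partialDeriv hO (hΓ l i k) j)).add (ContDiffOn.sum fun m _ => ?_)
  exact ((hΓ l i m).mul (hΓ m j k)).sub ((hΓ l j m).mul (hΓ m i k))

end PartialDeriv

section MatrixConnection

variable {n : ℕ} {ι : Type*} [Fintype ι] [DecidableEq ι]

theorem hasFDerivAt_sum_smul_const {α E F : Type*} [Fintype α] [NormedAddCommGroup E]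
    [NormedSpace ℝ E] [NormedAddCommGroup F] [NormedSpace ℝ F] (c : α → F) {f : α → E → ℝ} {u : E}
    (hf : ∀ a, DifferentiableAt ℝ (f a) u) :
    HasFDerivAt (fun u => ∑ a, f a u • c a) (∑ a, (fderiv ℝ (f a) u).smulRight (c a)) u :=
  HasFDerivAt.fun_sum fun a _ => (hf a).hasFDerivAt.smul_const (c a)

theorem fderiv_sum_smul_const_apply {α E F : Type*} [Fintype α] [NormedAddCommGroup E]
    [NormedSpace ℝ E] [NormedAddCommGroup F] [NormedSpace ℝ F] (c : α → F) {f : α → E → ℝ} {u : E}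
    (hf : ∀ a, DifferentiableAt ℝ (f a) u) (v : E) :
    fderiv ℝ (fun u => ∑ a, f a u • c a) u v = ∑ a, fderiv ℝ (f a) u v • c a := by
  simp [(hasFDerivAt_sum_smul_const c hf).fderiv]

theorem eq_sum_smul_single (x : EuclideanSpace ℝ ι) :
    x = ∑ i, x i • EuclideanSpace.single i (1 : ℝ) := by
  simpa using ((EuclideanSpace.basisFun ι ℝ).sum_repr x).symm

theorem connectionCurvature_apply {U G : Type*} [NormedAddCommGroup U] [NormedSpace ℝ U]
    [NormedAddCommGroup G] [NormedSpace ℝ G] (a : U → U →L[ℝ] G →L[ℝ] G) (u v w : U) (x : G) :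
    connectionCurvature a u v w x =
      fderiv ℝ a u v w x - fderiv ℝ a u w v x + a u v (a u w x) - a u w (a u v x) := rfl

theorem connectionCurvature_eq_zero_iff {G : Type*} [NormedAddCommGroup G] [NormedSpace ℝ G]
    (a : 𝔼 n → 𝔼 n →L[ℝ] G →L[ℝ] G) (u : 𝔼 n) :
    connectionCurvature a u = 0 ↔ ∀ i j,
      connectionCurvature a u (EuclideanSpace.single i 1) (EuclideanSpace.single j 1) = 0 := by
  refine ⟨fun h i j => congrFun₂ h _ _, fun h => funext₂ fun v w => ?_⟩
  let m := (ContinuousLinearMap.mul ℝ (G →L[ℝ] G)).bilinearComp (a u) (a u)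
  let T : 𝔼 n →L[ℝ] 𝔼 n →L[ℝ] G →L[ℝ] G := fderiv ℝ a u - (fderiv ℝ a u).flip + m - m.flip
  have hT : ∀ v w, connectionCurvature a u v w = T v w := fun v w => rfl
  rw [hT, eq_sum_smul_single v, eq_sum_smul_single w]
  simp [map_sum, ← hT, h]

/-- The coordinate forms `(w, x) ↦ wᵢ xₒ eₚ`, a basis for connection forms with values in square
matrices. -/
def elementaryForm (i : Fin n) (p o : ι) :
    𝔼 n →L[ℝ] EuclideanSpace ℝ ι →L[ℝ] EuclideanSpace ℝ ι :=
  (EuclideanSpace.proj i : 𝔼 n →L[ℝ] ℝ).smulRight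
    ((EuclideanSpace.proj o : EuclideanSpace ℝ ι →L[ℝ] ℝ).smulRight (EuclideanSpace.single p 1))

/-- The connection form `w ↦ ∑ᵢ wᵢ mᵢ(u)` given by square matrices `mᵢ = (mᵢ p o)` of functions. -/
def matrixConnection (m : Fin n → ι → ι → 𝔼 n → ℝ) (u : 𝔼 n) :
    𝔼 n →L[ℝ] EuclideanSpace ℝ ι →L[ℝ] EuclideanSpace ℝ ι :=
  ∑ x : Fin n × ι × ι, m x.1 x.2.1 x.2.2 u • elementaryForm x.1 x.2.1 x.2.2

variable (m : Fin n → ι → ι → 𝔼 n → ℝ) (u : 𝔼 n)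

theorem matrixConnection_apply (w : 𝔼 n) (x : EuclideanSpace ℝ ι) (p : ι) :
    matrixConnection m u w x p = ∑ i, ∑ o, w i * x o * m i p o u := by
  simp only [matrixConnection, elementaryForm, FunLike.coe_sum, Finset.sum_apply, FunLike.coe_smul,
    Pi.smul_apply, WithLp.ofLp_sum, WithLp.ofLp_smul, smul_eq_mul, Fintype.sum_prod_type,
    ContinuousLinearMap.smulRight_apply, PiLp.proj_apply, PiLp.single_apply]
  refine Finset.sum_congr rfl fun i _ => ?_
  rw [Finset.sum_comm]
  refine Finset.sum_congr rfl fun o _ => ?_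
  simp only [mul_ite, mul_one, mul_zero, Finset.sum_ite_eq, Finset.mem_univ, if_true]
  ring

theorem sum_single_mul (i : ι) (f : ι → ℝ) :
    ∑ a, (EuclideanSpace.single i (1 : ℝ) : EuclideanSpace ℝ ι) a * f a = f i := by
  simp

theorem matrixConnection_single_apply (i : Fin n) (x : EuclideanSpace ℝ ι) (p : ι) :
    matrixConnection m u (EuclideanSpace.single i 1) x p = ∑ o, m i p o u * x o := by
  simp only [matrixConnection_apply, mul_assoc, ← Finset.mul_sum, sum_single_mul]
  simp only [mul_comm]

theorem matrixConnection_single_single (i : Fin n) (p o : ι) :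
    matrixConnection m u (EuclideanSpace.single i 1) (EuclideanSpace.single o 1) p =
      m i p o u := by
  simp [matrixConnection_single_apply]

variable {m u}

theorem fderiv_matrixConnection_single (hm : ∀ i p o, DifferentiableAt ℝ (m i p o) u)
    (i j : Fin n) (p o : ι) :
    fderiv ℝ (matrixConnection m) u (EuclideanSpace.single i 1) (EuclideanSpace.single j 1)
      (EuclideanSpace.single o 1) p = partialDeriv i (m j p o) u := by
  have hfderiv : fderiv ℝ (matrixConnection m) u (EuclideanSpace.single i 1) =
      matrixConnection (fun j p o => partialDeriv i (m j p o)) u :=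
    fderiv_sum_smul_const_apply (fun x : Fin n × ι × ι => elementaryForm x.1 x.2.1 x.2.2)
      (fun x => hm x.1 x.2.1 x.2.2) _
  rw [hfderiv, matrixConnection_single_single]

theorem connectionCurvature_matrixConnection
    (hm : ∀ i p o, DifferentiableAt ℝ (m i p o) u) (i j : Fin n) (p o : ι) :
    connectionCurvature (matrixConnection m) u (EuclideanSpace.single i 1)
      (EuclideanSpace.single j 1) (EuclideanSpace.single o 1) p =
    partialDeriv i (m j p o) u - partialDeriv j (m i p o) u
      + ∑ q, m i p q u * m j q o u - ∑ q, m j p q u * m i q o u := by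
  rw [connectionCurvature_apply]
  simp only [PiLp.add_apply, PiLp.sub_apply, fderiv_matrixConnection_single hm,
    matrixConnection_single_apply _ _ _ (matrixConnection m u _ _), matrixConnection_single_single]

theorem matrixConnection_flat_iff (hm : ∀ i p o, DifferentiableAt ℝ (m i p o) u) :
    connectionCurvature (matrixConnection m) u = 0 ↔ ∀ i j p o,
      partialDeriv i (m j p o) u - partialDeriv j (m i p o) u
        + ∑ q, m i p q u * m j q o u - ∑ q, m j p q u * m i q o u = 0 := by
  rw [connectionCurvature_eq_zero_iff]
  refine forall₂_congr fun i j => ?_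
  simp only [← connectionCurvature_matrixConnection hm]
  refine ⟨fun h p o => by simp [h], fun h => ContinuousLinearMap.coe_injective ?_⟩
  refine (EuclideanSpace.basisFun ι ℝ).toBasis.ext fun o => ?_
  ext p
  simpa using h p o

end MatrixConnection

section Gauss

variable {n : ℕ}

/-- The coefficients of the connection of Gauss' equations. A hypersurface of constant curvature
`κ` in a Euclidean space has position vector `ψ` and frame `∂ᵢψ` with
`∂ᵢ∂ⱼψ = ∑ₖ Γᵏᵢⱼ ∂ₖψ - κ γᵢⱼ ψ`; the index `none` stands for the position vector. -/
def gaussCoeff (γ : 𝔼 n → Matrix (Fin n) (Fin n) ℝ) (κ : ℝ) (i : Fin n) :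
    Option (Fin n) → Option (Fin n) → 𝔼 n → ℝ
  | none, none => fun _ => 0
  | some k, none => fun _ => if k = i then 1 else 0
  | none, some j => fun u => -κ * γ u i j
  | some k, some j => christoffel γ k i j

/-- `γ` is the matrix of a smooth pseudo-Riemannian metric on the open set `V`. -/
structure IsPseudoRiemannianOn (γ : 𝔼 n → Matrix (Fin n) (Fin n) ℝ) (V : Set (𝔼 n)) : Prop where
  isOpen : IsOpen V
  smooth : ∀ i j, ContDiffOn ℝ ∞ (fun u => γ u i j) V
  symm : ∀ u ∈ V, (γ u).IsSymm
  det_ne_zero : ∀ u ∈ V, (γ u).det ≠ 0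

namespace IsPseudoRiemannianOn

variable {γ : 𝔼 n → Matrix (Fin n) (Fin n) ℝ} {V : Set (𝔼 n)} {κ : ℝ} {u : 𝔼 n}

theorem differentiableAt (hγ : IsPseudoRiemannianOn γ V) (hu : u ∈ V) (i j : Fin n) :
    DifferentiableAt ℝ (fun u => γ u i j) u :=
  ((hγ.smooth i j).contDiffAt (hγ.isOpen.mem_nhds hu)).differentiableAt (by simp)

theorem mono (hγ : IsPseudoRiemannianOn γ V) {V' : Set (𝔼 n)} (hV' : IsOpen V') (hV'V : V' ⊆ V) :
    IsPseudoRiemannianOn γ V' where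
  isOpen := hV'
  smooth i j := (hγ.smooth i j).mono hV'V
  symm u hu := hγ.symm u (hV'V hu)
  det_ne_zero u hu := hγ.det_ne_zero u (hV'V hu)

theorem differentiableAt_christoffel (hγ : IsPseudoRiemannianOn γ V) (hu : u ∈ V)
    (k i j : Fin n) : DifferentiableAt ℝ (christoffel γ k i j) u := by
  have hΓ : ContDiffOn ℝ ∞ (fun q : Unit × 𝔼 n => christoffel γ k i j q.2) {q | q.2 ∈ V} :=
    contDiffOn_christoffel (γ := fun _ : Unit => γ) (hγ.isOpen.preimage continuous_snd)
      (fun i j => (hγ.smooth i j).comp contDiff_snd.contDiffOn fun q hq => hq)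
      (fun q hq => hγ.det_ne_zero q.2 hq) k i j
  have hslice : ContDiffOn ℝ ∞ (christoffel γ k i j) V := contDiffOn_snd_of_contDiffOn hΓ ()
  exact (hslice.contDiffAt (hγ.isOpen.mem_nhds hu)).differentiableAt (by simp)

theorem differentiableAt_gaussCoeff (hγ : IsPseudoRiemannianOn γ V) (hu : u ∈ V) (i : Fin n)
    (p o : Option (Fin n)) : DifferentiableAt ℝ (gaussCoeff γ κ i p o) u := by
  rcases p with _ | k <;> rcases o with _ | j
  · exact differentiableAt_const _
  · exact (hγ.differentiableAt hu i j).const_mul _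
  · exact differentiableAt_const _
  · exact hγ.differentiableAt_christoffel hu k i j

theorem partialDeriv_symm (hγ : IsPseudoRiemannianOn γ V) (hu : u ∈ V) (l i j : Fin n) :
    partialDeriv l (fun w => γ w i j) u = partialDeriv l (fun w => γ w j i) u := by
  have hsymm : (fun w => γ w i j) =ᶠ[𝓝 u] fun w => γ w j i := by
    filter_upwards [hγ.isOpen.mem_nhds hu] with w hw using (hγ.symm w hw).apply j i
  unfold partialDeriv
  rw [hsymm.fderiv_eq]

theorem christoffel_symm (hγ : IsPseudoRiemannianOn γ V) (hu : u ∈ V) (k i j : Fin n) :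
    christoffel γ k i j u = christoffel γ k j i u := by
  unfold christoffel
  congr 1
  refine Finset.sum_congr rfl fun l _ => ?_
  rw [hγ.partialDeriv_symm hu l i j]
  ring

theorem sum_mul_christoffel (hγ : IsPseudoRiemannianOn γ V) (hu : u ∈ V) (i j l : Fin n) :
    ∑ m, γ u l m * christoffel γ m i j u = (1 / 2 : ℝ) *
      (partialDeriv i (fun w => γ w j l) u + partialDeriv j (fun w => γ w i l) u
        - partialDeriv l (fun w => γ w i j) u) := by
  let b : Fin n → ℝ := fun l => (1 / 2 : ℝ) *
      (partialDeriv i (fun w => γ w j l) u + partialDeriv j (fun w => γ w i l) u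
        - partialDeriv l (fun w => γ w i j) u)
  have hΓ : (fun m => christoffel γ m i j u) = Matrix.mulVec (γ u)⁻¹ b := by
    funext m
    simp only [christoffel, Matrix.mulVec, dotProduct, b, Finset.mul_sum]
    exact Finset.sum_congr rfl fun l _ => by ring
  have hlower : Matrix.mulVec (γ u) (fun m => christoffel γ m i j u) = b := by
    rw [hΓ, Matrix.mulVec_mulVec,
      Matrix.mul_nonsing_inv _ (isUnit_iff_ne_zero.2 (hγ.det_ne_zero u hu)), Matrix.one_mulVec]
  exact congrFun hlower l

theorem partialDeriv_eq (hγ : IsPseudoRiemannianOn γ V) (hu : u ∈ V) (l i j : Fin n) :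
    partialDeriv l (fun w => γ w i j) u =
      ∑ m, γ u j m * christoffel γ m l i u + ∑ m, γ u i m * christoffel γ m l j u := by
  rw [hγ.sum_mul_christoffel hu, hγ.sum_mul_christoffel hu, hγ.partialDeriv_symm hu l j i,
    hγ.partialDeriv_symm hu i l j, hγ.partialDeriv_symm hu j l i]
  ring

theorem gaussCoeff_codazzi (hγ : IsPseudoRiemannianOn γ V) (hu : u ∈ V) (i j k : Fin n) :
    -κ * partialDeriv i (fun u => γ u j k) u - -κ * partialDeriv j (fun u => γ u i k) u
      + ∑ q, -κ * γ u i q * christoffel γ q j k u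
      - ∑ q, -κ * γ u j q * christoffel γ q i k u = 0 := by
  simp only [mul_assoc, ← Finset.mul_sum, hγ.sum_mul_christoffel hu]
  rw [hγ.partialDeriv_symm hu j k i, hγ.partialDeriv_symm hu i k j, hγ.partialDeriv_symm hu k i j]
  ring

theorem gaussConnection_flat_iff (hγ : IsPseudoRiemannianOn γ V) (hu : u ∈ V) :
    connectionCurvature (matrixConnection (gaussCoeff γ κ)) u = 0 ↔
      HasConstantCurvatureOn γ {u} κ := by
  have hderiv_const (i : Fin n) (c : ℝ) : partialDeriv i (fun _ => c) u = 0 := by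
    simp [partialDeriv]
  have hderiv_mul (i j k : Fin n) : partialDeriv i (fun u => -κ * γ u j k) u =
      -κ * partialDeriv i (fun u => γ u j k) u := by
    unfold partialDeriv
    rw [fderiv_const_mul (hγ.differentiableAt hu j k) (-κ)]
    rfl
  have htangential (i j k l : Fin n) : partialDeriv i (christoffel γ l j k) u
      - partialDeriv j (christoffel γ l i k) u
      + ((if l = i then 1 else 0) * (-κ * γ u j k) +
          ∑ q, christoffel γ l i q u * christoffel γ q j k u)
      - ((if l = j then 1 else 0) * (-κ * γ u i k) +
          ∑ q, christoffel γ l j q u * christoffel γ q i k u) = riemannTensor γ l k i j u -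
        κ * (γ u j k * (if l = i then 1 else 0) - γ u i k * (if l = j then 1 else 0)) := by
    simp only [riemannTensor, Finset.sum_sub_distrib]
    ring
  rw [matrixConnection_flat_iff (hγ.differentiableAt_gaussCoeff hu)]
  simp only [HasConstantCurvatureOn, mem_singleton_iff, forall_eq]
  refine ⟨fun h l k i j => ?_, fun h i j p o => ?_⟩
  · have hlk := h i j (some l) (some k)
    simp only [gaussCoeff, Fintype.sum_option, htangential] at hlk
    exact sub_eq_zero.1 hlk
  · rcases p with _ | l <;> rcases o with _ | k <;>
      simp only [gaussCoeff, Fintype.sum_option, hderiv_const, hderiv_mul]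
    · simp [(hγ.symm u hu).apply i j]
    · simpa using hγ.gaussCoeff_codazzi hu i j k
    · simp [hγ.christoffel_symm hu l i j]
    · rw [htangential, h, sub_self]

end IsPseudoRiemannianOn

end Gauss

/-! ### Spheres have constant curvature -/

section Frame

variable {n : ℕ} {ι E : Type*} [Fintype ι] [NormedAddCommGroup E] [NormedSpace ℝ E]
  {V : Set (𝔼 n)} {m : Fin n → ι → ι → 𝔼 n → ℝ} {X : ι → 𝔼 n → E} {u : 𝔼 n}

theorem fderiv_fderiv_single {ψ : 𝔼 n → E} (hψ : DifferentiableAt ℝ (fderiv ℝ ψ) u) (v w : 𝔼 n) :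
    fderiv ℝ (fun u => fderiv ℝ ψ u w) u v = fderiv ℝ (fderiv ℝ ψ) u v w := by
  have happly : HasFDerivAt (fun u => fderiv ℝ ψ u w) _ u :=
    (ContinuousLinearMap.apply ℝ E w).hasFDerivAt.comp u hψ.hasFDerivAt
  rw [happly.fderiv]
  rfl

theorem fderiv_fderiv_frame (hm : ∀ i p o, DifferentiableAt ℝ (m i p o) u)
    (hX : ∀ o, ContDiffAt ℝ ∞ (X o) u)
    (hframe : ∀ᶠ w in 𝓝 u, ∀ i o,
      fderiv ℝ (X o) w (EuclideanSpace.single i 1) = ∑ p, m i p o w • X p w) (i j : Fin n) (o : ι) :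
    fderiv ℝ (fderiv ℝ (X o)) u (EuclideanSpace.single i 1) (EuclideanSpace.single j 1) =
      ∑ p, (partialDeriv i (m j p o) u + ∑ q, m i p q u * m j q o u) • X p u := by
  have hX' (p : ι) : HasFDerivAt (X p) (fderiv ℝ (X p) u) u :=
    ((hX p).differentiableAt (by simp)).hasFDerivAt
  have hdX : DifferentiableAt ℝ (fderiv ℝ (X o)) u :=
    ((hX o).fderiv_right (m := ∞) (by simp)).differentiableAt (by simp)
  have hexpand : (fun w => fderiv ℝ (X o) w (EuclideanSpace.single j 1)) =ᶠ[𝓝 u]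
      fun w => ∑ p, m j p o w • X p w := hframe.mono fun w hw => hw j o
  have hderiv : HasFDerivAt (fun w => ∑ p, m j p o w • X p w) _ u :=
    HasFDerivAt.fun_sum fun p _ => (hm j p o).hasFDerivAt.smul (hX' p)
  rw [← fderiv_fderiv_single hdX, hexpand.fderiv_eq, hderiv.fderiv]
  simp only [FunLike.coe_sum, Finset.sum_apply, FunLike.coe_add, Pi.add_apply, FunLike.coe_smul,
    Pi.smul_apply, ContinuousLinearMap.smulRight_apply, hframe.self_of_nhds, Finset.sum_add_distrib,
    add_smul, Finset.sum_smul, Finset.smul_sum, smul_smul]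
  rw [add_comm, Finset.sum_comm (f := fun q p => (m j q o u * m i p q u) • X p u)]
  simp only [mul_comm, partialDeriv]

theorem matrixConnection_flat_of_frame [DecidableEq ι]
    (hm : ∀ i p o, DifferentiableAt ℝ (m i p o) u) (hX : ∀ o, ContDiffAt ℝ ∞ (X o) u)
    (hframe : ∀ᶠ w in 𝓝 u, ∀ i o,
      fderiv ℝ (X o) w (EuclideanSpace.single i 1) = ∑ p, m i p o w • X p w)
    (hli : LinearIndependent ℝ fun o => X o u) :
    connectionCurvature (matrixConnection m) u = 0 := by
  rw [matrixConnection_flat_iff hm]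
  intro i j p o
  have hsymm : IsSymmSndFDerivAt ℝ (X o) u :=
    (hX o).isSymmSndFDerivAt (by simpa using ENat.LEInfty.out)
  have hcomm := hsymm.eq (EuclideanSpace.single i 1) (EuclideanSpace.single j 1)
  rw [fderiv_fderiv_frame hm hX hframe i j, fderiv_fderiv_frame hm hX hframe j i, ← sub_eq_zero,
    ← Finset.sum_sub_distrib] at hcomm
  simp only [← sub_smul] at hcomm
  linarith [Fintype.linearIndependent_iff.1 hli _ hcomm p]

end Frame

section InnerProduct

variable {n : ℕ} {E : Type*} [NormedAddCommGroup E] [NormedSpace ℝ E]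

/-- The bilinear form `s` is an inner product. (The tangent spaces come with the inner product of
`ℝᴺ` as their instance, so that those of a Riemannian metric have to be unbundled.) -/
structure IsInnerProduct (s : E →L[ℝ] E →L[ℝ] ℝ) : Prop where
  symm : ∀ x y, s x y = s y x
  pos : ∀ x, x ≠ 0 → 0 < s x x

namespace IsInnerProduct

variable {s : E →L[ℝ] E →L[ℝ] ℝ}

theorem smul (hs : IsInnerProduct s) {c : ℝ} (hc : 0 < c) : IsInnerProduct (c • s) where
  symm x y := congrArg (c * ·) (hs.symm x y)
  pos x hx := mul_pos hc (hs.pos x hx)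

theorem comp_injective {G : Type*} [NormedAddCommGroup G] [NormedSpace ℝ G]
    (hs : IsInnerProduct s) {A : G →L[ℝ] E} (hA : Function.Injective A) :
    IsInnerProduct (s.bilinearComp A A) where
  symm x y := hs.symm (A x) (A y)
  pos x hx := hs.pos (A x) ((map_ne_zero_iff A hA).2 hx)

theorem ext_of_span {ι : Type*} (hs : IsInnerProduct s) {X : ι → E}
    (hX : Submodule.span ℝ (range X) = ⊤) {x y : E} (h : ∀ o, s x (X o) = s y (X o)) : x = y := by
  have heq : (s x : E →ₗ[ℝ] ℝ) = s y := LinearMap.ext_on_range hX h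
  have hself : s (x - y) (x - y) = 0 := by
    rw [map_sub s, FunLike.coe_sub, Pi.sub_apply, sub_eq_zero]
    exact LinearMap.congr_fun heq _
  by_contra hne
  exact (hs.pos _ (sub_ne_zero.2 hne)).ne' hself

end IsInnerProduct

/-- The metric induced by the bilinear form `s` on the surface parametrized by `ψ`. -/
def inducedMetric (s : E →L[ℝ] E →L[ℝ] ℝ) (ψ : 𝔼 n → E) (u : 𝔼 n) : Matrix (Fin n) (Fin n) ℝ :=
  Matrix.of fun i j =>
    s (fderiv ℝ ψ u (EuclideanSpace.single i 1)) (fderiv ℝ ψ u (EuclideanSpace.single j 1))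

theorem sum_sum_apply_single {F : Type*} [NormedAddCommGroup F] [NormedSpace ℝ F]
    (L : 𝔼 n →L[ℝ] E) (s : E →L[ℝ] E →L[ℝ] F) (v w : 𝔼 n) :
    ∑ i, ∑ j, (v i * w j) • s (L (EuclideanSpace.single i 1)) (L (EuclideanSpace.single j 1)) =
      s (L v) (L w) := by
  conv_rhs => rw [eq_sum_smul_single v, eq_sum_smul_single w]
  simp only [map_sum, map_smul, FunLike.coe_sum, Finset.sum_apply, FunLike.coe_smul,
    Pi.smul_apply, Finset.smul_sum, smul_smul]
  rw [Finset.sum_comm]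
  exact Finset.sum_congr rfl fun i _ => Finset.sum_congr rfl fun j _ => by rw [mul_comm]

theorem IsInnerProduct.gram_det_ne_zero {s : E →L[ℝ] E →L[ℝ] ℝ} (hs : IsInnerProduct s)
    {L : 𝔼 n →L[ℝ] E} (hL : Function.Injective L) :
    (Matrix.of fun i j => s (L (EuclideanSpace.single i 1)) (L (EuclideanSpace.single j 1))).det
      ≠ 0 := by
  intro hdet
  obtain ⟨v, hv, hker⟩ := Matrix.exists_mulVec_eq_zero_iff.2 hdet
  have hnull : s (L (WithLp.toLp 2 v)) (L (WithLp.toLp 2 v)) = 0 := by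
    rw [← sum_sum_apply_single]
    refine Finset.sum_eq_zero fun i _ => ?_
    have hrow := congrArg (v i * ·) (congrFun hker i)
    simp only [Matrix.mulVec, dotProduct, Matrix.of_apply, Pi.zero_apply, Finset.mul_sum,
      mul_zero] at hrow
    rw [← hrow]
    exact Finset.sum_congr rfl fun j _ => by simp only [smul_eq_mul]; ring
  refine (hs.pos _ fun hLv => hv ?_).ne' hnull
  simpa using hL (hLv.trans (map_zero L).symm)

end InnerProduct

section Congr

variable {n : ℕ} {γ γ' : 𝔼 n → Matrix (Fin n) (Fin n) ℝ} {u : 𝔼 n}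

theorem partialDeriv_congr {f g : 𝔼 n → ℝ} (h : f =ᶠ[𝓝 u] g) (i : Fin n) :
    partialDeriv i f u = partialDeriv i g u := by
  unfold partialDeriv
  rw [h.fderiv_eq]

theorem christoffel_congr (h : γ =ᶠ[𝓝 u] γ') (k i j : Fin n) :
    christoffel γ k i j =ᶠ[𝓝 u] christoffel γ' k i j := by
  filter_upwards [h.eventuallyEq_nhds] with w hw
  have hentry (a b : Fin n) : (fun w => γ w a b) =ᶠ[𝓝 w] fun w => γ' w a b :=
    hw.mono fun z hz => congrFun₂ hz a b
  simp only [christoffel, hw.self_of_nhds, partialDeriv_congr (hentry _ _)]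

theorem riemannTensor_congr (h : γ =ᶠ[𝓝 u] γ') (l k i j : Fin n) :
    riemannTensor γ l k i j u = riemannTensor γ' l k i j u := by
  simp only [riemannTensor, partialDeriv_congr (christoffel_congr h _ _ _),
    (christoffel_congr h _ _ _).self_of_nhds]

theorem HasConstantCurvatureOn.congr {V : Set (𝔼 n)} {κ : ℝ} (hV : IsOpen V)
    (h : HasConstantCurvatureOn γ V κ) (hγ : EqOn γ γ' V) : HasConstantCurvatureOn γ' V κ := by
  intro u hu l k i j
  rw [← riemannTensor_congr (hγ.eventuallyEq_of_mem (hV.mem_nhds hu)), h u hu, hγ hu]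

end Congr

section Sphere

variable {n : ℕ} {E : Type*} [NormedAddCommGroup E] [NormedSpace ℝ E]

/-- `ψ` is a smooth immersion of the open set `V` into the sphere `s(x, x) = 1 / κ`. -/
structure IsSphereImmersion (s : E →L[ℝ] E →L[ℝ] ℝ) (κ : ℝ) (V : Set (𝔼 n)) (ψ : 𝔼 n → E) :
    Prop where
  isOpen : IsOpen V
  smooth : ContDiffOn ℝ ∞ ψ V
  mem_sphere : ∀ u ∈ V, κ * s (ψ u) (ψ u) = 1
  immersion : ∀ u ∈ V, Function.Injective (fderiv ℝ ψ u)

/-- The frame along a hypersurface formed by the position vector, with index `none`, and the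
coordinate tangent vectors. -/
def gaussFrame (ψ : 𝔼 n → E) : Option (Fin n) → 𝔼 n → E
  | none => ψ
  | some i => fun u => fderiv ℝ ψ u (EuclideanSpace.single i 1)

namespace IsSphereImmersion

variable {s : E →L[ℝ] E →L[ℝ] ℝ} {κ : ℝ} {V : Set (𝔼 n)} {ψ : 𝔼 n → E} {u : 𝔼 n}

theorem mono (hψ : IsSphereImmersion s κ V ψ) {V' : Set (𝔼 n)} (hV' : IsOpen V')
    (hV'V : V' ⊆ V) : IsSphereImmersion s κ V' ψ where
  isOpen := hV'
  smooth := hψ.smooth.mono hV'V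
  mem_sphere u hu := hψ.mem_sphere u (hV'V hu)
  immersion u hu := hψ.immersion u (hV'V hu)

theorem contDiffAt (hψ : IsSphereImmersion s κ V ψ) (hu : u ∈ V) : ContDiffAt ℝ ∞ ψ u :=
  hψ.smooth.contDiffAt (hψ.isOpen.mem_nhds hu)

theorem hasFDerivAt (hψ : IsSphereImmersion s κ V ψ) (hu : u ∈ V) :
    HasFDerivAt ψ (fderiv ℝ ψ u) u :=
  ((hψ.contDiffAt hu).differentiableAt (by simp)).hasFDerivAt

theorem contDiffAt_fderiv (hψ : IsSphereImmersion s κ V ψ) (hu : u ∈ V) :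
    ContDiffAt ℝ ∞ (fderiv ℝ ψ) u :=
  (hψ.contDiffAt hu).fderiv_right (by simp)

theorem hasFDerivAt_fderiv_apply (hψ : IsSphereImmersion s κ V ψ) (hu : u ∈ V) (v : 𝔼 n) :
    HasFDerivAt (fun w => fderiv ℝ ψ w v) ((fderiv ℝ (fderiv ℝ ψ) u).flip v) u :=
  (ContinuousLinearMap.apply ℝ E v).hasFDerivAt.comp u
    ((hψ.contDiffAt_fderiv hu).differentiableAt (by simp)).hasFDerivAt

theorem contDiffAt_gaussFrame (hψ : IsSphereImmersion s κ V ψ) (hu : u ∈ V) (o : Option (Fin n)) :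
    ContDiffAt ℝ ∞ (gaussFrame ψ o) u := by
  rcases o with _ | i
  · exact hψ.contDiffAt hu
  · exact (hψ.contDiffAt_fderiv hu).clm_apply contDiffAt_const

theorem apply_fderiv_self (hψ : IsSphereImmersion s κ V ψ) (hs : IsInnerProduct s)
    (hu : u ∈ V) (v : 𝔼 n) : s (fderiv ℝ ψ u v) (ψ u) = 0 := by
  have hderiv := ((s.hasFDerivAt.comp u (hψ.hasFDerivAt hu)).clm_apply (hψ.hasFDerivAt hu))
  have hconst : (fun w => (s ∘ ψ) w (ψ w)) =ᶠ[𝓝 u] fun _ => κ⁻¹ := by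
    filter_upwards [hψ.isOpen.mem_nhds hu] with w hw
    exact eq_inv_of_mul_eq_one_right (hψ.mem_sphere w hw)
  have hzero : s (fderiv ℝ ψ u v) (ψ u) + s (ψ u) (fderiv ℝ ψ u v) = 0 := by
    simpa [add_comm] using congrArg (fun T : 𝔼 n →L[ℝ] ℝ => T v)
      (hderiv.unique ((hasFDerivAt_const κ⁻¹ u).congr_of_eventuallyEq hconst))
  rw [hs.symm (ψ u)] at hzero
  linarith

theorem apply_fderiv_fderiv_self (hψ : IsSphereImmersion s κ V ψ) (hs : IsInnerProduct s)
    (hu : u ∈ V) (v w : 𝔼 n) :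
    s (fderiv ℝ (fderiv ℝ ψ) u v w) (ψ u) = -s (fderiv ℝ ψ u v) (fderiv ℝ ψ u w) := by
  have hderiv := (s.hasFDerivAt.comp u (hψ.hasFDerivAt_fderiv_apply hu w)).clm_apply
    (hψ.hasFDerivAt hu)
  have hconst : (fun z => (s ∘ fun w' => fderiv ℝ ψ w' w) z (ψ z)) =ᶠ[𝓝 u] fun _ => 0 := by
    filter_upwards [hψ.isOpen.mem_nhds hu] with z hz using hψ.apply_fderiv_self hs hz w
  have hzero : s (fderiv ℝ (fderiv ℝ ψ) u v w) (ψ u) +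
      s (fderiv ℝ ψ u w) (fderiv ℝ ψ u v) = 0 := by
    simpa [add_comm] using congrArg (fun T : 𝔼 n →L[ℝ] ℝ => T v)
      (hderiv.unique ((hasFDerivAt_const (0 : ℝ) u).congr_of_eventuallyEq hconst))
  rw [hs.symm (fderiv ℝ ψ u w)] at hzero
  linarith

theorem isPseudoRiemannianOn_inducedMetric (hψ : IsSphereImmersion s κ V ψ)
    (hs : IsInnerProduct s) : IsPseudoRiemannianOn (inducedMetric s ψ) V where
  isOpen := hψ.isOpen
  smooth i j := by
    have hdψ : ContDiffOn ℝ ∞ (fderiv ℝ ψ) V := hψ.smooth.fderiv_of_isOpen hψ.isOpen (by simp)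
    exact (contDiffOn_const.clm_apply (hdψ.clm_apply contDiffOn_const)).clm_apply
      (hdψ.clm_apply contDiffOn_const)
  symm u _ := Matrix.IsSymm.ext fun _ _ => hs.symm _ _
  det_ne_zero u hu := hs.gram_det_ne_zero (hψ.immersion u hu)

theorem partialDeriv_inducedMetric (hψ : IsSphereImmersion s κ V ψ) (hu : u ∈ V) (l i j : Fin n) :
    partialDeriv l (fun w => inducedMetric s ψ w i j) u =
      s (fderiv ℝ (fderiv ℝ ψ) u (EuclideanSpace.single l 1) (EuclideanSpace.single i 1))
          (fderiv ℝ ψ u (EuclideanSpace.single j 1)) +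
        s (fderiv ℝ ψ u (EuclideanSpace.single i 1))
          (fderiv ℝ (fderiv ℝ ψ) u (EuclideanSpace.single l 1) (EuclideanSpace.single j 1)) := by
  have hderiv := (s.hasFDerivAt.comp u (hψ.hasFDerivAt_fderiv_apply hu
    (EuclideanSpace.single i 1))).clm_apply
      (hψ.hasFDerivAt_fderiv_apply hu (EuclideanSpace.single j 1))
  change fderiv ℝ _ u _ = _
  rw [HasFDerivAt.fderiv (f := fun w => inducedMetric s ψ w i j) hderiv]
  simp [add_comm]

/-- Koszul's formula. -/
theorem apply_fderiv_fderiv (hψ : IsSphereImmersion s κ V ψ) (hs : IsInnerProduct s) (hu : u ∈ V)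
    (i j l : Fin n) :
    s (fderiv ℝ (fderiv ℝ ψ) u (EuclideanSpace.single i 1) (EuclideanSpace.single j 1))
        (fderiv ℝ ψ u (EuclideanSpace.single l 1)) =
      ∑ m, inducedMetric s ψ u l m * christoffel (inducedMetric s ψ) m i j u := by
  have hsymm : IsSymmSndFDerivAt ℝ ψ u :=
    (hψ.contDiffAt hu).isSymmSndFDerivAt (by simpa using ENat.LEInfty.out)
  rw [(hψ.isPseudoRiemannianOn_inducedMetric hs).sum_mul_christoffel hu]
  simp only [hψ.partialDeriv_inducedMetric hu]
  rw [hsymm.eq (EuclideanSpace.single j 1) (EuclideanSpace.single i 1),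
    hsymm.eq (EuclideanSpace.single l 1) (EuclideanSpace.single i 1),
    hsymm.eq (EuclideanSpace.single l 1) (EuclideanSpace.single j 1)]
  simp only [hs.symm (fderiv ℝ ψ u _)]
  ring

theorem linearIndependent_gaussFrame (hψ : IsSphereImmersion s κ V ψ) (hs : IsInnerProduct s)
    (hu : u ∈ V) : LinearIndependent ℝ fun o => gaussFrame ψ o u := by
  rw [Fintype.linearIndependent_iff]
  intro c hc
  let v : 𝔼 n := WithLp.toLp 2 fun i => c (some i)
  have htangent : ∑ i, c (some i) • gaussFrame ψ (some i) u = fderiv ℝ ψ u v := by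
    conv_rhs => rw [eq_sum_smul_single v]
    simp [v, gaussFrame]
  rw [Fintype.sum_option, htangent] at hc
  have hnone : c none = 0 := by
    have hs0 := congrArg (fun x => s x (ψ u)) hc
    have hne : s (ψ u) (ψ u) ≠ 0 := right_ne_zero_of_mul_eq_one (hψ.mem_sphere u hu)
    simpa [gaussFrame, hψ.apply_fderiv_self hs hu, hne] using hs0
  rw [hnone, zero_smul, zero_add] at hc
  have hv : v = 0 := hψ.immersion u hu (hc.trans (map_zero _).symm)
  rintro (_ | i)
  · exact hnone
  · exact congrArg (fun x : 𝔼 n => x i) hv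

variable [FiniteDimensional ℝ E]

theorem gauss_formula (hψ : IsSphereImmersion s κ V ψ) (hs : IsInnerProduct s)
    (hE : Module.finrank ℝ E = n + 1) (hu : u ∈ V) (i : Fin n) (o : Option (Fin n)) :
    fderiv ℝ (gaussFrame ψ o) u (EuclideanSpace.single i 1) =
      ∑ p, gaussCoeff (inducedMetric s ψ) κ i p o u • gaussFrame ψ p u := by
  rcases o with _ | j
  · simp [gaussCoeff, gaussFrame]
  have hspan : Submodule.span ℝ (range fun o => gaussFrame ψ o u) = ⊤ :=
    (hψ.linearIndependent_gaussFrame hs hu).span_eq_top_of_card_eq_finrank' (by simp [hE])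
  refine hs.ext_of_span hspan fun o => ?_
  have hsnd : fderiv ℝ (gaussFrame ψ (some j)) u (EuclideanSpace.single i 1) =
      fderiv ℝ (fderiv ℝ ψ) u (EuclideanSpace.single i 1) (EuclideanSpace.single j 1) :=
    fderiv_fderiv_single ((hψ.contDiffAt_fderiv hu).differentiableAt (by simp)) _ _
  simp only [hsnd, map_sum, map_smul, FunLike.coe_sum, Finset.sum_apply, FunLike.coe_smul,
    Pi.smul_apply, Fintype.sum_option, smul_eq_mul, map_add, FunLike.coe_add, Pi.add_apply]
  rcases o with _ | l
  · simp only [gaussFrame, gaussCoeff, hψ.apply_fderiv_fderiv_self hs hu,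
      hψ.apply_fderiv_self hs hu, mul_zero, Finset.sum_const_zero, add_zero]
    have hij : inducedMetric s ψ u i j = s (fderiv ℝ ψ u (EuclideanSpace.single i 1))
      (fderiv ℝ ψ u (EuclideanSpace.single j 1)) := rfl
    linear_combination hij + (inducedMetric s ψ u i j) * hψ.mem_sphere u hu
  · simp only [gaussFrame, gaussCoeff, hψ.apply_fderiv_fderiv hs hu, hs.symm (ψ u),
      hψ.apply_fderiv_self hs hu, mul_zero, zero_add]
    refine Finset.sum_congr rfl fun m _ => ?_
    rw [mul_comm, hs.symm]
    rfl

theorem hasConstantCurvatureOn_inducedMetric (hψ : IsSphereImmersion s κ V ψ)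
    (hs : IsInnerProduct s) (hE : Module.finrank ℝ E = n + 1) :
    HasConstantCurvatureOn (inducedMetric s ψ) V κ := by
  intro u hu
  have hγ := hψ.isPseudoRiemannianOn_inducedMetric hs
  refine (hγ.gaussConnection_flat_iff hu).1 ?_ u rfl
  refine matrixConnection_flat_of_frame (hγ.differentiableAt_gaussCoeff hu)
    (hψ.contDiffAt_gaussFrame hu) ?_ (hψ.linearIndependent_gaussFrame hs hu)
  filter_upwards [hψ.isOpen.mem_nhds hu] with w hw using hψ.gauss_formula hs hE hw

end IsSphereImmersion

end Sphere

/-! ### Conic norms and conformal maps -/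

section Homogeneous

variable {E G : Type*} [NormedAddCommGroup E] [NormedSpace ℝ E] [NormedAddCommGroup G]
  [NormedSpace ℝ G] {f : E → G} {y : E} {H : ℝ}

theorem fderiv_apply_self_of_homogeneous (hf : DifferentiableAt ℝ f y)
    (hhom : ∀ k : ℝ, 0 < k → f (k • y) = (k ^ H) • f y) : fderiv ℝ f y y = H • f y := by
  have hline : HasDerivAt (fun t : ℝ => t • y) y 1 := by
    simpa using (hasDerivAt_id (1 : ℝ)).smul_const y
  have hchain : HasDerivAt (fun t : ℝ => f (t • y)) (fderiv ℝ f y y) 1 :=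
    HasFDerivAt.comp_hasDerivAt_of_eq (1 : ℝ) hf.hasFDerivAt hline (by simp)
  have hpow : HasDerivAt (fun t : ℝ => t ^ H • f y) (H • f y) 1 := by
    simpa using
      (Real.hasDerivAt_rpow_const (x := 1) (p := H) (Or.inl one_ne_zero)).smul_const (f y)
  refine hchain.unique (hpow.congr_of_eventuallyEq ?_)
  filter_upwards [eventually_gt_nhds zero_lt_one] with t ht using hhom t ht

theorem fderiv_smul_of_homogeneous {k : ℝ} (hk : 0 < k)
    (hhom : ∀ᶠ w in 𝓝 y, f (k • w) = (k ^ H) • f w) :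
    fderiv ℝ f (k • y) = (k ^ (H - 1)) • fderiv ℝ f y := by
  have hderiv : k • fderiv ℝ f (k • y) = (k ^ H) • fderiv ℝ f y := by
    rw [← fderiv_comp_smul, EventuallyEq.fderiv_eq hhom]
    exact congrFun (fderiv_const_smul_field (𝕜 := ℝ) (f := f) (k ^ H)) y
  rw [← inv_smul_smul₀ hk.ne' (fderiv ℝ f (k • y)), hderiv, smul_smul, Real.rpow_sub_one hk.ne']
  congr 1
  field_simp

end Homogeneous

section ConicNorm

variable {N : ℕ}

/-- A smooth positive function `h` on an open cone `D`, homogeneous of degree one, with positive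
definite `½ ∂²h² / ∂y∂y`. The restriction of a Finsler metric function to a tangent space is of
this kind. -/
structure IsConicNorm (D : Set (𝔼 N)) (h : 𝔼 N → ℝ) : Prop where
  isOpen : IsOpen D
  ne_zero : ∀ y ∈ D, y ≠ 0
  conic : ∀ y ∈ D, ∀ k : ℝ, 0 < k → k • y ∈ D
  smooth : ContDiffOn ℝ ∞ h D
  pos : ∀ y ∈ D, 0 < h y
  homogeneous : ∀ y ∈ D, ∀ k : ℝ, 0 < k → h (k • y) = k * h y
  posDef : ∀ y ∈ D, ∀ ξ : 𝔼 N, ξ ≠ 0 → 0 < halfHessianSq h y ξ ξ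

/-- The form `½ ∂²h² / ∂y∂y` as a continuous bilinear form; it agrees with `halfHessianSq h y` where
`h` is smooth. -/
def hessForm (h : 𝔼 N → ℝ) (y : 𝔼 N) : 𝔼 N →L[ℝ] 𝔼 N →L[ℝ] ℝ :=
  (1 / 2 : ℝ) • (fderiv ℝ (fderiv ℝ fun w => h w ^ 2) y).flip

theorem halfHessianSq_eq_hessForm {h : 𝔼 N → ℝ} {y : 𝔼 N}
    (hd : DifferentiableAt ℝ (fderiv ℝ fun w => h w ^ 2) y) (ξ η : 𝔼 N) :
    halfHessianSq h y ξ η = hessForm h y ξ η := by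
  have happly : HasFDerivAt (fun z => fderiv ℝ (fun w => h w ^ 2) z ξ) _ y :=
    (ContinuousLinearMap.apply ℝ ℝ ξ).hasFDerivAt.comp y hd.hasFDerivAt
  rw [halfHessianSq, happly.fderiv]
  rfl

namespace IsConicNorm

variable {D : Set (𝔼 N)} {h : 𝔼 N → ℝ} {y : 𝔼 N}

theorem differentiableAt (hh : IsConicNorm D h) (hy : y ∈ D) : DifferentiableAt ℝ h y :=
  (hh.smooth.contDiffAt (hh.isOpen.mem_nhds hy)).differentiableAt (by simp)

theorem differentiableAt_fderiv_sq (hh : IsConicNorm D h) (hy : y ∈ D) :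
    DifferentiableAt ℝ (fderiv ℝ fun w => h w ^ 2) y := by
  have hsq : ContDiffOn ℝ ∞ (fderiv ℝ fun w => h w ^ 2) D :=
    (hh.smooth.pow 2).fderiv_of_isOpen hh.isOpen (by simp)
  exact (hsq.contDiffAt (hh.isOpen.mem_nhds hy)).differentiableAt (by simp)

theorem halfHessianSq_eq (hh : IsConicNorm D h) (hy : y ∈ D) (ξ η : 𝔼 N) :
    halfHessianSq h y ξ η = hessForm h y ξ η :=
  halfHessianSq_eq_hessForm (hh.differentiableAt_fderiv_sq hy) ξ η

theorem isInnerProduct_hessForm (hh : IsConicNorm D h) (hy : y ∈ D) :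
    IsInnerProduct (hessForm h y) where
  symm ξ η := by
    have hsymm : IsSymmSndFDerivAt ℝ (fun w => h w ^ 2) y :=
      ((hh.smooth.pow 2).contDiffAt (hh.isOpen.mem_nhds hy)).isSymmSndFDerivAt
        (by simpa using ENat.LEInfty.out)
    exact congrArg ((1 / 2 : ℝ) * ·) (hsymm.eq η ξ)
  pos ξ hξ := by
    rw [← hh.halfHessianSq_eq hy]
    exact hh.posDef y hy ξ hξ

theorem fderiv_sq_smul (hh : IsConicNorm D h) (hy : y ∈ D) {k : ℝ} (hk : 0 < k) :
    fderiv ℝ (fun w => h w ^ 2) (k • y) = k • fderiv ℝ (fun w => h w ^ 2) y := by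
  have hhom : ∀ᶠ w in 𝓝 y, h (k • w) ^ 2 = (k ^ (2 : ℝ)) • h w ^ 2 := by
    filter_upwards [hh.isOpen.mem_nhds hy] with w hw
    rw [hh.homogeneous w hw k hk, mul_pow, Real.rpow_two, smul_eq_mul]
  rw [fderiv_smul_of_homogeneous hk hhom]
  norm_num

theorem hessForm_smul (hh : IsConicNorm D h) (hy : y ∈ D) {k : ℝ} (hk : 0 < k) :
    hessForm h (k • y) = hessForm h y := by
  have hhom : ∀ᶠ w in 𝓝 y, fderiv ℝ (fun w => h w ^ 2) (k • w) =
      (k ^ (1 : ℝ)) • fderiv ℝ (fun w => h w ^ 2) w := by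
    filter_upwards [hh.isOpen.mem_nhds hy] with w hw
    rw [hh.fderiv_sq_smul hw hk, Real.rpow_one]
  have hsnd : fderiv ℝ (fderiv ℝ fun w => h w ^ 2) (k • y) =
      fderiv ℝ (fderiv ℝ fun w => h w ^ 2) y := by
    rw [fderiv_smul_of_homogeneous (f := fderiv ℝ fun w => h w ^ 2) (H := 1) hk hhom, sub_self,
      Real.rpow_zero, one_smul]
  simp only [hessForm, hsnd]

theorem fderiv_self (hh : IsConicNorm D h) (hy : y ∈ D) : fderiv ℝ h y y = h y := by
  rw [fderiv_apply_self_of_homogeneous (H := 1) (hh.differentiableAt hy), one_smul]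
  intro k hk
  rw [hh.homogeneous y hy k hk, Real.rpow_one, smul_eq_mul]

theorem hessForm_self (hh : IsConicNorm D h) (hy : y ∈ D) (ξ : 𝔼 N) :
    hessForm h y y ξ = h y * fderiv ℝ h y ξ := by
  have heuler : fderiv ℝ (fderiv ℝ fun w => h w ^ 2) y y = fderiv ℝ (fun w => h w ^ 2) y := by
    rw [fderiv_apply_self_of_homogeneous (H := 1) (hh.differentiableAt_fderiv_sq hy), one_smul]
    intro k hk
    rw [hh.fderiv_sq_smul hy hk, Real.rpow_one]
  rw [(hh.isInnerProduct_hessForm hy).symm]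
  change 1 / 2 * fderiv ℝ (fderiv ℝ fun w => h w ^ 2) y y ξ = _
  rw [heuler, ((hh.differentiableAt hy).hasFDerivAt.pow 2).fderiv]
  simp
  ring

theorem hessForm_self_self (hh : IsConicNorm D h) (hy : y ∈ D) : hessForm h y y y = h y ^ 2 := by
  rw [hh.hessForm_self hy, hh.fderiv_self hy, sq]

theorem inv_smul_mem (hh : IsConicNorm D h) (hy : y ∈ D) : (h y)⁻¹ • y ∈ D :=
  hh.conic y hy _ (inv_pos.2 (hh.pos y hy))

theorem apply_inv_smul (hh : IsConicNorm D h) (hy : y ∈ D) : h ((h y)⁻¹ • y) = 1 := by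
  rw [hh.homogeneous y hy _ (inv_pos.2 (hh.pos y hy)), inv_mul_cancel₀ (hh.pos y hy).ne']

end IsConicNorm

end ConicNorm

section UnitParam

variable {N n : ℕ} {D : Set (𝔼 N)} {h : 𝔼 N → ℝ} {V : Set (𝔼 n)} {φ : 𝔼 n → 𝔼 N} {u : 𝔼 n}

/-- A local parametrization of the hypersurface `h = 1` in `D`. -/
structure IsUnitParam (D : Set (𝔼 N)) (h : 𝔼 N → ℝ) (V : Set (𝔼 n)) (φ : 𝔼 n → 𝔼 N) : Prop where
  isOpen : IsOpen V
  smooth : ContDiffOn ℝ ∞ φ V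
  mem : ∀ u ∈ V, φ u ∈ D
  unit : ∀ u ∈ V, h (φ u) = 1
  immersion : ∀ u ∈ V, Function.Injective (fderiv ℝ φ u)

/-- The metric induced on a hypersurface with parametrization `φ` by the form `½ ∂²h² / ∂y∂y`. -/
def fiberMetric (h : 𝔼 N → ℝ) (φ : 𝔼 n → 𝔼 N) (u : 𝔼 n) : Matrix (Fin n) (Fin n) ℝ :=
  Matrix.of fun i j => halfHessianSq h (φ u)
    (fderiv ℝ φ u (EuclideanSpace.single i 1)) (fderiv ℝ φ u (EuclideanSpace.single j 1))

/-- The `n`-dimensional hypersurface `h = 1` in `D` has constant curvature `K`. -/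
def HasUnitCurvature (n : ℕ) (D : Set (𝔼 N)) (h : 𝔼 N → ℝ) (K : ℝ) : Prop :=
  ∀ (V : Set (𝔼 n)) (φ : 𝔼 n → 𝔼 N), IsUnitParam D h V φ →
    HasConstantCurvatureOn (fiberMetric h φ) V K

namespace IsUnitParam

theorem hasFDerivAt (hφ : IsUnitParam D h V φ) (hu : u ∈ V) : HasFDerivAt φ (fderiv ℝ φ u) u :=
  ((hφ.smooth.contDiffAt (hφ.isOpen.mem_nhds hu)).differentiableAt (by simp)).hasFDerivAt

theorem fiberMetric_eq (hφ : IsUnitParam D h V φ) (hh : IsConicNorm D h) (hu : u ∈ V) :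
    fiberMetric h φ u = Matrix.of fun i j => hessForm h (φ u)
      (fderiv ℝ φ u (EuclideanSpace.single i 1)) (fderiv ℝ φ u (EuclideanSpace.single j 1)) := by
  ext i j
  exact hh.halfHessianSq_eq (hφ.mem u hu) _ _

theorem fiberMetric_isSymm (hφ : IsUnitParam D h V φ) (hh : IsConicNorm D h) (hu : u ∈ V) :
    (fiberMetric h φ u).IsSymm := by
  rw [hφ.fiberMetric_eq hh hu]
  exact Matrix.IsSymm.ext fun _ _ => (hh.isInnerProduct_hessForm (hφ.mem u hu)).symm _ _

theorem fiberMetric_diag_pos (hφ : IsUnitParam D h V φ) (hh : IsConicNorm D h) (hu : u ∈ V)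
    (i : Fin n) : 0 < fiberMetric h φ u i i := by
  refine hh.posDef _ (hφ.mem u hu) _ fun hzero => ?_
  simpa using hφ.immersion u hu (hzero.trans (map_zero _).symm)

theorem sum_fiberMetric (hφ : IsUnitParam D h V φ) (hh : IsConicNorm D h) (hu : u ∈ V)
    (v w : 𝔼 n) : ∑ i, ∑ j, v i * w j * fiberMetric h φ u i j =
      hessForm h (φ u) (fderiv ℝ φ u v) (fderiv ℝ φ u w) := by
  rw [hφ.fiberMetric_eq hh hu]
  exact sum_sum_apply_single (fderiv ℝ φ u) (hessForm h (φ u)) v w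

theorem fderiv_norm_comp (hφ : IsUnitParam D h V φ) (hh : IsConicNorm D h) (hu : u ∈ V)
    (v : 𝔼 n) : fderiv ℝ h (φ u) (fderiv ℝ φ u v) = 0 := by
  have hchain := (hh.differentiableAt (hφ.mem u hu)).hasFDerivAt.comp u (hφ.hasFDerivAt hu)
  have hconst : h ∘ φ =ᶠ[𝓝 u] fun _ => 1 := by
    filter_upwards [hφ.isOpen.mem_nhds hu] with w hw using hφ.unit w hw
  exact congrArg (fun L : 𝔼 n →L[ℝ] ℝ => L v)
    (hchain.unique ((hasFDerivAt_const (1 : ℝ) u).congr_of_eventuallyEq hconst))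

end IsUnitParam

end UnitParam

section Conformal

variable {N n : ℕ} {E : Type*} [NormedAddCommGroup E] [NormedSpace ℝ E] {D : Set (𝔼 N)}
  {h : 𝔼 N → ℝ}

/-- The restriction to one tangent space of the requirements on a conformal automorphism of degree
`H` with multiplier `q`. Neither injectivity nor the positivity of `q` is required. -/
structure IsConformalMapOn (D : Set (𝔼 N)) (h : 𝔼 N → ℝ) (s : E →L[ℝ] E →L[ℝ] ℝ) (H : ℝ)
    (W : Set (𝔼 N)) (c : 𝔼 N → E) (q : 𝔼 N → ℝ) : Prop where
  isOpen : IsOpen W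
  subset : W ⊆ D
  conic : ∀ y ∈ W, ∀ k : ℝ, 0 < k → k • y ∈ W
  smooth : ContDiffOn ℝ ∞ c W
  homogeneous : ∀ y ∈ W, ∀ k : ℝ, 0 < k → c (k • y) = (k ^ H) • c y
  unit : ∀ y ∈ W, h y = 1 → s (c y) (c y) = 1
  conformal : ∀ y ∈ W, ∀ ξ η, halfHessianSq h y ξ η = q y * s (fderiv ℝ c y ξ) (fderiv ℝ c y η)

namespace IsConformalMapOn

variable {s : E →L[ℝ] E →L[ℝ] ℝ} {H : ℝ} {W : Set (𝔼 N)} {c : 𝔼 N → E} {q : 𝔼 N → ℝ} {y : 𝔼 N}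

theorem hasFDerivAt (hc : IsConformalMapOn D h s H W c q) (hy : y ∈ W) :
    HasFDerivAt c (fderiv ℝ c y) y :=
  ((hc.smooth.contDiffAt (hc.isOpen.mem_nhds hy)).differentiableAt (by simp)).hasFDerivAt

theorem apply_self (hc : IsConformalMapOn D h s H W c q) (hh : IsConicNorm D h) (hy : y ∈ W) :
    s (c y) (c y) = (h y ^ H) ^ 2 := by
  have hpos := hh.pos y (hc.subset hy)
  have hunit := hc.unit _ (hc.conic y hy _ (inv_pos.2 hpos)) (hh.apply_inv_smul (hc.subset hy))
  rw [hc.homogeneous y hy _ (inv_pos.2 hpos), Real.inv_rpow hpos.le] at hunit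
  simp only [map_smul, FunLike.coe_smul, Pi.smul_apply, smul_eq_mul] at hunit
  have := Real.rpow_pos_of_pos hpos H
  field_simp at hunit
  exact hunit

theorem multiplier_eq (hc : IsConformalMapOn D h s H W c q) (hh : IsConicNorm D h) (hH : H ≠ 0)
    (hy : y ∈ W) : q y = (1 / H * h y ^ (1 - H)) ^ 2 := by
  have hpos := hh.pos y (hc.subset hy)
  have hradial := hc.conformal y hy y y
  rw [hh.halfHessianSq_eq (hc.subset hy), hh.hessForm_self_self (hc.subset hy),
    fderiv_apply_self_of_homogeneous (hc.hasFDerivAt hy).differentiableAt (hc.homogeneous y hy)]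
    at hradial
  simp only [map_smul, FunLike.coe_smul, Pi.smul_apply, smul_eq_mul, hc.apply_self hh hy]
    at hradial
  have := Real.rpow_pos_of_pos hpos H
  rw [Real.rpow_sub hpos, Real.rpow_one]
  field_simp
  linarith

theorem fderiv_injective (hc : IsConformalMapOn D h s H W c q) (hh : IsConicNorm D h)
    (hy : y ∈ W) : Function.Injective (fderiv ℝ c y) := by
  refine (injective_iff_map_eq_zero _).2 fun ξ hξ => ?_
  have hconf := hc.conformal y hy ξ ξ
  rw [hξ, map_zero, mul_zero] at hconf
  by_contra hne
  exact (hh.posDef _ (hc.subset hy) ξ hne).ne' hconf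

variable {V : Set (𝔼 n)} {φ : 𝔼 n → 𝔼 N} {u : 𝔼 n}

theorem fderiv_comp_param (hc : IsConformalMapOn D h s H W c q) (hφ : IsUnitParam D h V φ)
    (hu : u ∈ V ∩ φ ⁻¹' W) : fderiv ℝ (c ∘ φ) u = (fderiv ℝ c (φ u)).comp (fderiv ℝ φ u) :=
  ((hc.hasFDerivAt hu.2).comp u (hφ.hasFDerivAt hu.1)).fderiv

theorem isSphereImmersion (hc : IsConformalMapOn D h s H W c q) (hh : IsConicNorm D h)
    (hH : H ≠ 0) (hφ : IsUnitParam D h V φ) :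
    IsSphereImmersion ((H ^ 2)⁻¹ • s) (H ^ 2) (V ∩ φ ⁻¹' W) (c ∘ φ) where
  isOpen := hφ.smooth.continuousOn.isOpen_inter_preimage hφ.isOpen hc.isOpen
  smooth := hc.smooth.comp (hφ.smooth.mono inter_subset_left) fun _ hu => hu.2
  mem_sphere u hu := by
    have hunit : s (c (φ u)) (c (φ u)) = 1 := hc.unit _ hu.2 (hφ.unit u hu.1)
    simp [hunit, hH]
  immersion u hu := by
    rw [hc.fderiv_comp_param hφ hu]
    exact (hc.fderiv_injective hh hu.2).comp (hφ.immersion u hu.1)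

theorem inducedMetric_eq_fiberMetric (hc : IsConformalMapOn D h s H W c q) (hh : IsConicNorm D h)
    (hH : H ≠ 0) (hφ : IsUnitParam D h V φ) :
    EqOn (inducedMetric ((H ^ 2)⁻¹ • s) (c ∘ φ)) (fiberMetric h φ) (V ∩ φ ⁻¹' W) := by
  intro u hu
  have hq : q (φ u) = (H ^ 2)⁻¹ := by
    rw [hc.multiplier_eq hh hH hu.2, hφ.unit u hu.1, Real.one_rpow, mul_one, one_div, inv_pow]
  ext i j
  simp only [inducedMetric, fiberMetric, Matrix.of_apply, hc.fderiv_comp_param hφ hu,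
    hc.conformal _ hu.2, hq]
  rfl

end IsConformalMapOn

theorem hasUnitCurvature_of_isConformalMapOn [FiniteDimensional ℝ E] (hh : IsConicNorm D h)
    {s : E →L[ℝ] E →L[ℝ] ℝ} (hs : IsInnerProduct s) (hE : Module.finrank ℝ E = n + 1) {H : ℝ}
    (hH : H ≠ 0)
    (hlocal : ∀ y ∈ D, ∃ W c q, y ∈ W ∧ IsConformalMapOn D h s H W c q) :
    HasUnitCurvature n D h (H ^ 2) := by
  intro V φ hφ u hu
  obtain ⟨W, c, q, hyW, hc⟩ := hlocal _ (hφ.mem u hu)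
  have hψ := hc.isSphereImmersion hh hH hφ
  exact (hψ.hasConstantCurvatureOn_inducedMetric (hs.smul (by positivity)) hE).congr hψ.isOpen
    (hc.inducedMetric_eq_fiberMetric hh hH hφ) u ⟨hu, hyW⟩

end Conformal

/-! ### Radial coordinates -/

section Radial

variable {N n : ℕ} {D : Set (𝔼 N)} {h : 𝔼 N → ℝ} (e : (ℝ × 𝔼 n) ≃L[ℝ] 𝔼 N)

/-- The radial projection of the affine hyperplane `e (1, u)` to the hypersurface `h = 1`. -/
def radialParam (h : 𝔼 N → ℝ) (e : (ℝ × 𝔼 n) ≃L[ℝ] 𝔼 N) (u : 𝔼 n) : 𝔼 N :=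
  (h (e (1, u)))⁻¹ • e (1, u)

/-- The inverse of `radialParam`, extended to the half-space `{y | 0 < (e.symm y).1}` as a function
constant on rays; it does not depend on the norm. -/
def radialChart (e : (ℝ × 𝔼 n) ≃L[ℝ] 𝔼 N) (y : 𝔼 N) : 𝔼 n :=
  (e.symm y).1⁻¹ • (e.symm y).2

theorem exists_continuousLinearEquiv_apply_one_zero (hN : N = n + 1) {y₀ : 𝔼 N} (hy₀ : y₀ ≠ 0) :
    ∃ e : (ℝ × 𝔼 n) ≃L[ℝ] 𝔼 N, e (1, 0) = y₀ := by
  let e₀ : (ℝ × 𝔼 n) ≃L[ℝ] 𝔼 N := ContinuousLinearEquiv.ofFinrankEq (by simp [hN, add_comm])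
  have he₀ : e₀ (1, 0) ≠ 0 := by simp
  obtain ⟨A, hA⟩ := SeparatingDual.exists_continuousLinearEquiv_apply_eq (R := ℝ) he₀ hy₀
  exact ⟨e₀.trans A, hA⟩

theorem radialChart_smul {k : ℝ} (hk : k ≠ 0) (y : 𝔼 N) :
    radialChart e (k • y) = radialChart e y := by
  simp only [radialChart, map_smul, Prod.smul_fst, Prod.smul_snd, smul_eq_mul, smul_smul]
  congr 1
  field_simp

theorem radialChart_apply_one (u : 𝔼 n) : radialChart e (e (1, u)) = u := by
  simp [radialChart]

theorem apply_one_radialChart {y : 𝔼 N} (hy : (e.symm y).1 ≠ 0) :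
    e (1, radialChart e y) = (e.symm y).1⁻¹ • y := by
  apply e.symm.injective
  ext <;> simp [radialChart, hy]

theorem contDiffOn_radialChart : ContDiffOn ℝ ∞ (radialChart e) {y | (e.symm y).1 ≠ 0} := by
  unfold radialChart
  fun_prop (disch := simp)

theorem differentiableAt_radialChart {y : 𝔼 N} (hy : (e.symm y).1 ≠ 0) :
    DifferentiableAt ℝ (radialChart e) y :=
  ((contDiffOn_radialChart e).contDiffAt ((isOpen_ne_fun (by fun_prop) (by fun_prop)).mem_nhds
    hy)).differentiableAt (by simp)

namespace IsConicNorm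

variable {e}

theorem radialChart_radialParam (hh : IsConicNorm D h) {u : 𝔼 n} (hu : e (1, u) ∈ D) :
    radialChart e (radialParam h e u) = u := by
  rw [radialParam, radialChart_smul e (inv_pos.2 (hh.pos _ hu)).ne', radialChart_apply_one]

theorem apply_one_radialChart_mem (hh : IsConicNorm D h) {y : 𝔼 N} (hy : y ∈ D)
    (hpos : 0 < (e.symm y).1) : e (1, radialChart e y) ∈ D := by
  rw [apply_one_radialChart e hpos.ne']
  exact hh.conic y hy _ (inv_pos.2 hpos)

theorem radialParam_radialChart (hh : IsConicNorm D h) {y : 𝔼 N} (hy : y ∈ D)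
    (hpos : 0 < (e.symm y).1) : radialParam h e (radialChart e y) = (h y)⁻¹ • y := by
  rw [radialParam, apply_one_radialChart e hpos.ne', hh.homogeneous y hy _ (inv_pos.2 hpos),
    smul_smul]
  congr 1
  field_simp

theorem isUnitParam_radialParam (hh : IsConicNorm D h) (e : (ℝ × 𝔼 n) ≃L[ℝ] 𝔼 N) :
    IsUnitParam D h {u | e (1, u) ∈ D} (radialParam h e) := by
  have haffine : ContDiff ℝ ∞ fun u : 𝔼 n => e (1, u) := by fun_prop
  have hV : IsOpen {u | e (1, u) ∈ D} := hh.isOpen.preimage haffine.continuous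
  have hsmooth : ContDiffOn ℝ ∞ (radialParam h e) {u | e (1, u) ∈ D} :=
    ((hh.smooth.comp haffine.contDiffOn fun _ hu => hu).inv fun u hu => (hh.pos _ hu).ne').smul
      haffine.contDiffOn
  refine ⟨hV, hsmooth, fun u hu => hh.inv_smul_mem hu, fun u hu => hh.apply_inv_smul hu,
    fun u hu => ?_⟩
  have hfst : (e.symm (radialParam h e u)).1 ≠ 0 := by
    simpa [radialParam] using (hh.pos _ hu).ne'
  have hparam : DifferentiableAt ℝ (radialParam h e) u :=
    (hsmooth.contDiffAt (hV.mem_nhds hu)).differentiableAt (by simp)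
  have hid : radialChart e ∘ radialParam h e =ᶠ[𝓝 u] id := by
    filter_upwards [hV.mem_nhds hu] with w hw using hh.radialChart_radialParam hw
  have hleft := ((differentiableAt_radialChart e hfst).hasFDerivAt.comp u hparam.hasFDerivAt).unique
    ((hasFDerivAt_id u).congr_of_eventuallyEq hid)
  exact Function.LeftInverse.injective fun v => congrArg (fun T : 𝔼 n →L[ℝ] 𝔼 n => T v) hleft

end IsConicNorm

theorem HasUnitCurvature.riemannTensor_eq {K : ℝ} (hK : HasUnitCurvature n D h K) {V : Set (𝔼 n)}
    {φ : 𝔼 n → 𝔼 N} (hφ : IsUnitParam D h V φ) {u : 𝔼 n} (hu : u ∈ V) {i j : Fin n}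
    (hij : i ≠ j) : riemannTensor (fiberMetric h φ) i j i j u = K * fiberMetric h φ u j j := by
  rw [hK V φ hφ u hu i j i j]
  simp [hij]

theorem HasUnitCurvature.unique (hh : IsConicNorm D h) (hN : N = n + 1) (hn : 2 ≤ n)
    (hD : D.Nonempty) {K K' : ℝ} (hK : HasUnitCurvature n D h K)
    (hK' : HasUnitCurvature n D h K') : K = K' := by
  obtain ⟨y₀, hy₀⟩ := hD
  obtain ⟨e, rfl⟩ := exists_continuousLinearEquiv_apply_one_zero hN (hh.ne_zero y₀ hy₀)
  have hφ := hh.isUnitParam_radialParam e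
  have hij : (⟨0, by omega⟩ : Fin n) ≠ ⟨1, by omega⟩ := by simp
  have heq := (hK.riemannTensor_eq hφ hy₀ hij).symm.trans (hK'.riemannTensor_eq hφ hy₀ hij)
  exact mul_right_cancel₀ (hφ.fiberMetric_diag_pos hh hy₀ _).ne' heq

end Radial

/-! ### Isometric immersions into spheres -/

section GaussForm

variable {n : ℕ}

theorem ext_single {ι F : Type*} [Finite ι] [DecidableEq ι] [NormedAddCommGroup F]
    [NormedSpace ℝ F] {f g : EuclideanSpace ℝ ι →L[ℝ] F}
    (h : ∀ i, f (EuclideanSpace.single i 1) = g (EuclideanSpace.single i 1)) : f = g := by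
  cases nonempty_fintype ι
  ext x
  rw [eq_sum_smul_single x]
  simp only [map_sum, map_smul, h]

theorem hasFDerivAt_apply_apply_of_parallel {U G : Type*} [NormedAddCommGroup U] [NormedSpace ℝ U]
    [NormedAddCommGroup G] [NormedSpace ℝ G] {b : U → G →L[ℝ] G →L[ℝ] ℝ} {a : U →L[ℝ] G →L[ℝ] G}
    {X Y : U → G} {u : U} (hb : DifferentiableAt ℝ b u)
    (hparallel : ∀ v x y, fderiv ℝ b u v x y = b u (a v x) y + b u x (a v y))
    (hX : HasFDerivAt X (-(a.flip (X u))) u) (hY : HasFDerivAt Y (-(a.flip (Y u))) u) :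
    HasFDerivAt (fun u => b u (X u) (Y u)) (0 : U →L[ℝ] ℝ) u := by
  refine ((hb.hasFDerivAt.clm_apply hX).clm_apply hY).congr_fderiv ?_
  ext v
  simp [hparallel]

/-- The components of the form `ds² + κ γ`. -/
def gaussFormCoeff (γ : 𝔼 n → Matrix (Fin n) (Fin n) ℝ) (κ : ℝ) :
    Option (Fin n) → Option (Fin n) → 𝔼 n → ℝ
  | none, none => fun _ => 1
  | some _, none => fun _ => 0
  | none, some _ => fun _ => 0
  | some i, some j => fun u => κ * γ u i j

/-- The bilinear form `(x, y) ↦ xᵃ yᵇ`. -/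
def coordForm (a b : Option (Fin n)) :
    𝔾 n →L[ℝ] 𝔾 n →L[ℝ] ℝ :=
  (EuclideanSpace.proj a : 𝔾 n →L[ℝ] ℝ).smulRight
    (EuclideanSpace.proj b : 𝔾 n →L[ℝ] ℝ)

theorem coordForm_apply (a b : Option (Fin n)) (x y : 𝔾 n) :
    coordForm a b x y = x a * y b := rfl

/-- The form `ds² + κ γ`. When `κ γ` is the metric induced on a hypersurface of the unit sphere, it
is the Gram matrix of the frame made of the position vector and the coordinate vector fields. -/
def gaussForm (γ : 𝔼 n → Matrix (Fin n) (Fin n) ℝ) (κ : ℝ) (u : 𝔼 n) :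
    𝔾 n →L[ℝ] 𝔾 n →L[ℝ] ℝ :=
  ∑ a : Option (Fin n) × Option (Fin n), gaussFormCoeff γ κ a.1 a.2 u • coordForm a.1 a.2

theorem gaussForm_apply_eq_sum (γ : 𝔼 n → Matrix (Fin n) (Fin n) ℝ) (κ : ℝ) (u : 𝔼 n)
    (x y : 𝔾 n) :
    gaussForm γ κ u x y = ∑ a, ∑ b, gaussFormCoeff γ κ a b u * (x a * y b) := by
  simp only [gaussForm, FunLike.coe_sum, Finset.sum_apply, FunLike.coe_smul, Pi.smul_apply,
    coordForm_apply, smul_eq_mul, Fintype.sum_prod_type]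

theorem gaussForm_apply (γ : 𝔼 n → Matrix (Fin n) (Fin n) ℝ) (κ : ℝ) (u : 𝔼 n)
    (x y : 𝔾 n) : gaussForm γ κ u x y =
      x none * y none + κ * ∑ i, ∑ j, x (some i) * y (some j) * γ u i j := by
  simp only [gaussForm_apply_eq_sum, Fintype.sum_option, gaussFormCoeff, one_mul, zero_mul,
    Finset.sum_const_zero, add_zero, zero_add, Finset.mul_sum]
  congr 1
  exact Finset.sum_congr rfl fun i _ => Finset.sum_congr rfl fun j _ => by ring

theorem isInnerProduct_gaussForm {γ : 𝔼 n → Matrix (Fin n) (Fin n) ℝ} {κ : ℝ} {u : 𝔼 n}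
    (hκ : 0 < κ) (hsymm : (γ u).IsSymm)
    (hpos : ∀ v : 𝔼 n, v ≠ 0 → 0 < ∑ i, ∑ j, v i * v j * γ u i j) :
    IsInnerProduct (gaussForm γ κ u) where
  symm x y := by
    rw [gaussForm_apply, gaussForm_apply, Finset.sum_comm, mul_comm (x none)]
    congr 2
    exact Finset.sum_congr rfl fun i _ => Finset.sum_congr rfl fun j _ => by
      rw [hsymm.apply i j]; ring
  pos x hx := by
    rw [gaussForm_apply]
    let v : 𝔼 n := WithLp.toLp 2 fun i => x (some i)
    by_cases hv : v = 0
    · have hsome (i : Fin n) : x (some i) = 0 := congrArg (fun w : 𝔼 n => w i) hv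
      have hnone : x none ≠ 0 := fun h => hx (by ext (_ | i) <;> simp [h, hsome])
      simp only [hsome, zero_mul, Finset.sum_const_zero, mul_zero, add_zero]
      exact mul_self_pos.2 hnone
    · exact add_pos_of_nonneg_of_pos (mul_self_nonneg _) (mul_pos hκ (hpos v hv))

variable {γ : 𝔼 n → Matrix (Fin n) (Fin n) ℝ} {V : Set (𝔼 n)} {κ : ℝ} {u : 𝔼 n}

theorem differentiableAt_gaussFormCoeff (hγ : IsPseudoRiemannianOn γ V) (hu : u ∈ V)
    (a b : Option (Fin n)) : DifferentiableAt ℝ (gaussFormCoeff γ κ a b) u := by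
  rcases a with _ | i <;> rcases b with _ | j
  · exact differentiableAt_const _
  · exact differentiableAt_const _
  · exact differentiableAt_const _
  · exact (hγ.differentiableAt hu i j).const_mul _

theorem partialDeriv_gaussFormCoeff (hγ : IsPseudoRiemannianOn γ V) (hu : u ∈ V) (i : Fin n)
    (a b : Option (Fin n)) : partialDeriv i (gaussFormCoeff γ κ a b) u =
      ∑ c, gaussCoeff γ κ i c a u * gaussFormCoeff γ κ c b u +
        ∑ c, gaussCoeff γ κ i c b u * gaussFormCoeff γ κ a c u := by
  have hconst (c : ℝ) : partialDeriv i (fun _ => c) u = 0 := by simp [partialDeriv]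
  have hsymm (i j : Fin n) : γ u i j = γ u j i := (hγ.symm u hu).apply j i
  rcases a with _ | j <;> rcases b with _ | k <;>
    simp only [gaussFormCoeff, gaussCoeff, hconst, Fintype.sum_option]
  · simp
  · simp
  · simp [hsymm j i]
  · have hmul : partialDeriv i (fun u => κ * γ u j k) u =
        κ * partialDeriv i (fun u => γ u j k) u := by
      simp [partialDeriv, fderiv_const_mul (hγ.differentiableAt hu j k)]
    rw [hmul, hγ.partialDeriv_eq hu, mul_zero, mul_zero, zero_add, zero_add, mul_add,
      Finset.mul_sum, Finset.mul_sum]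
    congr 1
    · exact Finset.sum_congr rfl fun m _ => by rw [hsymm k m]; ring
    · exact Finset.sum_congr rfl fun m _ => by ring

theorem differentiableAt_gaussForm (hγ : IsPseudoRiemannianOn γ V) (hu : u ∈ V) :
    DifferentiableAt ℝ (gaussForm γ κ) u :=
  (hasFDerivAt_sum_smul_const (fun a : Option (Fin n) × Option (Fin n) => coordForm a.1 a.2)
    fun a => differentiableAt_gaussFormCoeff hγ hu a.1 a.2).differentiableAt

theorem fderiv_gaussForm_apply (hγ : IsPseudoRiemannianOn γ V) (hu : u ∈ V) (v : 𝔼 n)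
    (x y : 𝔾 n) : fderiv ℝ (gaussForm γ κ) u v x y =
      ∑ a, ∑ b, fderiv ℝ (gaussFormCoeff γ κ a b) u v * (x a * y b) := by
  have hfderiv : fderiv ℝ (gaussForm γ κ) u v =
      ∑ a : Option (Fin n) × Option (Fin n),
        fderiv ℝ (gaussFormCoeff γ κ a.1 a.2) u v • coordForm a.1 a.2 :=
    fderiv_sum_smul_const_apply (fun a : Option (Fin n) × Option (Fin n) => coordForm a.1 a.2)
      (fun a => differentiableAt_gaussFormCoeff hγ hu a.1 a.2) v
  simp only [hfderiv, FunLike.coe_sum, Finset.sum_apply, FunLike.coe_smul, Pi.smul_apply,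
    coordForm_apply, smul_eq_mul, Fintype.sum_prod_type]

theorem fderiv_gaussForm (hγ : IsPseudoRiemannianOn γ V) (hu : u ∈ V) (v : 𝔼 n)
    (x y : 𝔾 n) :
    fderiv ℝ (gaussForm γ κ) u v x y =
      gaussForm γ κ u (matrixConnection (gaussCoeff γ κ) u v x) y +
        gaussForm γ κ u x (matrixConnection (gaussCoeff γ κ) u v y) := by
  set b := gaussForm γ κ u
  set a := matrixConnection (gaussCoeff γ κ) u
  have hcoord (i : Fin n) : fderiv ℝ (gaussForm γ κ) u (EuclideanSpace.single i 1) =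
      b.comp (a (EuclideanSpace.single i 1)) +
        (b.flip.comp (a (EuclideanSpace.single i 1))).flip := by
    refine ext_single fun p => ext_single fun q => ?_
    have hcoeff := partialDeriv_gaussFormCoeff (κ := κ) hγ hu i p q
    rw [partialDeriv] at hcoeff
    simp only [FunLike.coe_add, Pi.add_apply, ContinuousLinearMap.comp_apply,
      ContinuousLinearMap.flip_apply, a, b]
    rw [fderiv_gaussForm_apply hγ hu]
    simpa [gaussForm_apply_eq_sum, matrixConnection_single_single, mul_comm] using hcoeff
  rw [eq_sum_smul_single v]
  simp only [map_sum, map_smul, FunLike.coe_sum, Finset.sum_apply, FunLike.coe_smul,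
    Pi.smul_apply, hcoord, ← Finset.sum_add_distrib, smul_add, FunLike.coe_add, Pi.add_apply]
  rfl

theorem IsParallelAt.apply {U G : Type*} [NormedAddCommGroup U] [NormedSpace ℝ U]
    [NormedAddCommGroup G] [NormedSpace ℝ G] {a : U → U →L[ℝ] G →L[ℝ] G} {Z : U → G →L[ℝ] G}
    {u : U} (hZ : IsParallelAt a Z u) (x : G) :
    HasFDerivAt (fun u => Z u x) ((Z u).comp ((a u).flip x)) u := by
  refine ((ContinuousLinearMap.apply ℝ G x).hasFDerivAt.comp u hZ).congr_fderiv ?_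
  ext v
  simp

theorem IsParallelAt.ringInverse_apply {U G : Type*} [NormedAddCommGroup U] [NormedSpace ℝ U]
    [NormedAddCommGroup G] [NormedSpace ℝ G] [CompleteSpace G] {a : U → U →L[ℝ] G →L[ℝ] G}
    {Z : U → G →L[ℝ] G} {u : U} (hZ : IsParallelAt a Z u) (hunit : IsUnit (Z u)) (x : G) :
    HasFDerivAt (fun u => Ring.inverse (Z u) x) (-((a u).flip (Ring.inverse (Z u) x))) u := by
  refine ((ContinuousLinearMap.apply ℝ G x).hasFDerivAt.comp u
    (hZ.ringInverse hunit)).congr_fderiv ?_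
  ext v
  simp

theorem gaussForm_zero_apply_of_parallel (hγ : IsPseudoRiemannianOn γ V) (hconv : Convex ℝ V)
    (hzero : 0 ∈ V) {Z : 𝔼 n → 𝔾 n →L[ℝ]
      𝔾 n} (hZ0 : Z 0 = 1) (hunit : ∀ u ∈ V, IsUnit (Z u))
    (hZ : ∀ u ∈ V, IsParallelAt (matrixConnection (gaussCoeff γ κ)) Z u) (hu : u ∈ V)
    (x y : 𝔾 n) :
    gaussForm γ κ 0 (Z u x) (Z u y) = gaussForm γ κ u x y := by
  have hconst (X Y : 𝔾 n) :
      gaussForm γ κ u (Ring.inverse (Z u) X) (Ring.inverse (Z u) Y) = gaussForm γ κ 0 X Y := by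
    have hderiv (w : 𝔼 n) (hw : w ∈ V) := hasFDerivAt_apply_apply_of_parallel
      (differentiableAt_gaussForm hγ hw) (fderiv_gaussForm (κ := κ) hγ hw)
      ((hZ w hw).ringInverse_apply (hunit w hw) X) ((hZ w hw).ringInverse_apply (hunit w hw) Y)
    have hzero_eq := hconv.is_const_of_fderivWithin_eq_zero (𝕜 := ℝ)
      (fun w hw => (hderiv w hw).differentiableAt.differentiableWithinAt)
      (fun w hw => by rw [fderivWithin_of_isOpen hγ.isOpen hw, (hderiv w hw).fderiv]) hu hzero
    simpa [hZ0] using hzero_eq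
  have hcancel (X : 𝔾 n) : Ring.inverse (Z u) (Z u X) = X :=
    congrArg (fun T : 𝔾 n →L[ℝ] 𝔾 n =>
      T X) (Ring.inverse_mul_cancel _ (hunit u hu))
  rw [← hconst, hcancel, hcancel]

end GaussForm

section Frames

variable {P E G : Type*} [NormedAddCommGroup P] [NormedSpace ℝ P]
  [NormedAddCommGroup E] [NormedSpace ℝ E] [NormedAddCommGroup G] [NormedSpace ℝ G]

/-- One step of the Gram–Schmidt process, depending smoothly on parameters. -/
theorem exists_unit_orthogonal {t : P → E →L[ℝ] E →L[ℝ] ℝ} {B : Set P} (hB : IsOpen B)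
    (ht : ContDiffOn ℝ ∞ t B) (hinner : ∀ p ∈ B, IsInnerProduct (t p)) {d : ℕ}
    {e : Fin d → P → E} (he : ∀ a, ContDiffOn ℝ ∞ (e a) B)
    (horth : ∀ p ∈ B, ∀ a b, t p (e a p) (e b p) = if a = b then 1 else 0)
    (hd : d < Module.finrank ℝ E) {p₀ : P} (hp₀ : p₀ ∈ B) :
    ∃ (w : P → E) (B' : Set P), IsOpen B' ∧ p₀ ∈ B' ∧ B' ⊆ B ∧ ContDiffOn ℝ ∞ w B' ∧
      ∀ p ∈ B', t p (w p) (w p) = 1 ∧ ∀ a, t p (w p) (e a p) = 0 := by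
  obtain ⟨v, hv⟩ : ∃ v, v ∉ Submodule.span ℝ (range fun a => e a p₀) := by
    by_contra! hall
    have hcard := finrank_range_le_card (R := ℝ) (fun a => e a p₀)
    rw [Set.finrank, Submodule.eq_top_iff'.2 hall, finrank_top, Fintype.card_fin] at hcard
    omega
  let w : P → E := fun p => v - ∑ a, t p v (e a p) • e a p
  have hw : ContDiffOn ℝ ∞ w B := contDiffOn_const.sub (ContDiffOn.sum fun a _ =>
    ((ht.clm_apply contDiffOn_const).clm_apply (he a)).smul (he a))
  have hnormSq : ContDiffOn ℝ ∞ (fun p => t p (w p) (w p)) B := (ht.clm_apply hw).clm_apply hw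
  have horthogonal (p : P) (hp : p ∈ B) (b : Fin d) : t p (w p) (e b p) = 0 := by
    simp [w, map_sub, map_sum, horth p hp]
  have hw₀ : w p₀ ≠ 0 := fun h => hv <| by
    rw [sub_eq_zero.1 h]
    exact Submodule.sum_mem _ fun a _ => Submodule.smul_mem _ _ (Submodule.subset_span ⟨a, rfl⟩)
  let B' : Set P := B ∩ (fun p => t p (w p) (w p)) ⁻¹' Ioi 0
  have hpos (p : P) (hp : p ∈ B') : 0 < t p (w p) (w p) := hp.2
  refine ⟨fun p => (√(t p (w p) (w p)))⁻¹ • w p, B',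
    hnormSq.continuousOn.isOpen_inter_preimage hB isOpen_Ioi,
    ⟨hp₀, (hinner p₀ hp₀).pos _ hw₀⟩, inter_subset_left, ?_, fun p hp => ?_⟩
  · exact (((hnormSq.mono inter_subset_left).sqrt fun p hp => (hpos p hp).ne').inv
      fun p hp => (Real.sqrt_pos.2 (hpos p hp)).ne').smul (hw.mono inter_subset_left)
  · simp only [map_smul, FunLike.coe_smul, Pi.smul_apply, smul_eq_mul, horthogonal p hp.1,
      mul_zero, implies_true, and_true]
    rw [← mul_assoc, ← mul_inv, Real.mul_self_sqrt (hpos p hp).le, inv_mul_cancel₀ (hpos p hp).ne']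

theorem exists_orthonormal_family {t : P → E →L[ℝ] E →L[ℝ] ℝ} {B : Set P} (hB : IsOpen B)
    (ht : ContDiffOn ℝ ∞ t B) (hinner : ∀ p ∈ B, IsInnerProduct (t p)) {p₀ : P} (hp₀ : p₀ ∈ B)
    (d : ℕ) (hd : d ≤ Module.finrank ℝ E) :
    ∃ (e : Fin d → P → E) (B' : Set P), IsOpen B' ∧ p₀ ∈ B' ∧ B' ⊆ B ∧
      (∀ a, ContDiffOn ℝ ∞ (e a) B') ∧
      ∀ p ∈ B', ∀ a b, t p (e a p) (e b p) = if a = b then 1 else 0 := by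
  induction d with
  | zero => exact ⟨fun _ _ => 0, B, hB, hp₀, subset_rfl, fun a => a.elim0, fun _ _ a => a.elim0⟩
  | succ d ih =>
    obtain ⟨e, B₁, hB₁, hp₁, hB₁B, he, horth⟩ := ih (by omega)
    obtain ⟨w, B₂, hB₂, hp₂, hB₂B₁, hw, hwe⟩ := exists_unit_orthogonal hB₁ (ht.mono hB₁B)
      (fun p hp => hinner p (hB₁B hp)) he horth hd hp₁
    refine ⟨Fin.snoc (α := fun _ => P → E) e w, B₂, hB₂, hp₂, hB₂B₁.trans hB₁B, fun a => ?_,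
      fun p hp a b => ?_⟩
    · induction a using Fin.lastCases with
      | last => simpa only [Fin.snoc_last] using hw
      | cast a => simpa only [Fin.snoc_castSucc] using (he a).mono hB₂B₁
    · have hsymm := (hinner p (hB₁B (hB₂B₁ hp))).symm
      induction a using Fin.lastCases <;> induction b using Fin.lastCases <;>
        simp only [Fin.snoc_last, Fin.snoc_castSucc, Fin.castSucc_inj, hwe p hp, hsymm _ (w p),
          horth p (hB₂B₁ hp), Fin.castSucc_ne_last, (Fin.castSucc_ne_last _).symm, if_true,
          if_false]

theorem parseval_of_orthonormal [FiniteDimensional ℝ E] {t : E →L[ℝ] E →L[ℝ] ℝ} {d : ℕ}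
    (hd : d = Module.finrank ℝ E) {e : Fin d → E}
    (he : ∀ a b, t (e a) (e b) = if a = b then 1 else 0) (x y : E) :
    ∑ a, t (e a) x * t (e a) y = t x y := by
  have hli : LinearIndependent ℝ e := by
    rw [Fintype.linearIndependent_iff]
    intro g hg a
    simpa [map_sum, he] using congrArg (t (e a)) hg
  have hx : x ∈ Submodule.span ℝ (range e) := by
    rw [hli.span_eq_top_of_card_eq_finrank' (by simpa using hd)]
    trivial
  obtain ⟨c, rfl⟩ := (Submodule.mem_span_range_iff_exists_fun ℝ).1 hx
  simp [map_sum, he]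

theorem exists_smooth_isometry [FiniteDimensional ℝ G] {t : P → G →L[ℝ] G →L[ℝ] ℝ}
    {s : P → E →L[ℝ] E →L[ℝ] ℝ} (hdim : Module.finrank ℝ G = Module.finrank ℝ E) {B : Set P}
    (hB : IsOpen B) (ht : ContDiffOn ℝ ∞ t B) (htinner : ∀ p ∈ B, IsInnerProduct (t p))
    (hs : ContDiffOn ℝ ∞ s B) (hsinner : ∀ p ∈ B, IsInnerProduct (s p)) {p₀ : P} (hp₀ : p₀ ∈ B) :
    ∃ (T : P → G →L[ℝ] E) (B' : Set P), IsOpen B' ∧ p₀ ∈ B' ∧ B' ⊆ B ∧ ContDiffOn ℝ ∞ T B' ∧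
      ∀ p ∈ B', ∀ x y, s p (T p x) (T p y) = t p x y := by
  obtain ⟨e, B₁, hB₁, hp₁, hB₁B, he, heorth⟩ :=
    exists_orthonormal_family hB ht htinner hp₀ (Module.finrank ℝ G) le_rfl
  obtain ⟨ε, B₂, hB₂, hp₂, -, hε, hεorth⟩ :=
    exists_orthonormal_family hB hs hsinner hp₀ (Module.finrank ℝ G) hdim.le
  refine ⟨fun p => ∑ a, (t p (e a p)).smulRight (ε a p), B₁ ∩ B₂, hB₁.inter hB₂, ⟨hp₁, hp₂⟩,
    inter_subset_left.trans hB₁B, ContDiffOn.sum fun a _ => ?_, ?_⟩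
  · exact ((ht.mono (inter_subset_left.trans hB₁B)).clm_apply
      ((he a).mono inter_subset_left)).smulRight ((hε a).mono inter_subset_right)
  · rintro p ⟨hp₁, hp₂⟩ x y
    rw [← parseval_of_orthonormal rfl (heorth p hp₁) x y]
    simp [map_sum, hεorth p hp₂, mul_comm]

end Frames

section Fibers

variable {P E G : Type*}

theorem isOpen_fiber [TopologicalSpace P] [TopologicalSpace E] {O : Set (P × E)} (hO : IsOpen O)
    (p : P) : IsOpen {y | (p, y) ∈ O} :=
  hO.preimage (by fun_prop)

variable [NormedAddCommGroup P] [NormedSpace ℝ P] [NormedAddCommGroup E] [NormedSpace ℝ E]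
  [NormedAddCommGroup G] [NormedSpace ℝ G]

theorem contDiffOn_fderiv_snd {F : P × E → G} {O : Set (P × E)} (hO : IsOpen O)
    (hF : ContDiffOn ℝ ∞ F O) :
    ContDiffOn ℝ ∞ (fun q : P × E => fderiv ℝ (fun y => F (q.1, y)) q.2) O := by
  have hpartial :
      ContDiffOn ℝ ∞ (fun q => (fderiv ℝ F q).comp (ContinuousLinearMap.inr ℝ P E)) O :=
    (hF.fderiv_of_isOpen hO (by simp)).clm_comp contDiffOn_const
  refine hpartial.congr fun q hq => ?_
  have hderiv : HasFDerivAt F (fderiv ℝ F q) (q.1, q.2) :=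
    ((hF.contDiffAt (hO.mem_nhds hq)).differentiableAt (by simp)).hasFDerivAt
  exact (hderiv.comp q.2 (hasFDerivAt_prodMk_right q.1 q.2)).fderiv

theorem injOn_of_norm_comp_fderiv_sub_id_le {V : Set E} (hV : Convex ℝ V) {f : E → G}
    {f' : E → E →L[ℝ] G} (hf : ∀ x ∈ V, HasFDerivAt f (f' x) x) {R : G →L[ℝ] E}
    (hR : ∀ x ∈ V, ‖R.comp (f' x) - ContinuousLinearMap.id ℝ E‖ ≤ 1 / 2) : InjOn f V := by
  intro x hx y hy hxy
  have hlip := hV.norm_image_sub_le_of_norm_hasFDerivWithin_le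
    (fun z hz => ((R.hasFDerivAt.comp z (hf z hz)).sub (hasFDerivAt_id z)).hasFDerivWithinAt)
    hR hx hy
  have hhalf : ‖y - x‖ ≤ 1 / 2 * ‖y - x‖ := by
    simpa [hxy, norm_sub_rev] using hlip
  have hzero : ‖y - x‖ = 0 := by linarith [norm_nonneg (y - x)]
  exact (sub_eq_zero.1 (norm_eq_zero.1 hzero)).symm

theorem exists_ball_injOn [FiniteDimensional ℝ E] [FiniteDimensional ℝ G] {ψ : P × E → G}
    {O : Set (P × E)} (hO : IsOpen O) (hψ : ContDiffOn ℝ ∞ ψ O) {p₀ : P} (hp₀ : (p₀, 0) ∈ O)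
    (hinj : Function.Injective (fderiv ℝ (fun u => ψ (p₀, u)) 0)) :
    ∃ r, 0 < r ∧ ∀ p ∈ Metric.ball p₀ r, InjOn (fun u => ψ (p, u)) (Metric.ball 0 r) := by
  obtain ⟨R, hR⟩ : ∃ R : G →L[ℝ] E, R.comp (fderiv ℝ (fun u => ψ (p₀, u)) 0) =
      ContinuousLinearMap.id ℝ E := by
    obtain ⟨R, hR⟩ := LinearMap.exists_leftInverse_of_injective
      (fderiv ℝ (fun u => ψ (p₀, u)) 0).toLinearMap (LinearMap.ker_eq_bot.2 hinj)
    exact ⟨LinearMap.toContinuousLinearMap R,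
      ContinuousLinearMap.ext fun x => LinearMap.congr_fun hR x⟩
  have hcont : ContinuousOn (fun q : P × E => R.comp (fderiv ℝ (fun u => ψ (q.1, u)) q.2) -
      ContinuousLinearMap.id ℝ E) O :=
    ((contDiffOn_const.clm_comp (contDiffOn_fderiv_snd hO hψ)).sub contDiffOn_const).continuousOn
  have hnear : {q | q ∈ O ∧ ‖R.comp (fderiv ℝ (fun u => ψ (q.1, u)) q.2) -
      ContinuousLinearMap.id ℝ E‖ < 1 / 2} ∈ 𝓝 (p₀, (0 : E)) := by
    refine inter_mem (hO.mem_nhds hp₀) ((hcont.norm.continuousAt (hO.mem_nhds hp₀)).eventually_lt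
      continuousAt_const ?_)
    rw [hR, sub_self, norm_zero]
    norm_num
  obtain ⟨r, hr, hball⟩ := Metric.mem_nhds_iff.1 hnear
  rw [← ball_prod_same] at hball
  refine ⟨r, hr, fun p hp => injOn_of_norm_comp_fderiv_sub_id_le (convex_ball 0 r)
    (fun u hu => ?_) fun u hu => (hball (mk_mem_prod hp hu)).2.le⟩
  exact (((contDiffOn_snd_of_contDiffOn hψ p).contDiffAt ((isOpen_fiber hO p).mem_nhds
    (hball (mk_mem_prod hp hu)).1)).differentiableAt (by simp)).hasFDerivAt

end Fibers

section SphereMap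

variable {P E : Type*} [NormedAddCommGroup P] [NormedSpace ℝ P] [NormedAddCommGroup E]
  [NormedSpace ℝ E] {n : ℕ}

/-- `γ p`, for `p : P`, is a family of matrices of Riemannian metrics, smooth jointly in the
parameter `p` and the coordinates; `O` is the open set on which the family is considered. -/
structure IsRiemannianFamily (γ : P → 𝔼 n → Matrix (Fin n) (Fin n) ℝ) (O : Set (P × 𝔼 n)) :
    Prop where
  isOpen : IsOpen O
  smooth : ∀ i j, ContDiffOn ℝ ∞ (fun q : P × 𝔼 n => γ q.1 q.2 i j) O
  symm : ∀ q ∈ O, (γ q.1 q.2).IsSymm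
  pos : ∀ q ∈ O, ∀ v : 𝔼 n, v ≠ 0 → 0 < ∑ i, ∑ j, v i * v j * γ q.1 q.2 i j

theorem contDiffOn_sum_smul_const {X F α : Type*} [NormedAddCommGroup X] [NormedSpace ℝ X]
    [NormedAddCommGroup F] [NormedSpace ℝ F] [Fintype α] (c : α → F) {f : α → X → ℝ} {V : Set X}
    (hf : ∀ a, ContDiffOn ℝ ∞ (f a) V) : ContDiffOn ℝ ∞ (fun x => ∑ a, f a x • c a) V :=
  ContDiffOn.sum fun a _ => (hf a).smul contDiffOn_const

theorem contDiffOn_matrixConnection {ι : Type*} [Fintype ι] [DecidableEq ι]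
    {m : P → Fin n → ι → ι → 𝔼 n → ℝ} {O : Set (P × 𝔼 n)}
    (hm : ∀ i p o, ContDiffOn ℝ ∞ (fun q : P × 𝔼 n => m q.1 i p o q.2) O) :
    ContDiffOn ℝ ∞ (fun q : P × 𝔼 n => matrixConnection (m q.1) q.2) O :=
  contDiffOn_sum_smul_const (fun x : Fin n × ι × ι => elementaryForm x.1 x.2.1 x.2.2)
    (f := fun x (q : P × 𝔼 n) => m q.1 x.1 x.2.1 x.2.2 q.2) fun x => hm x.1 x.2.1 x.2.2

namespace IsRiemannianFamily

variable {γ : P → 𝔼 n → Matrix (Fin n) (Fin n) ℝ} {K : P → ℝ} {O : Set (P × 𝔼 n)}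

theorem det_ne_zero (hγ : IsRiemannianFamily γ O) {q : P × 𝔼 n} (hq : q ∈ O) :
    (γ q.1 q.2).det ≠ 0 := by
  intro hdet
  obtain ⟨v, hv, hγv⟩ := Matrix.exists_mulVec_eq_zero_iff.2 hdet
  have hrow (i : Fin n) : ∑ j, γ q.1 q.2 i j * v j = 0 := congrFun hγv i
  refine (hγ.pos q hq (WithLp.toLp 2 v) fun h => hv (congrArg WithLp.ofLp h)).ne' ?_
  refine Finset.sum_eq_zero fun i _ => ?_
  calc ∑ j, v i * v j * γ q.1 q.2 i j = v i * ∑ j, γ q.1 q.2 i j * v j := by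
        rw [Finset.mul_sum]
        exact Finset.sum_congr rfl fun j _ => by ring
    _ = 0 := by rw [hrow, mul_zero]

theorem isPseudoRiemannianOn (hγ : IsRiemannianFamily γ O) (p : P) :
    IsPseudoRiemannianOn (γ p) {u | (p, u) ∈ O} where
  isOpen := isOpen_fiber hγ.isOpen p
  smooth i j := contDiffOn_snd_of_contDiffOn (hγ.smooth i j) p
  symm u hu := hγ.symm (p, u) hu
  det_ne_zero _ hu := hγ.det_ne_zero hu

theorem contDiffOn_gaussCoeff (hγ : IsRiemannianFamily γ O)
    (hK : ContDiffOn ℝ ∞ (fun q : P × 𝔼 n => K q.1) O) (i : Fin n) (p o : Option (Fin n)) :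
    ContDiffOn ℝ ∞ (fun q : P × 𝔼 n => gaussCoeff (γ q.1) (K q.1) i p o q.2) O := by
  rcases p with _ | k <;> rcases o with _ | j
  · exact contDiffOn_const
  · exact hK.neg.mul (hγ.smooth i j)
  · exact contDiffOn_const
  · exact contDiffOn_christoffel hγ.isOpen hγ.smooth (fun _ => hγ.det_ne_zero) k i j

theorem contDiffOn_gaussFormCoeff (hγ : IsRiemannianFamily γ O)
    (hK : ContDiffOn ℝ ∞ (fun q : P × 𝔼 n => K q.1) O) (a b : Option (Fin n)) :
    ContDiffOn ℝ ∞ (fun q : P × 𝔼 n => gaussFormCoeff (γ q.1) (K q.1) a b q.2) O := by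
  rcases a with _ | i <;> rcases b with _ | j
  · exact contDiffOn_const
  · exact contDiffOn_const
  · exact contDiffOn_const
  · exact hK.mul (hγ.smooth i j)

theorem contDiffOn_gaussForm (hγ : IsRiemannianFamily γ O)
    (hK : ContDiffOn ℝ ∞ (fun q : P × 𝔼 n => K q.1) O) :
    ContDiffOn ℝ ∞ (fun q : P × 𝔼 n => gaussForm (γ q.1) (K q.1) q.2) O :=
  contDiffOn_sum_smul_const (fun a : Option (Fin n) × Option (Fin n) => coordForm a.1 a.2)
    (f := fun a (q : P × 𝔼 n) => gaussFormCoeff (γ q.1) (K q.1) a.1 a.2 q.2)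
    fun a => hγ.contDiffOn_gaussFormCoeff hK a.1 a.2

end IsRiemannianFamily

section Fixed

variable {γ : 𝔼 n → Matrix (Fin n) (Fin n) ℝ} {κ : ℝ} {V : Set (𝔼 n)} {u : 𝔼 n}
  {Z : 𝔼 n → 𝔾 n →L[ℝ] 𝔾 n}
  {s : E →L[ℝ] E →L[ℝ] ℝ} {L : 𝔾 n →L[ℝ] E}

theorem matrixConnection_gaussCoeff_none (u v : 𝔼 n) (a : Option (Fin n)) :
    matrixConnection (gaussCoeff γ κ) u v (EuclideanSpace.single none 1) a = a.elim 0 v := by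
  rw [matrixConnection_apply]
  rcases a with _ | k <;> simp [gaussCoeff]

theorem fderiv_comp_parallel_none (hZ : IsParallelAt (matrixConnection (gaussCoeff γ κ)) Z u)
    (v : 𝔼 n) : fderiv ℝ (fun u => L (Z u (EuclideanSpace.single none 1))) u v =
      L (Z u (matrixConnection (gaussCoeff γ κ) u v (EuclideanSpace.single none 1))) :=
  congrArg (fun T : 𝔼 n →L[ℝ] E => T v)
    (L.hasFDerivAt.comp u (hZ.apply (EuclideanSpace.single none 1))).fderiv

theorem apply_fderiv_comp_parallel_none
    (hZ : IsParallelAt (matrixConnection (gaussCoeff γ κ)) Z u)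
    (hL : ∀ x y, s (L (Z u x)) (L (Z u y)) = gaussForm γ κ u x y) (v w : 𝔼 n) :
    s (fderiv ℝ (fun u => L (Z u (EuclideanSpace.single none 1))) u v)
      (fderiv ℝ (fun u => L (Z u (EuclideanSpace.single none 1))) u w) =
        κ * ∑ i, ∑ j, v i * w j * γ u i j := by
  rw [fderiv_comp_parallel_none hZ, fderiv_comp_parallel_none hZ, hL, gaussForm_apply]
  simp only [matrixConnection_gaussCoeff_none, Option.elim, zero_mul, zero_add]

theorem inducedMetric_comp_parallel_none
    (hZ : IsParallelAt (matrixConnection (gaussCoeff γ κ)) Z u)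
    (hL : ∀ x y, s (L (Z u x)) (L (Z u y)) = gaussForm γ κ u x y) :
    inducedMetric s (fun u => L (Z u (EuclideanSpace.single none 1))) u = κ • γ u := by
  ext i j
  simp [inducedMetric, apply_fderiv_comp_parallel_none hZ hL]

theorem isSphereImmersion_comp_parallel_none (hV : IsOpen V) (hκ : 0 < κ)
    (hpos : ∀ u ∈ V, ∀ v : 𝔼 n, v ≠ 0 → 0 < ∑ i, ∑ j, v i * v j * γ u i j)
    (hsmooth : ContDiffOn ℝ ∞ Z V)
    (hZ : ∀ u ∈ V, IsParallelAt (matrixConnection (gaussCoeff γ κ)) Z u)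
    (hL : ∀ u ∈ V, ∀ x y, s (L (Z u x)) (L (Z u y)) = gaussForm γ κ u x y) :
    IsSphereImmersion s 1 V fun u => L (Z u (EuclideanSpace.single none 1)) where
  isOpen := hV
  smooth := contDiffOn_const.clm_apply (hsmooth.clm_apply contDiffOn_const)
  mem_sphere u hu := by
    rw [hL u hu, gaussForm_apply]
    simp
  immersion u hu := (injective_iff_map_eq_zero _).2 fun v hv => by
    by_contra hne
    have hnorm := apply_fderiv_comp_parallel_none (hZ u hu) (hL u hu) v v
    rw [hv, map_zero] at hnorm
    exact (mul_pos hκ (hpos u hu v hne)).ne hnorm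

end Fixed

variable {γ : P → 𝔼 n → Matrix (Fin n) (Fin n) ℝ} {K : P → ℝ} {O : Set (P × 𝔼 n)} {B : Set P}
  {s : P → E →L[ℝ] E →L[ℝ] ℝ} {p₀ : P}

namespace IsRiemannianFamily

theorem exists_parallel_frame [FiniteDimensional ℝ P] (hγ : IsRiemannianFamily γ O)
    (hK : ContDiffOn ℝ ∞ (fun q : P × 𝔼 n => K q.1) O)
    (hcurv : ∀ p, HasConstantCurvatureOn (γ p) {u | (p, u) ∈ O} (K p)) (hp₀ : (p₀, 0) ∈ O) :
    ∃ (Z : P × 𝔼 n → 𝔾 n →L[ℝ] 𝔾 n) (r : ℝ), 0 < r ∧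
      Metric.ball p₀ r ×ˢ Metric.ball 0 r ⊆ O ∧
      ContDiffOn ℝ ∞ Z (Metric.ball p₀ r ×ˢ Metric.ball 0 r) ∧
      ∀ p ∈ Metric.ball p₀ r, ∀ u ∈ Metric.ball 0 r,
        IsParallelAt (matrixConnection (gaussCoeff (γ p) (K p))) (fun u => Z (p, u)) u ∧
          ∀ x y, gaussForm (γ p) (K p) 0 (Z (p, u) x) (Z (p, u) y) =
            gaussForm (γ p) (K p) u x y := by
  have hsmooth : ContDiffOn ℝ ∞
      (fun q : P × 𝔼 n => matrixConnection (gaussCoeff (γ q.1) (K q.1)) q.2) O :=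
    contDiffOn_matrixConnection (m := fun p => gaussCoeff (γ p) (K p))
      (hγ.contDiffOn_gaussCoeff hK)
  have hflat (q : P × 𝔼 n) (hq : q ∈ O) :
      connectionCurvature (fun u => matrixConnection (gaussCoeff (γ q.1) (K q.1)) u) q.2 = 0 :=
    ((hγ.isPseudoRiemannianOn q.1).gaussConnection_flat_iff hq).2 fun u hu =>
      hcurv q.1 u (mem_singleton_iff.1 hu ▸ hq)
  obtain ⟨Z, r, hr, hrO, hZ, hZ0, hZparallel⟩ := exists_isParallelAt hγ.isOpen hsmooth hp₀ hflat
  have hparallel (p : P) (hp : p ∈ Metric.ball p₀ r) (u : 𝔼 n) (hu : u ∈ Metric.ball 0 r) :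
      IsParallelAt (matrixConnection (gaussCoeff (γ p) (K p))) (fun u => Z (p, u)) u :=
    (hZparallel p hp u hu).2
  have hmetric (p : P) (hp : p ∈ Metric.ball p₀ r) :
      IsPseudoRiemannianOn (γ p) (Metric.ball 0 r) :=
    (hγ.isPseudoRiemannianOn p).mono Metric.isOpen_ball fun w hw => hrO (mk_mem_prod hp hw)
  exact ⟨Z, r, hr, hrO, hZ, fun p hp u hu => ⟨hparallel p hp u hu,
    gaussForm_zero_apply_of_parallel (Z := fun u => Z (p, u)) (hmetric p hp) (convex_ball 0 r)
      (Metric.mem_ball_self hr) (hZ0 p hp) (fun w hw => (hZparallel p hp w hw).1)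
      (hparallel p hp) hu⟩⟩

theorem exists_sphereImmersion [FiniteDimensional ℝ P] [FiniteDimensional ℝ E]
    (hγ : IsRiemannianFamily γ O) (hE : Module.finrank ℝ E = n + 1) (hOB : MapsTo Prod.fst O B)
    (hK : ContDiffOn ℝ ∞ K B) (hKpos : ∀ p ∈ B, 0 < K p)
    (hcurv : ∀ p, HasConstantCurvatureOn (γ p) {u | (p, u) ∈ O} (K p))
    (hs : ContDiffOn ℝ ∞ s B) (hinner : ∀ p ∈ B, IsInnerProduct (s p)) (hp₀ : (p₀, 0) ∈ O) :
    ∃ (ψ : P × 𝔼 n → E) (r : ℝ), 0 < r ∧ Metric.ball p₀ r ×ˢ Metric.ball 0 r ⊆ O ∧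
      ContDiffOn ℝ ∞ ψ (Metric.ball p₀ r ×ˢ Metric.ball 0 r) ∧ ∀ p ∈ Metric.ball p₀ r,
        IsSphereImmersion (s p) 1 (Metric.ball 0 r) (fun u => ψ (p, u)) ∧
          EqOn (inducedMetric (s p) fun u => ψ (p, u)) (K p • γ p) (Metric.ball 0 r) := by
  have hKO : ContDiffOn ℝ ∞ (fun q : P × 𝔼 n => K q.1) O := hK.comp contDiff_fst.contDiffOn hOB
  obtain ⟨Z, r₁, hr₁, hr₁O, hZ, hZparallel⟩ := hγ.exists_parallel_frame hKO hcurv hp₀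
  obtain ⟨T, B', hB', hp₀', -, hT, hTs⟩ := exists_smooth_isometry (s := s)
    (t := fun p => gaussForm (γ p) (K p) 0) (B := {p | (p, (0 : 𝔼 n)) ∈ O}) (by simp [hE])
    (hγ.isOpen.preimage (by fun_prop))
    ((hγ.contDiffOn_gaussForm hKO).comp (contDiff_prodMk_left (0 : 𝔼 n)).contDiffOn fun p hp => hp)
    (fun p hp => isInnerProduct_gaussForm (hKpos p (hOB hp)) (hγ.symm _ hp) (hγ.pos _ hp))
    (hs.mono fun p hp => hOB hp) (fun p hp => hinner p (hOB hp)) hp₀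
  obtain ⟨r₂, hr₂, hr₂B'⟩ := Metric.isOpen_iff.1 hB' p₀ hp₀'
  have hr : 0 < min r₁ r₂ := lt_min hr₁ hr₂
  set r := min r₁ r₂
  have hsub : Metric.ball p₀ r ×ˢ Metric.ball (0 : 𝔼 n) r ⊆
      Metric.ball p₀ r₁ ×ˢ Metric.ball 0 r₁ :=
    prod_mono (Metric.ball_subset_ball (min_le_left _ _))
      (Metric.ball_subset_ball (min_le_left _ _))
  have hsubB' : Metric.ball p₀ r ⊆ B' := (Metric.ball_subset_ball (min_le_right _ _)).trans hr₂B'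
  have hsubO : Metric.ball p₀ r ×ˢ Metric.ball (0 : 𝔼 n) r ⊆ O := hsub.trans hr₁O
  have hparallel (p : P) (hp : p ∈ Metric.ball p₀ r) (u : 𝔼 n) (hu : u ∈ Metric.ball 0 r) :=
    hZparallel p (hsub (mk_mem_prod hp hu)).1 u (hsub (mk_mem_prod hp hu)).2
  have hiso (p : P) (hp : p ∈ Metric.ball p₀ r) (u : 𝔼 n) (hu : u ∈ Metric.ball 0 r)
      (x y : 𝔾 n) : s p (T p (Z (p, u) x)) (T p (Z (p, u) y)) = gaussForm (γ p) (K p) u x y :=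
    (hTs p (hsubB' hp) _ _).trans ((hparallel p hp u hu).2 x y)
  have hTr : ContDiffOn ℝ ∞ (fun q : P × 𝔼 n => T q.1) (Metric.ball p₀ r ×ˢ Metric.ball 0 r) :=
    hT.comp contDiff_fst.contDiffOn fun q hq => hsubB' hq.1
  have hZr : ContDiffOn ℝ ∞ Z (Metric.ball p₀ r ×ˢ Metric.ball 0 r) := hZ.mono hsub
  refine ⟨fun q => T q.1 (Z q (EuclideanSpace.single none 1)), r, hr, hsubO,
    hTr.clm_apply (hZr.clm_apply contDiffOn_const), fun p hp => ⟨?_, fun u hu => ?_⟩⟩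
  · have hp0 : (p, (0 : 𝔼 n)) ∈ O := hsubO (mk_mem_prod hp (Metric.mem_ball_self hr))
    exact isSphereImmersion_comp_parallel_none Metric.isOpen_ball (hKpos p (hOB hp0))
      (fun u hu => hγ.pos (p, u) (hsubO (mk_mem_prod hp hu)))
      ((contDiffOn_snd_of_contDiffOn hZr p).mono fun u hu => mk_mem_prod hp hu)
      (fun u hu => (hparallel p hp u hu).1) (hiso p hp)
  · exact inducedMetric_comp_parallel_none (hparallel p hp u hu).1 (hiso p hp u hu)

/-- Shrinking the balls makes the immersions injective. -/
theorem exists_sphereEmbedding [FiniteDimensional ℝ P] [FiniteDimensional ℝ E]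
    (hγ : IsRiemannianFamily γ O) (hE : Module.finrank ℝ E = n + 1) (hOB : MapsTo Prod.fst O B)
    (hK : ContDiffOn ℝ ∞ K B) (hKpos : ∀ p ∈ B, 0 < K p)
    (hcurv : ∀ p, HasConstantCurvatureOn (γ p) {u | (p, u) ∈ O} (K p))
    (hs : ContDiffOn ℝ ∞ s B) (hinner : ∀ p ∈ B, IsInnerProduct (s p)) (hp₀ : (p₀, 0) ∈ O) :
    ∃ (ψ : P × 𝔼 n → E) (r : ℝ), 0 < r ∧ Metric.ball p₀ r ×ˢ Metric.ball 0 r ⊆ O ∧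
      ContDiffOn ℝ ∞ ψ (Metric.ball p₀ r ×ˢ Metric.ball 0 r) ∧ ∀ p ∈ Metric.ball p₀ r,
        IsSphereImmersion (s p) 1 (Metric.ball 0 r) (fun u => ψ (p, u)) ∧
          InjOn (fun u => ψ (p, u)) (Metric.ball 0 r) ∧
          EqOn (inducedMetric (s p) fun u => ψ (p, u)) (K p • γ p) (Metric.ball 0 r) := by
  obtain ⟨ψ, r₁, hr₁, hr₁O, hψ, hψp⟩ :=
    hγ.exists_sphereImmersion hE hOB hK hKpos hcurv hs hinner hp₀
  obtain ⟨r₂, hr₂, hinj⟩ := exists_ball_injOn (Metric.isOpen_ball.prod Metric.isOpen_ball) hψ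
    (mk_mem_prod (Metric.mem_ball_self hr₁) (Metric.mem_ball_self hr₁))
    ((hψp p₀ (Metric.mem_ball_self hr₁)).1.immersion 0 (Metric.mem_ball_self hr₁))
  have hsub₁ : Metric.ball (0 : 𝔼 n) (min r₁ r₂) ⊆ Metric.ball 0 r₁ :=
    Metric.ball_subset_ball (min_le_left _ _)
  have hprod : Metric.ball p₀ (min r₁ r₂) ×ˢ Metric.ball (0 : 𝔼 n) (min r₁ r₂) ⊆
      Metric.ball p₀ r₁ ×ˢ Metric.ball 0 r₁ :=
    prod_mono (Metric.ball_subset_ball (min_le_left _ _)) hsub₁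
  refine ⟨ψ, min r₁ r₂, lt_min hr₁ hr₂, hprod.trans hr₁O, hψ.mono hprod, fun p hp => ?_⟩
  obtain ⟨himmersion, hmetric⟩ := hψp p (Metric.ball_subset_ball (min_le_left _ _) hp)
  exact ⟨himmersion.mono Metric.isOpen_ball hsub₁,
    (hinj p (Metric.ball_subset_ball (min_le_right _ _) hp)).mono
      (Metric.ball_subset_ball (min_le_right _ _)), hmetric.mono hsub₁⟩

end IsRiemannianFamily

end SphereMap

/-! ### Homogeneous extension -/

section HomogeneousExtension

variable {N n : ℕ} {E : Type*} [NormedAddCommGroup E] [NormedSpace ℝ E] {D : Set (𝔼 N)}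
  {h : 𝔼 N → ℝ} {e : (ℝ × 𝔼 n) ≃L[ℝ] 𝔼 N}

/-- The cone over the part of the hyperplane `e (1, u)` given by `u ∈ Ω`. -/
def radialCone (e : (ℝ × 𝔼 n) ≃L[ℝ] 𝔼 N) (Ω : Set (𝔼 n)) : Set (𝔼 N) :=
  {y | 0 < (e.symm y).1 ∧ radialChart e y ∈ Ω}

theorem isOpen_radialCone {Ω : Set (𝔼 n)} (hΩ : IsOpen Ω) : IsOpen (radialCone e Ω) := by
  have hpos : IsOpen {y : 𝔼 N | 0 < (e.symm y).1} := isOpen_lt (by fun_prop) (by fun_prop)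
  exact ((contDiffOn_radialChart e).continuousOn.mono fun _ hy => ne_of_gt hy).isOpen_inter_preimage
    hpos hΩ

theorem smul_mem_radialCone {Ω : Set (𝔼 n)} {y : 𝔼 N} (hy : y ∈ radialCone e Ω) {k : ℝ}
    (hk : 0 < k) : k • y ∈ radialCone e Ω := by
  refine ⟨by simpa using mul_pos hk hy.1, ?_⟩
  rw [radialChart_smul e hk.ne']
  exact hy.2

/-- The positively homogeneous extension, of degree `H`, of a map `ψ` of the hypersurface `h = 1`
written in the coordinates given by `radialParam`. -/
def homogeneousExtension (h : 𝔼 N → ℝ) (e : (ℝ × 𝔼 n) ≃L[ℝ] 𝔼 N) (H : ℝ) (ψ : 𝔼 n → E)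
    (y : 𝔼 N) : E :=
  h y ^ H • ψ (radialChart e y)

namespace IsConicNorm

theorem radialCone_subset (hh : IsConicNorm D h) {Ω : Set (𝔼 n)}
    (hΩ : MapsTo (fun u => e (1, u)) Ω D) : radialCone e Ω ⊆ D := by
  intro y hy
  have hmem : (e.symm y).1 • e (1, radialChart e y) ∈ D := hh.conic _ (hΩ hy.2) _ hy.1
  rwa [apply_one_radialChart e hy.1.ne', smul_smul, mul_inv_cancel₀ hy.1.ne', one_smul] at hmem

theorem fderiv_homogeneousExtension (hh : IsConicNorm D h) {y : 𝔼 N} (hy : y ∈ D)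
    (hpos : 0 < (e.symm y).1) {ψ : 𝔼 n → E} (hψ : DifferentiableAt ℝ ψ (radialChart e y)) (H : ℝ)
    (ξ : 𝔼 N) :
    fderiv ℝ (homogeneousExtension h e H ψ) y ξ =
      (H * h y ^ (H - 1) * fderiv ℝ h y ξ) • ψ (radialChart e y) +
        h y ^ H • fderiv ℝ ψ (radialChart e y) (fderiv ℝ (radialChart e) y ξ) := by
  have hext : HasFDerivAt (homogeneousExtension h e H ψ) _ y :=
    ((hh.differentiableAt hy).hasFDerivAt.rpow_const (p := H)
      (Or.inl (hh.pos y hy).ne')).fun_smul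
      (hψ.hasFDerivAt.comp y (differentiableAt_radialChart e hpos.ne').hasFDerivAt)
  rw [hext.fderiv, add_comm]
  rfl

theorem homogeneousExtension_radialParam (hh : IsConicNorm D h) {y : 𝔼 N} (hy : y ∈ D)
    (hpos : 0 < (e.symm y).1) : homogeneousExtension h e 1 (radialParam h e) y = y := by
  rw [homogeneousExtension, hh.radialParam_radialChart hy hpos, Real.rpow_one,
    smul_inv_smul₀ (hh.pos y hy).ne']

theorem eq_fderiv_smul_radialParam_add (hh : IsConicNorm D h) {y : 𝔼 N} (hy : y ∈ D)
    (hpos : 0 < (e.symm y).1) (ξ : 𝔼 N) :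
    ξ = fderiv ℝ h y ξ • radialParam h e (radialChart e y) +
      h y • fderiv ℝ (radialParam h e) (radialChart e y) (fderiv ℝ (radialChart e) y ξ) := by
  have hid : homogeneousExtension h e 1 (radialParam h e) =ᶠ[𝓝 y] id := by
    have hposo : IsOpen {y : 𝔼 N | 0 < (e.symm y).1} := isOpen_lt (by fun_prop) (by fun_prop)
    filter_upwards [hh.isOpen.mem_nhds hy, hposo.mem_nhds hpos] with z hz hzpos
      using hh.homogeneousExtension_radialParam hz hzpos
  have hφ := (hh.isUnitParam_radialParam e).hasFDerivAt (hh.apply_one_radialChart_mem hy hpos)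
  calc ξ = fderiv ℝ (homogeneousExtension h e 1 (radialParam h e)) y ξ := by
        rw [hid.fderiv_eq, fderiv_id, ContinuousLinearMap.id_apply]
    _ = _ := by
        rw [hh.fderiv_homogeneousExtension hy hpos hφ.differentiableAt]
        simp only [sub_self, Real.rpow_zero, mul_one, one_mul, Real.rpow_one]

theorem hessForm_eq_radial (hh : IsConicNorm D h) {y : 𝔼 N} (hy : y ∈ D)
    (hpos : 0 < (e.symm y).1) (ξ η : 𝔼 N) :
    hessForm h y ξ η = fderiv ℝ h y ξ * fderiv ℝ h y η + h y ^ 2 * ∑ i, ∑ j,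
      fderiv ℝ (radialChart e) y ξ i * fderiv ℝ (radialChart e) y η j *
        fiberMetric h (radialParam h e) (radialChart e y) i j := by
  have hφ := hh.isUnitParam_radialParam e
  have hu := hh.apply_one_radialChart_mem hy hpos
  have hmem := hφ.mem _ hu
  have htangent (v : 𝔼 n) : hessForm h (radialParam h e (radialChart e y))
      (radialParam h e (radialChart e y)) (fderiv ℝ (radialParam h e) (radialChart e y) v) = 0 := by
    rw [hh.hessForm_self hmem, hφ.fderiv_norm_comp hh hu, mul_zero]
  have htangent' (v : 𝔼 n) : hessForm h (radialParam h e (radialChart e y))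
      (fderiv ℝ (radialParam h e) (radialChart e y) v) (radialParam h e (radialChart e y)) = 0 := by
    rw [(hh.isInnerProduct_hessForm hmem).symm, htangent]
  have hform : hessForm h y = hessForm h (radialParam h e (radialChart e y)) := by
    rw [hh.radialParam_radialChart hy hpos, hh.hessForm_smul hy (inv_pos.2 (hh.pos y hy))]
  rw [hform, hφ.sum_fiberMetric hh hu]
  conv_lhs => rw [hh.eq_fderiv_smul_radialParam_add hy hpos ξ,
    hh.eq_fderiv_smul_radialParam_add hy hpos η]
  simp only [map_add, map_smul, FunLike.coe_add, Pi.add_apply, FunLike.coe_smul, Pi.smul_apply,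
    hh.hessForm_self_self hmem, hφ.unit _ hu, htangent, htangent', smul_eq_mul]
  ring

variable {s : E →L[ℝ] E →L[ℝ] ℝ} {H : ℝ} {Ω : Set (𝔼 n)} {ψ : 𝔼 n → E}

theorem inner_fderiv_homogeneousExtension (hh : IsConicNorm D h) (hs : IsInnerProduct s)
    (hψ : IsSphereImmersion s 1 Ω ψ) {y : 𝔼 N} (hyD : y ∈ D) (hy : y ∈ radialCone e Ω)
    (ξ η : 𝔼 N) :
    s (fderiv ℝ (homogeneousExtension h e H ψ) y ξ) (fderiv ℝ (homogeneousExtension h e H ψ) y η) =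
      (H * h y ^ (H - 1)) ^ 2 * (fderiv ℝ h y ξ * fderiv ℝ h y η) + (h y ^ H) ^ 2 * ∑ i, ∑ j,
        fderiv ℝ (radialChart e) y ξ i * fderiv ℝ (radialChart e) y η j *
          inducedMetric s ψ (radialChart e y) i j := by
  have hunit : s (ψ (radialChart e y)) (ψ (radialChart e y)) = 1 := by
    simpa using hψ.mem_sphere _ hy.2
  have htangent (v : 𝔼 n) : s (ψ (radialChart e y)) (fderiv ℝ ψ (radialChart e y) v) = 0 := by
    rw [hs.symm, hψ.apply_fderiv_self hs hy.2]
  have hsum (v w : 𝔼 n) : ∑ i, ∑ j, v i * w j * inducedMetric s ψ (radialChart e y) i j =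
      s (fderiv ℝ ψ (radialChart e y) v) (fderiv ℝ ψ (radialChart e y) w) :=
    sum_sum_apply_single _ s v w
  have hψd := (hψ.hasFDerivAt hy.2).differentiableAt
  rw [hh.fderiv_homogeneousExtension hyD hy.1 hψd, hh.fderiv_homogeneousExtension hyD hy.1 hψd,
    hsum]
  simp only [map_add, map_smul, FunLike.coe_add, Pi.add_apply, FunLike.coe_smul, Pi.smul_apply,
    hunit, htangent, hψ.apply_fderiv_self hs hy.2, smul_eq_mul]
  ring

theorem halfHessianSq_eq_inner_fderiv (hh : IsConicNorm D h) (hs : IsInnerProduct s)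
    (hH : H ≠ 0) (hψ : IsSphereImmersion s 1 Ω ψ)
    (hmetric : EqOn (inducedMetric s ψ) (H ^ 2 • fiberMetric h (radialParam h e)) Ω) {y : 𝔼 N}
    (hyD : y ∈ D) (hy : y ∈ radialCone e Ω) (ξ η : 𝔼 N) :
    halfHessianSq h y ξ η = (1 / H * h y ^ (1 - H)) ^ 2 *
      s (fderiv ℝ (homogeneousExtension h e H ψ) y ξ)
        (fderiv ℝ (homogeneousExtension h e H ψ) y η) := by
  have hpos := hh.pos y hyD
  have hrpow₁ : h y ^ (1 - H) * h y ^ (H - 1) = 1 := by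
    rw [← Real.rpow_add hpos, sub_add_sub_cancel, sub_self, Real.rpow_zero]
  have hrpow₂ : h y ^ (1 - H) * h y ^ H = h y := by
    rw [← Real.rpow_add hpos, sub_add_cancel, Real.rpow_one]
  have hcoeff (a b : ℝ) (i j : Fin n) : a * b * inducedMetric s ψ (radialChart e y) i j =
      H ^ 2 * (a * b * fiberMetric h (radialParam h e) (radialChart e y) i j) := by
    rw [hmetric hy.2, Pi.smul_apply, Matrix.smul_apply, smul_eq_mul]
    ring
  rw [hh.halfHessianSq_eq hyD, hh.hessForm_eq_radial hyD hy.1,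
    hh.inner_fderiv_homogeneousExtension hs hψ hyD hy]
  simp only [hcoeff, ← Finset.mul_sum]
  set S := ∑ i, ∑ j, fderiv ℝ (radialChart e) y ξ i * fderiv ℝ (radialChart e) y η j *
    fiberMetric h (radialParam h e) (radialChart e y) i j
  set d := fderiv ℝ h y ξ * fderiv ℝ h y η
  have hinv : 1 / H * H = 1 := one_div_mul_cancel hH
  calc d + h y ^ 2 * S
      = (1 / H * H) ^ 2 * ((h y ^ (1 - H) * h y ^ (H - 1)) ^ 2 * d +
          (h y ^ (1 - H) * h y ^ H) ^ 2 * S) := by rw [hrpow₁, hrpow₂, hinv]; ring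
    _ = _ := by ring

theorem contDiffOn_homogeneousExtension (hh : IsConicNorm D h) (hψ : ContDiffOn ℝ ∞ ψ Ω)
    (hΩ : MapsTo (fun u => e (1, u)) Ω D) :
    ContDiffOn ℝ ∞ (homogeneousExtension h e H ψ) (radialCone e Ω) :=
  ((hh.smooth.mono (hh.radialCone_subset hΩ)).rpow_const_of_ne fun y hy =>
    (hh.pos y (hh.radialCone_subset hΩ hy)).ne').smul
    (hψ.comp ((contDiffOn_radialChart e).mono fun _ hy => hy.1.ne') fun _ hy => hy.2)

theorem isConformalMapOn_homogeneousExtension (hh : IsConicNorm D h) (hs : IsInnerProduct s)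
    (hH : H ≠ 0) (hψ : IsSphereImmersion s 1 Ω ψ) (hΩ : MapsTo (fun u => e (1, u)) Ω D)
    (hmetric : EqOn (inducedMetric s ψ) (H ^ 2 • fiberMetric h (radialParam h e)) Ω) :
    IsConformalMapOn D h s H (radialCone e Ω) (homogeneousExtension h e H ψ)
      fun y => (1 / H * h y ^ (1 - H)) ^ 2 where
  isOpen := isOpen_radialCone hψ.isOpen
  subset := hh.radialCone_subset hΩ
  conic _ hy _ hk := smul_mem_radialCone hy hk
  smooth := hh.contDiffOn_homogeneousExtension hψ.smooth hΩ
  homogeneous y hy k hk := by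
    have hyD := hh.radialCone_subset hΩ hy
    rw [homogeneousExtension, hh.homogeneous y hyD k hk, radialChart_smul e hk.ne',
      Real.mul_rpow hk.le (hh.pos y hyD).le, mul_smul, homogeneousExtension]
  unit y hy hunit := by
    simpa [homogeneousExtension, hunit] using hψ.mem_sphere _ hy.2
  conformal y hy :=
    hh.halfHessianSq_eq_inner_fderiv hs hH hψ hmetric (hh.radialCone_subset hΩ hy) hy

end IsConicNorm

theorem IsConformalMapOn.injOn_homogeneousExtension {s : E →L[ℝ] E →L[ℝ] ℝ} {H : ℝ}
    {Ω : Set (𝔼 n)} {ψ : 𝔼 n → E} {q : 𝔼 N → ℝ}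
    (hc : IsConformalMapOn D h s H (radialCone e Ω) (homogeneousExtension h e H ψ) q)
    (hh : IsConicNorm D h) (hH : H ≠ 0) (hψ : InjOn ψ Ω) :
    InjOn (homogeneousExtension h e H ψ) (radialCone e Ω) := by
  intro y hy z hz hyz
  have hypos := hh.pos y (hc.subset hy)
  have hzpos := hh.pos z (hc.subset hz)
  have hsq : (h y ^ H) ^ 2 = (h z ^ H) ^ 2 := by
    rw [← hc.apply_self hh hy, ← hc.apply_self hh hz, hyz]
  have hpow : h y ^ H = h z ^ H :=
    (sq_eq_sq₀ (Real.rpow_pos_of_pos hypos H).le (Real.rpow_pos_of_pos hzpos H).le).1 hsq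
  have hnorm : h y = h z := (Real.rpow_left_inj hypos.le hzpos.le hH).1 hpow
  have hchart : radialChart e y = radialChart e z := by
    refine hψ hy.2 hz.2 (smul_right_injective E (Real.rpow_pos_of_pos hzpos H).ne' ?_)
    simpa only [homogeneousExtension, hpow] using hyz
  rw [← hh.homogeneousExtension_radialParam (hc.subset hy) hy.1,
    ← hh.homogeneousExtension_radialParam (hc.subset hz) hz.1]
  simp only [homogeneousExtension, hnorm, hchart]

end HomogeneousExtension

/-! ### Families of conic norms -/

section ConicNormFamily

variable {N n : ℕ} {P : Type*} [NormedAddCommGroup P] [NormedSpace ℝ P]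

/-- A family of conic norms which is smooth jointly in the parameter and the vector. -/
structure IsConicNormFamily (D : Set (P × 𝔼 N)) (f : P × 𝔼 N → ℝ) : Prop where
  isOpen : IsOpen D
  smooth : ContDiffOn ℝ ∞ f D
  isConicNorm : ∀ p, IsConicNorm {y | (p, y) ∈ D} fun y => f (p, y)

/-- The points at which `radialParam` is defined, over the parameters `p` for which the centre
`e (1, 0)` of the radial coordinates is admissible. -/
def radialDomain (D : Set (P × 𝔼 N)) (e : (ℝ × 𝔼 n) ≃L[ℝ] 𝔼 N) : Set (P × 𝔼 n) :=
  {q | (q.1, e (1, q.2)) ∈ D ∧ (q.1, e (1, 0)) ∈ D}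

namespace IsConicNormFamily

variable {D : Set (P × 𝔼 N)} {f : P × 𝔼 N → ℝ}

theorem contDiffOn_fderiv_fderiv_sq (hf : IsConicNormFamily D f) : ContDiffOn ℝ ∞
    (fun q : P × 𝔼 N => fderiv ℝ (fderiv ℝ fun y => f (q.1, y) ^ 2) q.2) D := by
  have hgrad : ContDiffOn ℝ ∞ (fun q : P × 𝔼 N => fderiv ℝ (fun y => f (q.1, y) ^ 2) q.2) D :=
    contDiffOn_fderiv_snd hf.isOpen (F := fun q => f q ^ 2) (hf.smooth.pow 2)
  exact contDiffOn_fderiv_snd hf.isOpen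
    (F := fun q : P × 𝔼 N => fderiv ℝ (fun y => f (q.1, y) ^ 2) q.2) hgrad

theorem contDiffOn_fiberMetric (hf : IsConicNormFamily D f) {O : Set (P × 𝔼 n)} (hO : IsOpen O)
    {φ : P → 𝔼 n → 𝔼 N} (hφ : ContDiffOn ℝ ∞ (fun q : P × 𝔼 n => φ q.1 q.2) O)
    (hφD : ∀ q ∈ O, (q.1, φ q.1 q.2) ∈ D) (i j : Fin n) :
    ContDiffOn ℝ ∞ (fun q : P × 𝔼 n => fiberMetric (fun y => f (q.1, y)) (φ q.1) q.2 i j) O := by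
  have hhess : ContDiffOn ℝ ∞
      (fun q : P × 𝔼 n => fderiv ℝ (fderiv ℝ fun y => f (q.1, y) ^ 2) (φ q.1 q.2)) O :=
    hf.contDiffOn_fderiv_fderiv_sq.comp (f := fun q : P × 𝔼 n => (q.1, φ q.1 q.2))
      (contDiff_fst.contDiffOn.prodMk hφ) hφD
  have hdφ : ContDiffOn ℝ ∞ (fun q : P × 𝔼 n => fderiv ℝ (φ q.1) q.2) O :=
    contDiffOn_fderiv_snd hO (F := fun q : P × 𝔼 n => φ q.1 q.2) hφ
  have happly (k : Fin n) : ContDiffOn ℝ ∞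
      (fun q : P × 𝔼 n => fderiv ℝ (φ q.1) q.2 (EuclideanSpace.single k 1)) O :=
    hdφ.clm_apply contDiffOn_const
  exact (((hhess.clm_apply (happly j)).clm_apply (happly i)).const_smul (1 / 2 : ℝ)).congr
    fun q hq => (hf.isConicNorm q.1).halfHessianSq_eq (hφD q hq) _ _

variable (e : (ℝ × 𝔼 n) ≃L[ℝ] 𝔼 N)

theorem isRiemannianFamily_radial (hf : IsConicNormFamily D f) :
    IsRiemannianFamily
      (fun p => fiberMetric (fun y => f (p, y)) (radialParam (fun y => f (p, y)) e))
      (radialDomain D e) := by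
  have hφ (p : P) := (hf.isConicNorm p).isUnitParam_radialParam e
  have haffine : ContDiff ℝ ∞ fun q : P × 𝔼 n => (q.1, e (1, q.2)) := by fun_prop
  have hO : IsOpen (radialDomain D e) := (hf.isOpen.preimage haffine.continuous).inter
    (hf.isOpen.preimage (f := fun q : P × 𝔼 n => (q.1, e (1, 0))) (by fun_prop))
  have hφs : ContDiffOn ℝ ∞ (fun q : P × 𝔼 n => radialParam (fun y => f (q.1, y)) e q.2)
      (radialDomain D e) :=
    ((hf.smooth.comp haffine.contDiffOn fun q hq => hq.1).inv fun q hq =>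
      ((hf.isConicNorm q.1).pos _ hq.1).ne').smul haffine.snd.contDiffOn
  refine ⟨hO, hf.contDiffOn_fiberMetric
    (φ := fun p => radialParam (fun y => f (p, y)) e) hO hφs fun q hq => (hφ q.1).mem q.2 hq.1,
    fun q hq => (hφ q.1).fiberMetric_isSymm (hf.isConicNorm q.1) hq.1, fun q hq v hv => ?_⟩
  rw [(hφ q.1).sum_fiberMetric (hf.isConicNorm q.1) hq.1]
  exact ((hf.isConicNorm q.1).isInnerProduct_hessForm ((hφ q.1).mem q.2 hq.1)).pos _
    (((hφ q.1).immersion q.2 hq.1).ne_iff' (map_zero _) |>.2 hv)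

variable {K : P → ℝ} {e}

/-- The curvature is a component of the curvature tensor at the centre of the radial coordinates,
divided by a diagonal coefficient of the metric. -/
theorem contDiffOn_curvature (hf : IsConicNormFamily D f) (hn : 2 ≤ n)
    (hK : ∀ p, HasUnitCurvature n {y | (p, y) ∈ D} (fun y => f (p, y)) (K p)) :
    ContDiffOn ℝ ∞ K {p | (p, e (1, 0)) ∈ D} := by
  let i : Fin n := ⟨0, by omega⟩
  let j : Fin n := ⟨1, by omega⟩
  have hij : i ≠ j := by simp [i, j]
  have hγ := hf.isRiemannianFamily_radial e
  have hcenter : MapsTo (fun p => (p, (0 : 𝔼 n))) {p | (p, e (1, 0)) ∈ D} (radialDomain D e) :=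
    fun p hp => ⟨hp, hp⟩
  have hslice := (contDiff_prodMk_left (𝕜 := ℝ) (n := ∞) (E := P) (0 : 𝔼 n)).contDiffOn
    (s := {p | (p, e (1, 0)) ∈ D})
  have hR := (contDiffOn_riemannTensor
    (γ := fun p => fiberMetric (fun y => f (p, y)) (radialParam (fun y => f (p, y)) e))
    hγ.isOpen hγ.smooth (fun q hq => hγ.det_ne_zero hq) i j i j).comp hslice hcenter
  have hφ (p : P) := (hf.isConicNorm p).isUnitParam_radialParam e
  have hne (p : P) (hp : (p, e (1, 0)) ∈ D) :=
    ((hφ p).fiberMetric_diag_pos (hf.isConicNorm p) hp j).ne'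
  refine (hR.div ((hγ.smooth j j).comp hslice hcenter) hne).congr fun p hp => ?_
  exact (eq_div_iff (hne p hp)).2 ((hK p).riemannTensor_eq (hφ p) hp hij).symm

theorem contDiffOn_homogeneousExtension (hf : IsConicNormFamily D f) {E : Type*}
    [NormedAddCommGroup E] [NormedSpace ℝ E] {H : P → ℝ} {ψ : P × 𝔼 n → E} {B : Set P}
    {Ω : Set (𝔼 n)} (hH : ContDiffOn ℝ ∞ H B) (hψ : ContDiffOn ℝ ∞ ψ (B ×ˢ Ω))
    (hD : B ×ˢ radialCone e Ω ⊆ D) :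
    ContDiffOn ℝ ∞ (fun q : P × 𝔼 N =>
      homogeneousExtension (fun y => f (q.1, y)) e (H q.1) (fun u => ψ (q.1, u)) q.2)
      (B ×ˢ radialCone e Ω) := by
  have hchart : ContDiffOn ℝ ∞ (fun q : P × 𝔼 N => (q.1, radialChart e q.2))
      (B ×ˢ radialCone e Ω) :=
    contDiff_fst.contDiffOn.prodMk (((contDiffOn_radialChart e).mono fun _ hy => hy.1.ne').comp
      contDiff_snd.contDiffOn fun q hq => hq.2)
  exact ((hf.smooth.mono hD).rpow (hH.comp contDiff_fst.contDiffOn fun q hq => hq.1) fun q hq =>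
    ((hf.isConicNorm q.1).pos q.2 (hD hq)).ne').smul (hψ.comp hchart fun q hq => ⟨hq.1, hq.2.2⟩)

theorem exists_isConformalMapOn [FiniteDimensional ℝ P] (hf : IsConicNormFamily D f)
    (hN : N = n + 1) (hn : 2 ≤ n) (hKpos : ∀ q ∈ D, 0 < K q.1)
    (hK : ∀ p, HasUnitCurvature n {y | (p, y) ∈ D} (fun y => f (p, y)) (K p))
    {B : Set P} (hDB : MapsTo Prod.fst D B) {E : Type*} [NormedAddCommGroup E]
    [NormedSpace ℝ E] [FiniteDimensional ℝ E] (hE : Module.finrank ℝ E = N)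
    {s : P → E →L[ℝ] E →L[ℝ] ℝ} (hs : ContDiffOn ℝ ∞ s B)
    (hinner : ∀ p ∈ B, IsInnerProduct (s p)) {q₀ : P × 𝔼 N} (hq₀ : q₀ ∈ D) :
    ∃ (W : Set (P × 𝔼 N)) (c : P × 𝔼 N → E), IsOpen W ∧ q₀ ∈ W ∧ W ⊆ D ∧ ContDiffOn ℝ ∞ c W ∧
      ∀ q ∈ W, InjOn (fun y => c (q.1, y)) {y | (q.1, y) ∈ W} ∧
        IsConformalMapOn {y | (q.1, y) ∈ D} (fun y => f (q.1, y)) (s q.1) √(K q.1)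
          {y | (q.1, y) ∈ W} (fun y => c (q.1, y))
          fun y => (1 / √(K q.1) * f (q.1, y) ^ (1 - √(K q.1))) ^ 2 := by
  obtain ⟨p₀, y₀⟩ := q₀
  obtain ⟨e, rfl⟩ := exists_continuousLinearEquiv_apply_one_zero hN
    ((hf.isConicNorm p₀).ne_zero y₀ hq₀)
  have hγ := hf.isRiemannianFamily_radial e
  have hKs : ContDiffOn ℝ ∞ K {p | (p, e (1, 0)) ∈ D} := hf.contDiffOn_curvature hn hK
  obtain ⟨ψ, r, hr, hrO, hψ, hψp⟩ := hγ.exists_sphereEmbedding (hE.trans hN)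
    (fun q hq => hq.2) hKs (fun p hp => hKpos _ hp)
    (fun p u hu => hK p _ _ ((hf.isConicNorm p).isUnitParam_radialParam e) u hu.1)
    (hs.mono fun p hp => hDB hp) (fun p hp => hinner p (hDB hp)) (p₀ := p₀) ⟨hq₀, hq₀⟩
  have hball (p : P) (hp : p ∈ Metric.ball p₀ r) :
      MapsTo (fun u => e (1, u)) (Metric.ball 0 r) {y | (p, y) ∈ D} :=
    fun u hu => (hrO (mk_mem_prod hp hu)).1
  have hWD : Metric.ball p₀ r ×ˢ radialCone e (Metric.ball 0 r) ⊆ D :=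
    fun q hq => (hf.isConicNorm q.1).radialCone_subset (hball q.1 hq.1) hq.2
  have hcenter (p : P) (hp : p ∈ Metric.ball p₀ r) : (p, e (1, 0)) ∈ D :=
    (hrO (mk_mem_prod hp (Metric.mem_ball_self hr))).2
  refine ⟨Metric.ball p₀ r ×ˢ radialCone e (Metric.ball 0 r),
    fun q => homogeneousExtension (fun y => f (q.1, y)) e √(K q.1) (fun u => ψ (q.1, u)) q.2,
    Metric.isOpen_ball.prod (isOpen_radialCone Metric.isOpen_ball),
    ⟨Metric.mem_ball_self hr, by simp [radialCone, radialChart_apply_one, hr]⟩, hWD,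
    hf.contDiffOn_homogeneousExtension ((hKs.mono hcenter).sqrt fun p hp =>
      (hKpos _ (hcenter p hp)).ne') hψ hWD, ?_⟩
  rintro ⟨p, y⟩ ⟨hp, -⟩
  have hKp : 0 < K p := hKpos _ (hcenter p hp)
  obtain ⟨hψ', hinj, hmetric⟩ := hψp p hp
  have hfiber : {y | (p, y) ∈ Metric.ball p₀ r ×ˢ radialCone e (Metric.ball 0 r)} =
      radialCone e (Metric.ball 0 r) := by
    ext y
    exact and_iff_right hp
  rw [hfiber]
  have hconf := (hf.isConicNorm p).isConformalMapOn_homogeneousExtension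
    (hinner p (hDB (hcenter p hp))) (Real.sqrt_pos.2 hKp).ne' hψ' (hball p hp)
    (by rwa [Real.sq_sqrt hKp.le])
  exact ⟨hconf.injOn_homogeneousExtension (hf.isConicNorm p) (Real.sqrt_pos.2 hKp).ne' hinj, hconf⟩

end IsConicNormFamily

end ConicNormFamily

section LinearChange

variable {N n : ℕ} {D : Set (𝔼 N)} {h : 𝔼 N → ℝ} (A : 𝔼 N ≃L[ℝ] 𝔼 N)

theorem fderiv_comp_equiv_apply {F : Type*} [NormedAddCommGroup F] [NormedSpace ℝ F]
    (g : 𝔼 N → F) (y ξ : 𝔼 N) :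
    fderiv ℝ (fun w => g (A w)) y ξ = fderiv ℝ g (A y) (A ξ) :=
  congrArg (fun T : 𝔼 N →L[ℝ] F => T ξ) (A.comp_right_fderiv (f := g) (x := y))

theorem halfHessianSq_comp_equiv (h : 𝔼 N → ℝ) (y ξ η : 𝔼 N) :
    halfHessianSq (fun w => h (A w)) y ξ η = halfHessianSq h (A y) (A ξ) (A η) := by
  simp only [halfHessianSq, fderiv_comp_equiv_apply A fun w => h w ^ 2]
  rw [fderiv_comp_equiv_apply A fun z => fderiv ℝ (fun w => h w ^ 2) z (A ξ)]

theorem IsConicNorm.comp_equiv (hh : IsConicNorm D h) :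
    IsConicNorm {y | A y ∈ D} fun y => h (A y) where
  isOpen := hh.isOpen.preimage A.continuous
  ne_zero y hy h0 := hh.ne_zero _ hy (by rw [h0, map_zero])
  conic y hy k hk := by simpa only [mem_ofPred_eq, map_smul] using hh.conic _ hy k hk
  smooth := hh.smooth.comp A.contDiff.contDiffOn fun _ hy => hy
  pos y hy := hh.pos _ hy
  homogeneous y hy k hk := by rw [map_smul, hh.homogeneous _ hy k hk]
  posDef y hy ξ hξ := by
    rw [halfHessianSq_comp_equiv]
    exact hh.posDef _ hy _ ((map_ne_zero_iff A A.injective).2 hξ)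

theorem HasUnitCurvature.comp_equiv {K : ℝ} (hK : HasUnitCurvature n D h K) :
    HasUnitCurvature n {y | A y ∈ D} (fun y => h (A y)) K := by
  intro V φ hφ
  have hderiv (u v : 𝔼 n) : fderiv ℝ (fun u => A (φ u)) u v = A (fderiv ℝ φ u v) :=
    congrArg (fun T : 𝔼 n →L[ℝ] 𝔼 N => T v) (A.comp_fderiv (f := φ) (x := u))
  have hparam : IsUnitParam D h V fun u => A (φ u) :=
    { isOpen := hφ.isOpen
      smooth := A.contDiff.comp_contDiffOn hφ.smooth
      mem := hφ.mem
      unit := hφ.unit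
      immersion := fun u hu v w hvw => by
        rw [hderiv, hderiv] at hvw
        exact hφ.immersion u hu (A.injective hvw) }
  have hmetric : fiberMetric (fun y => h (A y)) φ = fiberMetric h fun u => A (φ u) := by
    ext u i j
    simp only [fiberMetric, Matrix.of_apply, hderiv, halfHessianSq_comp_equiv]
  rw [hmetric]
  exact hK V _ hparam

theorem IsConformalMapOn.comp_equiv {E G : Type*} [NormedAddCommGroup E] [NormedSpace ℝ E]
    [NormedAddCommGroup G] [NormedSpace ℝ G] {s : G →L[ℝ] G →L[ℝ] ℝ} (B : E →L[ℝ] G) {H : ℝ}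
    {W : Set (𝔼 N)} {c : 𝔼 N → E} {q : 𝔼 N → ℝ}
    (hc : IsConformalMapOn D h (s.bilinearComp B B) H W c q) :
    IsConformalMapOn {y | A y ∈ D} (fun y => h (A y)) s H {y | A y ∈ W} (fun y => B (c (A y)))
      fun y => q (A y) where
  isOpen := hc.isOpen.preimage A.continuous
  subset y hy := hc.subset hy
  conic y hy k hk := by simpa only [mem_ofPred_eq, map_smul] using hc.conic _ hy k hk
  smooth := B.contDiff.comp_contDiffOn (hc.smooth.comp A.contDiff.contDiffOn fun _ hy => hy)
  homogeneous y hy k hk := by rw [map_smul, hc.homogeneous _ hy k hk, map_smul]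
  unit y hy hunit := hc.unit _ hy hunit
  conformal y hy ξ η := by
    have hderiv : fderiv ℝ (fun y => B (c (A y))) y =
        B.comp ((fderiv ℝ c (A y)).comp (A : 𝔼 N →L[ℝ] 𝔼 N)) :=
      (B.hasFDerivAt.comp y ((hc.hasFDerivAt hy).comp y A.hasFDerivAt)).fderiv
    rw [halfHessianSq_comp_equiv, hc.conformal _ hy, hderiv]
    rfl

end LinearChange

section Fibers

open Bundle

variable {N : ℕ} {M : Type*} [TopologicalSpace M] [ChartedSpace (𝔼 N) M] [IsManifold (𝓡 N) ∞ M]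

/-- The linear map of `T_x M` given by the bundle chart at `x₀`. It is extended by zero to the
points `x` outside the domain of the chart. -/
def fiberCoord (x₀ x : M) : 𝔼 N →L[ℝ] 𝔼 N :=
  (trivializationAt (𝔼 N) (TangentSpace (𝓡 N)) x₀).continuousLinearMapAt ℝ x

/-- The linear map to `T_x M` given by the bundle chart at `x₀`. It is extended by zero to the
points `x` outside the domain of the chart. -/
def fiberCoordSymm (x₀ x : M) : 𝔼 N →L[ℝ] 𝔼 N :=
  (trivializationAt (𝔼 N) (TangentSpace (𝓡 N)) x₀).symmL ℝ x

/-- The linear equivalence of `T_x M` given by the bundle chart at `x₀`. -/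
def fiberEquiv {x₀ x : M} (hx : x ∈ (chartAt (𝔼 N) x₀).source) : 𝔼 N ≃L[ℝ] 𝔼 N :=
  ContinuousLinearEquiv.equivOfInverse (fiberCoord x₀ x) (fiberCoordSymm x₀ x)
    ((trivializationAt (𝔼 N) (TangentSpace (𝓡 N)) x₀).symmL_continuousLinearMapAt hx)
    ((trivializationAt (𝔼 N) (TangentSpace (𝓡 N)) x₀).continuousLinearMapAt_symmL hx)

variable {x₀ x : M}

theorem fiberCoordSymm_fiberCoord (hx : x ∈ (chartAt (𝔼 N) x₀).source) (y : 𝔼 N) :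
    fiberCoordSymm x₀ x (fiberCoord x₀ x y) = y :=
  (fiberEquiv hx).symm_apply_apply y

theorem fiberCoord_fiberCoordSymm (hx : x ∈ (chartAt (𝔼 N) x₀).source) (y : 𝔼 N) :
    fiberCoord x₀ x (fiberCoordSymm x₀ x y) = y :=
  (fiberEquiv hx).apply_symm_apply y

theorem trivializationAt_snd (hx : x ∈ (chartAt (𝔼 N) x₀).source) (y : TangentSpace (𝓡 N) x) :
    (trivializationAt (𝔼 N) (TangentSpace (𝓡 N)) x₀ ⟨x, y⟩).2 = fiberCoord x₀ x y :=
  ((trivializationAt (𝔼 N) (TangentSpace (𝓡 N)) x₀).continuousLinearMapAt_apply_of_mem ℝ hx y).symm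

variable (x) in
theorem contMDiff_fiber_inclusion : ContMDiff 𝓘(ℝ, 𝔼 N) (𝓡 N).tangent ∞
    fun w : 𝔼 N => (⟨x, w⟩ : TangentBundle (𝓡 N) M) := by
  intro w
  rw [contMDiffAt_totalSpace]
  refine ⟨contMDiffAt_const, ?_⟩
  refine ((fiberCoord x x).contDiff.contMDiff.contMDiffAt (x := w)).congr_of_eventuallyEq ?_
  exact Eventually.of_forall fun w => trivializationAt_snd (mem_chart_source _ x) w

theorem isOpen_fiber_tangentBundle {W : Set (TangentBundle (𝓡 N) M)} (hW : IsOpen W) (x : M) :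
    IsOpen {w : 𝔼 N | (⟨x, w⟩ : TangentBundle (𝓡 N) M) ∈ W} :=
  hW.preimage (contMDiff_fiber_inclusion x).continuous

theorem contDiffOn_fiber_of_totalMap {C : (x : M) → TangentSpace (𝓡 N) x → TangentSpace (𝓡 N) x}
    {W : Set (TangentBundle (𝓡 N) M)}
    (hC : ContMDiffOn (𝓡 N).tangent (𝓡 N).tangent ∞ (totalMap C) W) (x : M) :
    ContDiffOn ℝ ∞ (F := 𝔼 N) (fun w : 𝔼 N => C x w)
      {w | (⟨x, w⟩ : TangentBundle (𝓡 N) M) ∈ W} := by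
  have htotal : ContMDiffOn 𝓘(ℝ, 𝔼 N) (𝓡 N).tangent ∞
      (fun w : 𝔼 N => (⟨x, C x w⟩ : TangentBundle (𝓡 N) M))
      {w | (⟨x, w⟩ : TangentBundle (𝓡 N) M) ∈ W} :=
    hC.comp (contMDiff_fiber_inclusion x).contMDiffOn fun w hw => hw
  have hcoord : ContMDiffOn 𝓘(ℝ, 𝔼 N) 𝓘(ℝ, 𝔼 N) ∞ (fun w : 𝔼 N => fiberCoord x x (C x w))
      {w | (⟨x, w⟩ : TangentBundle (𝓡 N) M) ∈ W} := fun w hw =>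
    (contMDiffWithinAt_totalSpace.1 (htotal w hw)).2.congr
      (fun z _ => (trivializationAt_snd (mem_chart_source _ x) _).symm)
      (trivializationAt_snd (mem_chart_source _ x) _).symm
  exact ((fiberCoordSymm x x).contDiff.comp_contDiffOn hcoord.contDiffOn).congr fun w _ =>
    (fiberCoordSymm_fiberCoord (mem_chart_source _ x) _).symm

/-- The admissible tangent vectors at a point. -/
def FinslerSpace.fiberDomain (Φ : FinslerSpace N M) (x : M) : Set (𝔼 N) :=
  {w | (⟨x, w⟩ : TangentBundle (𝓡 N) M) ∈ Φ.domain}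

/-- The Finsler metric function on a tangent space. -/
def FinslerSpace.fiberNorm (Φ : FinslerSpace N M) (x : M) (w : 𝔼 N) : ℝ := Φ.F ⟨x, w⟩

theorem FinslerSpace.isConicNorm (Φ : FinslerSpace N M) (x : M) :
    IsConicNorm (Φ.fiberDomain x) (Φ.fiberNorm x) where
  isOpen := isOpen_fiber_tangentBundle Φ.isOpen_domain x
  ne_zero _ hy := Φ.ne_zero _ hy
  conic _ hy k hk := Φ.conic _ hy k hk
  smooth := (Φ.smooth.comp (contMDiff_fiber_inclusion x).contMDiffOn fun _ hw => hw).contDiffOn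
  pos _ hy := Φ.pos _ hy
  homogeneous _ hy k hk := Φ.homogeneous _ hy k hk
  posDef _ hy := Φ.posDef _ hy

theorem FinslerSpace.indicatrixHasConstantCurvature_iff (Φ : FinslerSpace N M) (K : M → ℝ) :
    Φ.IndicatrixHasConstantCurvature K ↔
      ∀ x, HasUnitCurvature (N - 1) (Φ.fiberDomain x) (Φ.fiberNorm x) (K x) := by
  refine forall_congr' fun x => forall₂_congr fun V φ => ⟨fun h hφ => ?_, fun h hφ => ?_⟩
  · exact h ⟨hφ.isOpen, hφ.smooth, fun u hu => ⟨hφ.mem u hu, hφ.unit u hu⟩, hφ.immersion⟩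
  · exact h ⟨hφ.isOpen, hφ.smooth, fun u hu => (hφ.mapsTo hu).1, fun u hu => (hφ.mapsTo hu).2,
      hφ.immersion⟩

theorem isInnerProduct_inner (S : RiemMetric N M) (x : M) : IsInnerProduct (E := 𝔼 N) (S.inner x) :=
  ⟨S.symm x, S.pos x⟩

namespace IsConformalAutomorphismOn

variable {Φ : FinslerSpace N M} {S : RiemMetric N M} {H : M → ℝ}
  {W : Set (TangentBundle (𝓡 N) M)} {C : (x : M) → TangentSpace (𝓡 N) x → TangentSpace (𝓡 N) x}
  {q : TangentBundle (𝓡 N) M → ℝ}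

theorem isConformalMapOn (hC : IsConformalAutomorphismOn Φ S H W C q) (x : M) :
    IsConformalMapOn (E := 𝔼 N) (Φ.fiberDomain x) (Φ.fiberNorm x) (S.inner x) (H x)
      {w | (⟨x, w⟩ : TangentBundle (𝓡 N) M) ∈ W} (C x) fun w => q ⟨x, w⟩ where
  isOpen := isOpen_fiber_tangentBundle hC.isOpen x
  subset _ hw := hC.subset hw
  conic _ hw := hC.conic _ hw
  smooth := contDiffOn_fiber_of_totalMap hC.smooth x
  homogeneous _ hw := hC.homogeneous _ hw
  unit _ hw := hC.unit _ hw
  conformal _ hw := hC.conformal _ hw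

theorem of_isConformalMapOn (hW : IsOpen W)
    (hC : ContMDiffOn (𝓡 N).tangent (𝓡 N).tangent ∞ (totalMap C) W) (hq : ∀ v ∈ W, 0 < q v)
    (hfiber : ∀ v ∈ W, InjOn (C v.1) {w | (⟨v.1, w⟩ : TangentBundle (𝓡 N) M) ∈ W} ∧
      IsConformalMapOn (E := 𝔼 N) (Φ.fiberDomain v.1) (Φ.fiberNorm v.1) (S.inner v.1) (H v.1)
        {w | (⟨v.1, w⟩ : TangentBundle (𝓡 N) M) ∈ W} (C v.1) fun w => q ⟨v.1, w⟩) :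
    IsConformalAutomorphismOn Φ S H W C q where
  isOpen := hW
  subset v hv := (hfiber v hv).2.subset hv
  conic v hv := (hfiber v hv).2.conic _ hv
  smooth := hC
  injective := by
    rintro ⟨x, y⟩ hy ⟨x', z⟩ hz heq
    obtain rfl : x = x' := congrArg TotalSpace.proj heq
    rw [(hfiber _ hy).1 hy hz (eq_of_heq (TotalSpace.mk.inj heq).2)]
  homogeneous v hv := (hfiber v hv).2.homogeneous _ hv
  unit v hv := (hfiber v hv).2.unit _ hv
  multiplier_pos := hq
  conformal v hv := (hfiber v hv).2.conformal _ hv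

theorem multiplier_eq (hC : IsConformalAutomorphismOn Φ S H W C q) (hH : ∀ x, H x ≠ 0)
    {v : TangentBundle (𝓡 N) M} (hv : v ∈ W) :
    q v = (1 / H v.1 * Φ.F v ^ (1 - H v.1)) ^ 2 :=
  (hC.isConformalMapOn v.1).multiplier_eq (Φ.isConicNorm v.1) (hH v.1) hv

end IsConformalAutomorphismOn

theorem IsConformallyAutomorphic.indicatrixHasConstantCurvature (hN : 1 ≤ N)
    {Φ : FinslerSpace N M} {S : RiemMetric N M} {H : M → ℝ} (h : IsConformallyAutomorphic Φ S H) :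
    Φ.IndicatrixHasConstantCurvature fun x => H x ^ 2 := by
  refine (Φ.indicatrixHasConstantCurvature_iff _).2 fun x =>
    hasUnitCurvature_of_isConformalMapOn (Φ.isConicNorm x) (isInnerProduct_inner S x)
      (by simp; omega) (h.1 x).ne' fun y hy => ?_
  obtain ⟨W, C, q, hvW, hC⟩ := h.2 _ hy
  exact ⟨_, C x, _, hvW, hC.isConformalMapOn x⟩

end Fibers

/-! ### Bundle charts of the tangent bundle -/

section Coordinates

open Bundle

variable {N : ℕ} {M : Type*} [TopologicalSpace M] [ChartedSpace (𝔼 N) M]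

theorem extChartAt_symm_mem_chartAt_source {x₀ : M} {p : 𝔼 N}
    (hp : p ∈ (extChartAt (𝓡 N) x₀).target) :
    (extChartAt (𝓡 N) x₀).symm p ∈ (chartAt (𝔼 N) x₀).source := by
  rw [← extChartAt_source (𝓡 N)]
  exact (extChartAt (𝓡 N) x₀).map_target hp

variable [IsManifold (𝓡 N) ∞ M] (v₀ : TangentBundle (𝓡 N) M) {x : M}

theorem mem_tangent_extChartAt_source {v : TangentBundle (𝓡 N) M} :
    v ∈ (extChartAt (𝓡 N).tangent v₀).source ↔ v.1 ∈ (chartAt (𝔼 N) v₀.1).source := by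
  rw [extChartAt_source]
  exact TangentBundle.mem_chart_source_iff _ _

theorem tangent_extChartAt_apply (hx : x ∈ (chartAt (𝔼 N) v₀.1).source) (w : 𝔼 N) :
    extChartAt (𝓡 N).tangent v₀ ⟨x, w⟩ = (extChartAt (𝓡 N) v₀.1 x, fiberCoord v₀.1 x w) := by
  rw [FiberBundle.extChartAt]
  exact Prod.ext rfl (trivializationAt_snd hx w)

theorem tangent_extChartAt_symm_apply (hx : x ∈ (chartAt (𝔼 N) v₀.1).source) (w : 𝔼 N) :
    (extChartAt (𝓡 N).tangent v₀).symm (extChartAt (𝓡 N) v₀.1 x, w) =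
      ⟨x, fiberCoordSymm v₀.1 x w⟩ := by
  rw [← fiberCoord_fiberCoordSymm hx w, ← tangent_extChartAt_apply v₀ hx,
    fiberCoord_fiberCoordSymm hx]
  exact (extChartAt (𝓡 N).tangent v₀).left_inv ((mem_tangent_extChartAt_source v₀).2 hx)

theorem mem_tangent_extChartAt_target {q : 𝔼 N × 𝔼 N} :
    q ∈ (extChartAt (𝓡 N).tangent v₀).target ↔
      ∃ x ∈ (chartAt (𝔼 N) v₀.1).source, extChartAt (𝓡 N) v₀.1 x = q.1 := by
  constructor
  · intro hq
    have hsource := (mem_tangent_extChartAt_source v₀).1 ((extChartAt _ v₀).map_target hq)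
    refine ⟨_, hsource, ?_⟩
    conv_rhs => rw [← (extChartAt (𝓡 N).tangent v₀).right_inv hq]
    exact (congrArg Prod.fst (tangent_extChartAt_apply v₀ hsource _)).symm
  · obtain ⟨p, w⟩ := q
    rintro ⟨x, hx, rfl⟩
    rw [← fiberCoord_fiberCoordSymm hx w, ← tangent_extChartAt_apply v₀ hx]
    exact (extChartAt (𝓡 N).tangent v₀).map_source ((mem_tangent_extChartAt_source v₀).2 hx)

/-- The components of a Riemannian metric in the bundle chart at `x₀`. -/
def metricCoord (S : RiemMetric N M) (x₀ x : M) : 𝔼 N →L[ℝ] 𝔼 N →L[ℝ] ℝ :=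
  (S.inner x : 𝔼 N →L[ℝ] 𝔼 N →L[ℝ] ℝ).bilinearComp (fiberCoordSymm x₀ x) (fiberCoordSymm x₀ x)

theorem isInnerProduct_metricCoord (S : RiemMetric N M) {x₀ : M}
    (hx : x ∈ (chartAt (𝔼 N) x₀).source) : IsInnerProduct (metricCoord S x₀ x) :=
  (isInnerProduct_inner S x).comp_injective (fiberEquiv hx).symm.injective

theorem contMDiffOn_fiberCoordSymm (w : 𝔼 N) : ContMDiffOn 𝓘(ℝ, 𝔼 N) (𝓡 N).tangent ∞
    (fun p => (⟨(extChartAt (𝓡 N) v₀.1).symm p,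
      fiberCoordSymm v₀.1 ((extChartAt (𝓡 N) v₀.1).symm p) w⟩ : TangentBundle (𝓡 N) M))
    (extChartAt (𝓡 N) v₀.1).target := by
  have hconst : ContMDiffOn 𝓘(ℝ, 𝔼 N) 𝓘(ℝ, 𝔼 N × 𝔼 N) ∞ (fun p : 𝔼 N => (p, w))
      (extChartAt (𝓡 N) v₀.1).target := (contDiff_prodMk_left w).contMDiff.contMDiffOn
  refine ((contMDiffOn_extChartAt_symm v₀).comp hconst fun p hp =>
    (mem_tangent_extChartAt_target v₀).2
      ⟨_, extChartAt_symm_mem_chartAt_source hp, (extChartAt (𝓡 N) v₀.1).right_inv hp⟩).congr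
    fun p hp => ?_
  rw [← tangent_extChartAt_symm_apply v₀ (extChartAt_symm_mem_chartAt_source hp),
    (extChartAt (𝓡 N) v₀.1).right_inv hp]
  rfl

theorem contDiffOn_metricCoord (S : RiemMetric N M) : ContDiffOn ℝ ∞
    (fun p => metricCoord S v₀.1 ((extChartAt (𝓡 N) v₀.1).symm p))
    (extChartAt (𝓡 N) v₀.1).target := by
  refine contDiffOn_clm_apply.2 fun v => contDiffOn_clm_apply.2 fun w => ?_
  have hS := S.contMDiff.comp_contMDiffOn (contMDiffOn_extChartAt_symm (I := 𝓡 N) (n := ∞) v₀.1)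
  have happly := hS.clm_bundle_apply₂ (F₃ := ℝ) (E₃ := fun _ : M => ℝ)
    (contMDiffOn_fiberCoordSymm v₀ v) (contMDiffOn_fiberCoordSymm v₀ w)
  exact ContMDiffOn.contDiffOn fun p hp => (contMDiffWithinAt_totalSpace.1 (happly p hp)).2

namespace FinslerSpace

variable (Φ : FinslerSpace N M)

/-- The domain of a Finsler metric function in the bundle chart at `v₀`. -/
def coordDomain : Set (𝔼 N × 𝔼 N) :=
  (extChartAt (𝓡 N).tangent v₀).target ∩ (extChartAt (𝓡 N).tangent v₀).symm ⁻¹' Φ.domain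

/-- A Finsler metric function in the bundle chart at `v₀`. -/
def coordNorm (q : 𝔼 N × 𝔼 N) : ℝ := Φ.F ((extChartAt (𝓡 N).tangent v₀).symm q)

theorem fiber_coordDomain (hx : x ∈ (chartAt (𝔼 N) v₀.1).source) :
    {y | (extChartAt (𝓡 N) v₀.1 x, y) ∈ Φ.coordDomain v₀} =
      {y | (fiberEquiv hx).symm y ∈ Φ.fiberDomain x} := by
  ext y
  rw [mem_ofPred_eq, coordDomain, mem_inter_iff, mem_preimage, tangent_extChartAt_symm_apply v₀ hx]
  exact and_iff_right ((mem_tangent_extChartAt_target v₀).2 ⟨x, hx, rfl⟩)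

theorem coordNorm_extChartAt (hx : x ∈ (chartAt (𝔼 N) v₀.1).source) (y : 𝔼 N) :
    Φ.coordNorm v₀ (extChartAt (𝓡 N) v₀.1 x, y) = Φ.fiberNorm x ((fiberEquiv hx).symm y) := by
  rw [coordNorm, tangent_extChartAt_symm_apply v₀ hx]
  rfl

theorem exists_extChartAt_eq_of_mem_coordDomain {q : 𝔼 N × 𝔼 N} (hq : q ∈ Φ.coordDomain v₀) :
    ∃ x ∈ (chartAt (𝔼 N) v₀.1).source, extChartAt (𝓡 N) v₀.1 x = q.1 :=
  (mem_tangent_extChartAt_target v₀).1 hq.1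

theorem mapsTo_fst_coordDomain :
    MapsTo Prod.fst (Φ.coordDomain v₀) (extChartAt (𝓡 N) v₀.1).target := by
  intro q hq
  obtain ⟨x, hx, hxq⟩ := Φ.exists_extChartAt_eq_of_mem_coordDomain v₀ hq
  rw [← hxq]
  exact (extChartAt (𝓡 N) v₀.1).map_source (by rwa [extChartAt_source])

theorem isConicNorm_coord (p : 𝔼 N) :
    IsConicNorm {y | (p, y) ∈ Φ.coordDomain v₀} fun y => Φ.coordNorm v₀ (p, y) := by
  rcases eq_empty_or_nonempty {y | (p, y) ∈ Φ.coordDomain v₀} with hempty | ⟨y, hy⟩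
  · rw [hempty]
    exact ⟨isOpen_empty, by simp, by simp, contDiffOn_empty, by simp, by simp, by simp⟩
  · obtain ⟨x, hx, rfl⟩ := Φ.exists_extChartAt_eq_of_mem_coordDomain v₀ hy
    simp only [Φ.fiber_coordDomain v₀ hx, Φ.coordNorm_extChartAt v₀ hx]
    exact (Φ.isConicNorm x).comp_equiv (fiberEquiv hx).symm

theorem isConicNormFamily : IsConicNormFamily (Φ.coordDomain v₀) (Φ.coordNorm v₀) where
  isOpen := (continuousOn_extChartAt_symm v₀).isOpen_inter_preimage (isOpen_extChartAt_target v₀)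
    Φ.isOpen_domain
  smooth := (Φ.smooth.comp ((contMDiffOn_extChartAt_symm v₀).mono inter_subset_left)
    fun _ hq => hq.2).contDiffOn
  isConicNorm := Φ.isConicNorm_coord v₀

theorem hasUnitCurvature_coord {n : ℕ} {K : M → ℝ}
    (hK : ∀ x, HasUnitCurvature n (Φ.fiberDomain x) (Φ.fiberNorm x) (K x)) (p : 𝔼 N) :
    HasUnitCurvature n {y | (p, y) ∈ Φ.coordDomain v₀} (fun y => Φ.coordNorm v₀ (p, y))
      (K ((extChartAt (𝓡 N) v₀.1).symm p)) := by
  intro V φ hφ u hu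
  obtain ⟨x, hx, rfl⟩ := Φ.exists_extChartAt_eq_of_mem_coordDomain v₀ (hφ.mem u hu)
  simp only [Φ.fiber_coordDomain v₀ hx, Φ.coordNorm_extChartAt v₀ hx] at hφ ⊢
  rw [(extChartAt (𝓡 N) v₀.1).left_inv (by rwa [extChartAt_source])]
  exact (hK x).comp_equiv (fiberEquiv hx).symm V φ hφ u hu

end FinslerSpace

/-- The family of maps of the tangent spaces which is given by the family `c (p, ·)` in the bundle
chart at `v₀`. -/
def fiberMapOfCoord (c : 𝔼 N × 𝔼 N → 𝔼 N) (x : M) (w : TangentSpace (𝓡 N) x) :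
    TangentSpace (𝓡 N) x :=
  fiberCoordSymm v₀.1 x (c (extChartAt (𝓡 N) v₀.1 x, fiberCoord v₀.1 x w))

variable {v₀} {c : 𝔼 N × 𝔼 N → 𝔼 N} {W : Set (𝔼 N × 𝔼 N)}

theorem contMDiffOn_totalMap_fiberMapOfCoord (hc : ContDiffOn ℝ ∞ c W) :
    ContMDiffOn (𝓡 N).tangent (𝓡 N).tangent ∞ (totalMap (fiberMapOfCoord v₀ c))
      ((extChartAt (𝓡 N).tangent v₀).source ∩ extChartAt (𝓡 N).tangent v₀ ⁻¹' W) := by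
  have hchart : ContMDiffOn (𝓡 N).tangent 𝓘(ℝ, 𝔼 N × 𝔼 N) ∞ (extChartAt (𝓡 N).tangent v₀)
      ((extChartAt (𝓡 N).tangent v₀).source ∩ extChartAt (𝓡 N).tangent v₀ ⁻¹' W) :=
    contMDiffOn_extChartAt.mono fun v hv => (extChartAt_source (𝓡 N).tangent v₀).subset hv.1
  have hmap : ContMDiffOn 𝓘(ℝ, 𝔼 N × 𝔼 N) 𝓘(ℝ, 𝔼 N × 𝔼 N) ∞ (fun q : 𝔼 N × 𝔼 N => (q.1, c q)) W :=
    (contDiff_fst.contDiffOn.prodMk hc).contMDiffOn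
  have happly (v : TangentBundle (𝓡 N) M) (hv : v ∈ (extChartAt (𝓡 N).tangent v₀).source) :
      extChartAt (𝓡 N).tangent v₀ v = (extChartAt (𝓡 N) v₀.1 v.1, fiberCoord v₀.1 v.1 v.2) :=
    tangent_extChartAt_apply v₀ ((mem_tangent_extChartAt_source v₀).1 hv) v.2
  refine ((contMDiffOn_extChartAt_symm v₀).comp (hmap.comp hchart fun v hv => hv.2)
    fun v hv => ?_).congr fun v hv => ?_
  · refine (mem_tangent_extChartAt_target v₀).2
      ⟨v.1, (mem_tangent_extChartAt_source v₀).1 hv.1, ?_⟩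
    exact (congrArg Prod.fst (happly v hv.1)).symm
  · simp only [Function.comp_apply, happly v hv.1]
    exact (tangent_extChartAt_symm_apply v₀ ((mem_tangent_extChartAt_source v₀).1 hv.1) _).symm

theorem fiber_preimage_extChartAt {x : M} (hx : x ∈ (chartAt (𝔼 N) v₀.1).source) :
    {w : 𝔼 N | (⟨x, w⟩ : TangentBundle (𝓡 N) M) ∈
      (extChartAt (𝓡 N).tangent v₀).source ∩ extChartAt (𝓡 N).tangent v₀ ⁻¹' W} =
      {w | fiberEquiv hx w ∈ {y | (extChartAt (𝓡 N) v₀.1 x, y) ∈ W}} := by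
  refine Set.ext fun w => ?_
  rw [mem_ofPred_eq, mem_inter_iff, mem_preimage, tangent_extChartAt_apply v₀ hx w]
  exact and_iff_right ((mem_tangent_extChartAt_source v₀).2 hx)

theorem injOn_fiberMapOfCoord {x : M} (hx : x ∈ (chartAt (𝔼 N) v₀.1).source) {Y : Set (𝔼 N)}
    (hinj : InjOn (fun y => c (extChartAt (𝓡 N) v₀.1 x, y)) Y) :
    InjOn (fiberMapOfCoord v₀ c x) {w | fiberEquiv hx w ∈ Y} := fun _ hy _ hz heq =>
  (fiberEquiv hx).injective (hinj hy hz ((fiberEquiv hx).symm.injective heq))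

theorem isConformalMapOn_fiberMapOfCoord {Φ : FinslerSpace N M} {S : RiemMetric N M} {x : M}
    (hx : x ∈ (chartAt (𝔼 N) v₀.1).source) {H : ℝ} {Y : Set (𝔼 N)} {q : ℝ → ℝ}
    (hc : IsConformalMapOn {y | (extChartAt (𝓡 N) v₀.1 x, y) ∈ Φ.coordDomain v₀}
      (fun y => Φ.coordNorm v₀ (extChartAt (𝓡 N) v₀.1 x, y)) (metricCoord S v₀.1 x) H Y
      (fun y => c (extChartAt (𝓡 N) v₀.1 x, y))
      fun y => q (Φ.coordNorm v₀ (extChartAt (𝓡 N) v₀.1 x, y))) :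
    IsConformalMapOn (E := 𝔼 N) (Φ.fiberDomain x) (Φ.fiberNorm x) (S.inner x) H
      {w | fiberEquiv hx w ∈ Y} (fiberMapOfCoord v₀ c x) fun w => q (Φ.fiberNorm x w) := by
  simp only [Φ.fiber_coordDomain v₀ hx, Φ.coordNorm_extChartAt v₀ hx] at hc
  have hcomp := hc.comp_equiv (fiberEquiv hx) (fiberCoordSymm v₀.1 x)
  simp only [mem_ofPred_eq, ContinuousLinearEquiv.symm_apply_apply, Set.ofPred_mem_eq] at hcomp
  exact hcomp

theorem exists_isConformalAutomorphismOn (hN : 3 ≤ N) {Φ : FinslerSpace N M} {K : M → ℝ}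
    (hKpos : ∀ x, 0 < K x) (hK : Φ.IndicatrixHasConstantCurvature K) (S : RiemMetric N M)
    (hv₀ : v₀ ∈ Φ.domain) : ∃ W C q, v₀ ∈ W ∧
      IsConformalAutomorphismOn Φ S (fun x => √(K x)) W C q := by
  have hinner (p : 𝔼 N) (hp : p ∈ (extChartAt (𝓡 N) v₀.1).target) :
      IsInnerProduct (metricCoord S v₀.1 ((extChartAt (𝓡 N) v₀.1).symm p)) :=
    isInnerProduct_metricCoord S (extChartAt_symm_mem_chartAt_source hp)
  have hmem : extChartAt (𝓡 N).tangent v₀ v₀ ∈ Φ.coordDomain v₀ :=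
    ⟨mem_extChartAt_target v₀, by rwa [mem_preimage, extChartAt_to_inv]⟩
  obtain ⟨W, c, hW, hv₀W, -, hc, hfiber⟩ := (Φ.isConicNormFamily v₀).exists_isConformalMapOn
    (n := N - 1) (by omega) (by omega) (fun q _ => hKpos ((extChartAt (𝓡 N) v₀.1).symm q.1))
    (Φ.hasUnitCurvature_coord v₀ ((Φ.indicatrixHasConstantCurvature_iff K).1 hK))
    (Φ.mapsTo_fst_coordDomain v₀) finrank_euclideanSpace_fin (contDiffOn_metricCoord v₀ S)
    hinner hmem
  let C := fiberMapOfCoord v₀ c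
  let V := (extChartAt (𝓡 N).tangent v₀).source ∩ extChartAt (𝓡 N).tangent v₀ ⁻¹' W
  have hV (v : TangentBundle (𝓡 N) M) (hv : v ∈ V) :
      InjOn (C v.1) {w : 𝔼 N | ⟨v.1, w⟩ ∈ V} ∧
        IsConformalMapOn (E := 𝔼 N) (Φ.fiberDomain v.1) (Φ.fiberNorm v.1) (S.inner v.1) √(K v.1)
          {w : 𝔼 N | ⟨v.1, w⟩ ∈ V} (C v.1)
          fun w => (1 / √(K v.1) * Φ.fiberNorm v.1 w ^ (1 - √(K v.1))) ^ 2 := by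
    have hx := (mem_tangent_extChartAt_source v₀).1 hv.1
    have hfst : (extChartAt (𝓡 N).tangent v₀ v).1 = extChartAt (𝓡 N) v₀.1 v.1 :=
      congrArg Prod.fst (tangent_extChartAt_apply v₀ hx v.2)
    have hvW := hfiber _ hv.2
    rw [hfst, (extChartAt (𝓡 N) v₀.1).left_inv (by rwa [extChartAt_source])] at hvW
    refine ⟨(injOn_fiberMapOfCoord hx hvW.1).mono (fiber_preimage_extChartAt hx).subset, ?_⟩
    rw [fiber_preimage_extChartAt hx]
    exact isConformalMapOn_fiberMapOfCoord
      (q := fun t => (1 / √(K v.1) * t ^ (1 - √(K v.1))) ^ 2) hx hvW.2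
  refine ⟨V, C, fun v => (1 / √(K v.1) * Φ.F v ^ (1 - √(K v.1))) ^ 2,
    ⟨mem_extChartAt_source v₀, hv₀W⟩, .of_isConformalMapOn
    ((continuousOn_extChartAt v₀).isOpen_inter_preimage (isOpen_extChartAt_source v₀) hW)
    (contMDiffOn_totalMap_fiberMapOfCoord hc) (fun v hv => ?_) hV⟩
  have hF : 0 < Φ.F v := Φ.pos v ((hV v hv).2.subset hv)
  have hK : 0 < √(K v.1) := Real.sqrt_pos.2 (hKpos v.1)
  positivity

end Coordinates

/-! ### Existence of Riemannian metrics -/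

section RiemannianMetrics

open Bundle

variable {E : Type*} [NormedAddCommGroup E] [NormedSpace ℝ E]

theorem convex_setOf_isInnerProduct : Convex ℝ {s : E →L[ℝ] E →L[ℝ] ℝ | IsInnerProduct s} := by
  refine convex_iff_forall_pos.2 fun s hs t ht a b ha hb _ => ⟨fun v w => ?_, fun v hv => ?_⟩
  · simp [hs.symm v w, ht.symm v w]
  · simpa using add_pos (mul_pos ha (hs.pos v hv)) (mul_pos hb (ht.pos v hv))

theorem IsInnerProduct.exists_mul_sq_norm_le [FiniteDimensional ℝ E] {s : E →L[ℝ] E →L[ℝ] ℝ}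
    (hs : IsInnerProduct s) : ∃ m, 0 < m ∧ ∀ v, m * ‖v‖ ^ 2 ≤ s v v := by
  rcases subsingleton_or_nontrivial E with hE | hE
  · exact ⟨1, one_pos, fun v => by simp [Subsingleton.elim v 0]⟩
  have hcont : Continuous fun v => s v v := by fun_prop
  obtain ⟨v₀, hv₀, hmin⟩ := (isCompact_sphere (0 : E) 1).exists_isMinOn
    (NormedSpace.sphere_nonempty.2 zero_le_one) hcont.continuousOn
  refine ⟨s v₀ v₀, hs.pos v₀ (ne_zero_of_mem_unit_sphere ⟨v₀, hv₀⟩), fun v => ?_⟩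
  rcases eq_or_ne v 0 with rfl | hv
  · simp
  have hnorm : ‖v‖ ≠ 0 := norm_ne_zero_iff.2 hv
  have hle : s v₀ v₀ ≤ s (‖v‖⁻¹ • v) (‖v‖⁻¹ • v) := hmin (by simp [norm_smul, hnorm])
  calc s v₀ v₀ * ‖v‖ ^ 2 ≤ s (‖v‖⁻¹ • v) (‖v‖⁻¹ • v) * ‖v‖ ^ 2 := by gcongr
    _ = s v v := by
      simp only [map_smul, FunLike.coe_smul, Pi.smul_apply, smul_eq_mul]
      field_simp

theorem IsInnerProduct.isVonNBounded [FiniteDimensional ℝ E] {s : E →L[ℝ] E →L[ℝ] ℝ}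
    (hs : IsInnerProduct s) : Bornology.IsVonNBounded ℝ {v | s v v < 1} := by
  obtain ⟨m, hm, hle⟩ := hs.exists_mul_sq_norm_le
  rw [NormedSpace.isVonNBounded_iff, isBounded_iff_forall_norm_le]
  refine ⟨√(1 / m), fun v hv => Real.le_sqrt_of_sq_le ?_⟩
  rw [le_div_iff₀ hm, mul_comm]
  exact (hle v).trans (le_of_lt hv)

variable {N : ℕ} {M : Type*} [TopologicalSpace M] [ChartedSpace (𝔼 N) M] [IsManifold (𝓡 N) ∞ M]

/-- The Euclidean metric of the bundle chart at `x₀`. -/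
def chartMetric (x₀ x : M) : TangentSpace (𝓡 N) x →L[ℝ] TangentSpace (𝓡 N) x →L[ℝ] ℝ :=
  ((innerSL ℝ).bilinearComp (fiberCoord x₀ x) (fiberCoord x₀ x) : 𝔼 N →L[ℝ] 𝔼 N →L[ℝ] ℝ)

theorem isInnerProduct_chartMetric {x₀ x : M} (hx : x ∈ (chartAt (𝔼 N) x₀).source) :
    IsInnerProduct (E := 𝔼 N) (chartMetric x₀ x) :=
  IsInnerProduct.comp_injective (s := innerSL ℝ) ⟨fun v w => (real_inner_comm v w).symm,
    fun _ hv => real_inner_self_pos.2 hv⟩ (fiberEquiv hx).injective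

set_option synthInstance.maxHeartbeats 400000 in
-- The instances on the bundle of bilinear forms are found only after a long search.
theorem contMDiffOn_chartMetric (x₀ : M) :
    ContMDiffOn (𝓡 N) ((𝓡 N).prod 𝓘(ℝ, 𝔼 N →L[ℝ] 𝔼 N →L[ℝ] ℝ)) ∞
      (fun x => TotalSpace.mk' (𝔼 N →L[ℝ] 𝔼 N →L[ℝ] ℝ)
        (E := fun x : M => TangentSpace (𝓡 N) x →L[ℝ] TangentSpace (𝓡 N) x →L[ℝ] ℝ) x
        (chartMetric x₀ x)) (chartAt (𝔼 N) x₀).source := by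
  have hbase : (chartAt (𝔼 N) x₀).source ⊆ (trivializationAt (𝔼 N →L[ℝ] 𝔼 N →L[ℝ] ℝ)
      (fun x : M => TangentSpace (𝓡 N) x →L[ℝ] TangentSpace (𝓡 N) x →L[ℝ] ℝ) x₀).baseSet := by
    intro x hx
    simpa [hom_trivializationAt_baseSet] using hx
  refine ((trivializationAt (𝔼 N →L[ℝ] 𝔼 N →L[ℝ] ℝ)
    (fun x : M => TangentSpace (𝓡 N) x →L[ℝ] TangentSpace (𝓡 N) x →L[ℝ] ℝ)
      x₀).contMDiffOn_section_iff (chartAt (𝔼 N) x₀).open_source hbase).2 ?_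
  refine (contMDiffOn_const (M' := 𝔼 N →L[ℝ] 𝔼 N →L[ℝ] ℝ) (c := innerSL ℝ)).congr fun x hx => ?_
  rw [hom_trivializationAt_apply]
  ext v w
  rw [inCoordinates_apply_eq₂ hx hx (mem_univ _)]
  have hcoord (v : 𝔼 N) : fiberCoord x₀ x
      ((trivializationAt (𝔼 N) (TangentSpace (𝓡 N)) x₀).symm x v) = v := by
    rw [← Trivialization.symmL_apply (R := ℝ) _ hx]
    exact fiberCoord_fiberCoordSymm hx v
  have hmetric : chartMetric x₀ x ((trivializationAt (𝔼 N) (TangentSpace (𝓡 N)) x₀).symm x v)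
      ((trivializationAt (𝔼 N) (TangentSpace (𝓡 N)) x₀).symm x w) = innerSL ℝ v w :=
    congrArg₂ (inner ℝ) (hcoord v) (hcoord w)
  exact Eq.trans (by simp) hmetric

set_option synthInstance.maxHeartbeats 400000 in
-- The instances on the bundle of bilinear forms are found only after a long search.
theorem nonempty_riemMetric [T2Space M] [SigmaCompactSpace M] : Nonempty (RiemMetric N M) := by
  obtain ⟨S, hS⟩ := exists_contMDiffSection_forall_mem_convex_of_local (𝓡 N) (n := ⊤)
    (F_fiber := 𝔼 N →L[ℝ] 𝔼 N →L[ℝ] ℝ)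
    (V := fun x : M => TangentSpace (𝓡 N) x →L[ℝ] TangentSpace (𝓡 N) x →L[ℝ] ℝ)
    (fun x => {s : 𝔼 N →L[ℝ] 𝔼 N →L[ℝ] ℝ | IsInnerProduct s})
    (fun _ => convex_setOf_isInnerProduct)
    fun x₀ => ⟨(chartAt (𝔼 N) x₀).source, (chartAt (𝔼 N) x₀).open_source.mem_nhds
      (mem_chart_source _ _), chartMetric x₀, contMDiffOn_chartMetric x₀,
      fun x hx => isInnerProduct_chartMetric hx⟩
  exact ⟨⟨fun x => S x, fun x => (hS x).symm, fun x => (hS x).pos,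
    fun x => (hS x).isVonNBounded, S.contMDiff⟩⟩

end RiemannianMetrics

end FinslerConformal

end

theorem proposition2p1 {N : ℕ} (hN : 3 ≤ N) {M : Type*} [TopologicalSpace M]
    [T2Space M] [SigmaCompactSpace M] [ChartedSpace (EuclideanSpace ℝ (Fin N)) M]
    [IsManifold (𝓡 N) ∞ M] (Φ : FinslerConformal.FinslerSpace N M) :
    ((∃ (S : FinslerConformal.RiemMetric N M) (H : M → ℝ),
        FinslerConformal.IsConformallyAutomorphic Φ S H) ↔
      ∃ K : M → ℝ, (∀ x, 0 < K x) ∧ Φ.IndicatrixHasConstantCurvature K) ∧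
    (∀ (S : FinslerConformal.RiemMetric N M) (H : M → ℝ),
      FinslerConformal.IsConformallyAutomorphic Φ S H →
        Φ.IndicatrixHasConstantCurvature (fun x => H x ^ 2) ∧
        (∀ K : M → ℝ, Φ.IndicatrixHasConstantCurvature K → ∀ x, K x = H x ^ 2) ∧
        ∀ W C q, FinslerConformal.IsConformalAutomorphismOn Φ S H W C q →
          ∀ v ∈ W, q v = (1 / H v.1 * Φ.F v ^ (1 - H v.1)) ^ 2) := by
  refine ⟨⟨?_, ?_⟩, fun S H h => ⟨h.indicatrixHasConstantCurvature (by omega), fun K hK x => ?_,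
    fun W C q hC v hv => hC.multiplier_eq (fun x => (h.1 x).ne') hv⟩⟩
  · rintro ⟨S, H, h⟩
    exact ⟨fun x => H x ^ 2, fun x => pow_pos (h.1 x) 2,
      h.indicatrixHasConstantCurvature (by omega)⟩
  · rintro ⟨K, hKpos, hK⟩
    obtain ⟨S⟩ := FinslerConformal.nonempty_riemMetric (N := N) (M := M)
    exact ⟨S, fun x => √(K x), fun x => Real.sqrt_pos.2 (hKpos x), fun v hv =>
      FinslerConformal.exists_isConformalAutomorphismOn hN hKpos hK S hv⟩
  · exact FinslerConformal.HasUnitCurvature.unique (Φ.isConicNorm x) (n := N - 1) (by omega)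
      (by omega) (Φ.fiber_nonempty x) ((Φ.indicatrixHasConstantCurvature_iff K).1 hK x)
      ((Φ.indicatrixHasConstantCurvature_iff _).1
        (h.indicatrixHasConstantCurvature (by omega)) x)
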